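/- Let $Z$ be a CAT(0) cube complex. Its hyperplanes are the classes of edges under parallelism, the equivalence relation generated by being opposite edges of a square. Removing the open carrier of a hyperplane $H$ (the union of the open cells whose closure contains an edge of $H$) leaves two components, the halfspaces of $H$; the carrier of $H$ is the union of the closed cells containing an edge of $H$; and $\mathrm{Sep}(A\mid B)$ is the set of hyperplanes having $A$ in one halfspace and $B$ in the other, where a hyperplane written in place of $A$ or $B$ stands for its carrier. Let a group $G$ act freely on $Z$ by combinatorial isometries, let $\mathfrak W$ be the set of hyperplanes of $Z$, and let $\mathcal H\subseteq\mathfrak W$ be a $G$-invariant family. The collapse of $\mathcal H$ is the $G$-equivariant cellular map $c\colon Z\to Y=X(Z^{(0)},\mathfrak W\setminus\mathcal H)$ to the cube complex given by Sageev's construction: a vertex of $Y$ is a choice of one halfspace for each hyperplane in $\mathfrak W\setminus\mathcal H$ such that the chosen halfspaces pairwise intersect and each vertex of $Z$ lies in all but finitely many of them; $2^k$ distinct vertices of $Y$ span a $k$-cube if and only if their choices agree for all hyperplanes except $k$; and $c$ sends a vertex of $Z$ to the choice of the halfspaces containing it and extends affinely to cubes. The collapse $c$ is strong if for all $H\in\mathcal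 H$ and $g\in G$ with $gH\neq H$, $\mathrm{Sep}(H\mid gH)\not\subseteq\mathcal H$. Then $c$ is strong if and only if both of the following hold: 1. the map $\bar c\colon Z/G\to Y/G$ induced by $c$ is a homotopy equivalence; 2. for every vertex $y$ of $Y/G$, any two edges of the subcomplex $C=\bar c^{-1}(y)$ of $Z/G$ that are parallel in $Z/G$ (joined by a finite sequence of edges in which consecutive ones are opposite edges of a square of $Z/G$) are parallel in $C$ (joined by such a sequence whose squares lie in $C$). -/

import Mathlib

open scoped Pointwise

universe u v w

/-! ### Cube complexes -/

/-- Let `φ` send the vertices of the `n`-cube `{0,1}ⁿ` to functions on a set `W` of coordinates.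
`φ` is a *face map* if there are `n` distinct coordinates such that the `i`-th of them records exactly
the `i`-th coordinate of the cube, all other coordinates being constant.
For `W = Fin m`, `P = Bool` these are the isometric embeddings of the vertex set of the `n`-cube
as that of a subcube of the `m`-cube (the symmetries of the cube for `m = n`). -/
def IsFaceMap {n : ℕ} {W : Type u} {P : Type v} (φ : (Fin n → Bool) → W → P) : Prop :=
  ∃ σ : Fin n ↪ W, (∀ i ε δ, φ ε (σ i) = φ δ (σ i) ↔ ε i = δ i) ∧
    ∀ w, w ∉ Set.range σ → ∀ ε δ, φ ε w = φ δ w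

/-- A cube complex with vertex set `V` all of whose closed cubes embed and are determined by their
vertex sets (every CAT(0) cube complex is of this kind). It is given by its parametrised cubes:
`IsCube n φ` says that `φ : {0,1}ⁿ → V` is (the restriction to vertices of) an isometric
parametrisation of a cube of the complex. All faces, and all reparametrisations by symmetries of
the cube, are included. -/
structure CubeComplex (V : Type u) where
  IsCube : ∀ n : ℕ, ((Fin n → Bool) → V) → Prop
  injective : ∀ {n : ℕ} {φ : (Fin n → Bool) → V}, IsCube n φ → Function.Injective φ
  vertex : ∀ v : V, IsCube 0 fun _ => v
  face : ∀ {m n : ℕ} {φ : (Fin n → Bool) → V} (f : (Fin m → Bool) → (Fin n → Bool)),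
    IsFaceMap f → IsCube n φ → IsCube m (φ ∘ f)
  unique : ∀ {n : ℕ} {φ ψ : (Fin n → Bool) → V}, IsCube n φ → IsCube n ψ →
    Set.range φ = Set.range ψ → ∃ f : (Fin n → Bool) → (Fin n → Bool), IsFaceMap f ∧ ψ = φ ∘ f

/-- The basepoint `(0,…,0)` of the cube. -/
def cubeOrigin (n : ℕ) : Fin n → Bool := fun _ => false

/-- The neighbour `(0,…,1,…,0)` of the basepoint of the cube. -/
def cubeUnit {n : ℕ} (i : Fin n) : Fin n → Bool := fun j => decide (j = i)

/-- The point with coordinates `x ∈ [0,1]ⁿ` of the cube with vertices `φ`, written as a formal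
convex combination of vertices, with the multiaffine weights. -/
noncomputable def cubePoint {V : Type u} {n : ℕ} (φ : (Fin n → Bool) → V)
    (x : Fin n → unitInterval) : V →₀ ℝ :=
  ∑ ε : Fin n → Bool, Finsupp.single (φ ε) (∏ i, if ε i then (x i : ℝ) else 1 - (x i : ℝ))

theorem mapDomain_cubePoint {V : Type u} {V' : Type v} {n : ℕ} (c : V → V')
    (φ : (Fin n → Bool) → V) (x : Fin n → unitInterval) :
    (cubePoint φ x).mapDomain c = cubePoint (c ∘ φ) x := by
  simp [cubePoint, Finsupp.mapDomain_finsetSum, Finsupp.mapDomain_single]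

namespace CubeComplex

variable {V : Type u} (Z : CubeComplex V)

/-- The underlying set of the cube complex: the union of its closed cubes. The weights of a point
determine its carrier (the cube spanned by the support) and its coordinates there, so two cubes are
glued exactly along their common faces. -/
def Realization : Type u :=
  {p : V →₀ ℝ // ∃ (n : ℕ) (φ : (Fin n → Bool) → V) (x : Fin n → unitInterval),
    Z.IsCube n φ ∧ p = cubePoint φ x}

/-- The characteristic map of a parametrised cube. -/
noncomputable def charMap {n : ℕ} (φ : {φ : (Fin n → Bool) → V // Z.IsCube n φ})
    (x : Fin n → unitInterval) : Z.Realization :=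
  ⟨cubePoint φ.1 x, n, φ.1, x, φ.2, rfl⟩

/-- The topology of a cell complex: a set is open if and only if its preimages under all
characteristic maps of cubes are open. -/
noncomputable instance : TopologicalSpace Z.Realization :=
  ⨆ (n : ℕ) (φ : {φ : (Fin n → Bool) → V // Z.IsCube n φ}),
    TopologicalSpace.coinduced (Z.charMap φ) inferInstance

/-- The `1`-skeleton. -/
def graph : SimpleGraph V where
  Adj a b := ∃ φ, Z.IsCube 1 φ ∧ φ (fun _ => false) = a ∧ φ (fun _ => true) = b
  symm := ⟨by
    rintro a b ⟨φ, hφ, rfl, rfl⟩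
    refine ⟨φ ∘ fun ε i => !(ε i), Z.face _ ⟨Function.Embedding.refl _, ?_, ?_⟩ hφ, rfl, rfl⟩
    · intro i ε δ
      simp
    · intro w hw
      exact absurd ⟨w, rfl⟩ hw⟩
  loopless := ⟨by
    rintro a ⟨φ, hφ, h0, h1⟩
    have h := congrFun (Z.injective hφ (h0.trans h1.symm)) 0
    simp at h⟩

/-- The (unoriented) edges. -/
abbrev Edge : Type u := Z.graph.edgeSet

theorem adj_update {n : ℕ} {φ : (Fin n → Bool) → V} (hφ : Z.IsCube n φ) (ε : Fin n → Bool)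
    (i : Fin n) : Z.graph.Adj (φ ε) (φ (Function.update ε i (!(ε i)))) := by
  refine ⟨φ ∘ fun t => Function.update ε i (xor (t 0) (ε i)),
    Z.face _ ⟨⟨fun _ => i, fun a b _ => Subsingleton.elim a b⟩, ?_, ?_⟩ hφ, ?_, ?_⟩
  · intro j s t
    obtain rfl : j = 0 := Subsingleton.elim _ _
    change Function.update ε i (s 0 ^^ ε i) i = Function.update ε i (t 0 ^^ ε i) i ↔ _
    simp
  · intro k hk s t
    have : k ≠ i := fun h => hk ⟨0, h.symm⟩
    simp [Function.update_of_ne this]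
  · simp
  · simp

/-- The parametrised squares. -/
abbrev Square : Type u := {φ : (Fin 2 → Bool) → V // Z.IsCube 2 φ}

variable {Z} in
/-- The edge of a square joining the vertices `(0,0)` and `(1,0)`. -/
def Square.bottom (q : Z.Square) : Z.Edge :=
  ⟨s(q.1 ![false, false], q.1 ![true, false]), by
    have h := Z.adj_update q.2 ![false, false] 0
    have e : Function.update ![false, false] (0 : Fin 2) (!(![false, false] (0 : Fin 2)))
        = ![true, false] := by decide
    rw [e] at h
    exact h⟩

variable {Z} in
/-- The opposite edge of the square, joining the vertices `(0,1)` and `(1,1)`. -/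
def Square.top (q : Z.Square) : Z.Edge :=
  ⟨s(q.1 ![false, true], q.1 ![true, true]), by
    have h := Z.adj_update q.2 ![false, true] 0
    have e : Function.update ![false, true] (0 : Fin 2) (!(![false, true] (0 : Fin 2)))
        = ![true, true] := by decide
    rw [e] at h
    exact h⟩

/-! ### CAT(0) cube complexes -/

/-- Homotopy of edge paths with fixed endpoints: the equivalence relation generated by inserting or
deleting a backtrack and by pushing a path across a square. -/
inductive PathHomotopic : ∀ {a b : V}, Z.graph.Walk a b → Z.graph.Walk a b → Prop
  | refl {a b : V} (p : Z.graph.Walk a b) : PathHomotopic p p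
  | symm {a b : V} {p q : Z.graph.Walk a b} : PathHomotopic p q → PathHomotopic q p
  | trans {a b : V} {p q r : Z.graph.Walk a b} :
      PathHomotopic p q → PathHomotopic q r → PathHomotopic p r
  | cons {a b c : V} (h : Z.graph.Adj a b) {p q : Z.graph.Walk b c} :
      PathHomotopic p q → PathHomotopic (.cons h p) (.cons h q)
  | backtrack {a b c : V} (h : Z.graph.Adj a b) (h' : Z.graph.Adj b a) (p : Z.graph.Walk a c) :
      PathHomotopic (.cons h (.cons h' p)) p
  | square {c : V} (φ : (Fin 2 → Bool) → V) (hφ : Z.IsCube 2 φ)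
      (h₁ : Z.graph.Adj (φ ![false, false]) (φ ![true, false]))
      (h₂ : Z.graph.Adj (φ ![true, false]) (φ ![true, true]))
      (h₃ : Z.graph.Adj (φ ![false, false]) (φ ![false, true]))
      (h₄ : Z.graph.Adj (φ ![false, true]) (φ ![true, true]))
      (p : Z.graph.Walk (φ ![true, true]) c) :
      PathHomotopic (.cons h₁ (.cons h₂ p)) (.cons h₃ (.cons h₄ p))

/-- A cube complex is CAT(0) if it is non-empty, connected, simply connected (every edge loop is
null-homotopic), and satisfies Gromov's link condition: vertex links are flag simplicial complexes. -/
structure IsCAT0 : Prop where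
  connected : Z.graph.Connected
  simplyConnected : ∀ (a : V) (p : Z.graph.Walk a a), Z.PathHomotopic p .nil
  /-- A simplex of a link is determined by its vertices. -/
  link_simplicial : ∀ (n : ℕ) (φ ψ : (Fin n → Bool) → V), Z.IsCube n φ → Z.IsCube n ψ →
    φ (cubeOrigin n) = ψ (cubeOrigin n) → (∀ i, φ (cubeUnit i) = ψ (cubeUnit i)) → φ = ψ
  /-- Pairwise adjacent vertices of a link span a simplex. -/
  link_flag : ∀ (n : ℕ) (a : V) (b : Fin n → V), Function.Injective b →
    (∀ i, Z.graph.Adj a (b i)) →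
    (∀ i j, i ≠ j → ∃ φ, Z.IsCube 2 φ ∧ φ (cubeOrigin 2) = a ∧
      φ (cubeUnit 0) = b i ∧ φ (cubeUnit 1) = b j) →
    ∃ φ, Z.IsCube n φ ∧ φ (cubeOrigin n) = a ∧ ∀ i, φ (cubeUnit i) = b i

/-! ### Hyperplanes -/

/-- Parallelism of edges: the equivalence relation generated by being opposite in a square. -/
def parallelSetoid : Setoid Z.Edge :=
  Relation.EqvGen.setoid fun e f => ∃ q : Z.Square, e = q.bottom ∧ f = q.top

/-- Hyperplanes are the parallelism classes of edges. -/
def Hyperplane : Type u := Quotient Z.parallelSetoid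

variable {Z}

/-- The edges dual to a hyperplane. -/
def Hyperplane.dual (H : Z.Hyperplane) : Set (Sym2 V) :=
  {e | ∃ he : e ∈ Z.graph.edgeSet, (Quotient.mk Z.parallelSetoid ⟨e, he⟩ : Z.Hyperplane) = H}

/-- The vertices of the carrier of a hyperplane, the union of the closed cubes having an edge dual
to it. -/
def Hyperplane.carrier (H : Z.Hyperplane) : Set V :=
  {a | ∃ (n : ℕ) (φ : (Fin n → Bool) → V), Z.IsCube n φ ∧ a ∈ Set.range φ ∧
    ∃ ε i, s(φ ε, φ (Function.update ε i (!(ε i)))) ∈ H.dual}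

/-- The set of vertices in the same component as `a` after removal of the open carrier of `H`. -/
def Hyperplane.side (H : Z.Hyperplane) (a : V) : Set V :=
  {b | (Z.graph.deleteEdges H.dual).Reachable a b}

/-- The halfspaces of a hyperplane (as sets of vertices): the components of the complement of its
open carrier. -/
def Hyperplane.halfspaces (H : Z.Hyperplane) : Set (Set V) := Set.range H.side

/-- The separator `Sep(A | B)`: the hyperplanes with `A` in one halfspace and `B` in the other. -/
def Sep (Z : CubeComplex V) (A B : Set V) : Set Z.Hyperplane :=
  {H | ∃ s ∈ H.halfspaces, ∃ t ∈ H.halfspaces, s ≠ t ∧ A ⊆ s ∧ B ⊆ t}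

end CubeComplex

/-! ### Group actions -/

/-- The action of `G` on vertices is an action by combinatorial isometries (cellular
automorphisms) of the cube complex `Z`. -/
class CubicalAction (G : Type w) [Group G] {V : Type u} [MulAction G V] (Z : CubeComplex V) :
    Prop where
  smul_isCube : ∀ (g : G) {n : ℕ} {φ : (Fin n → Bool) → V}, Z.IsCube n φ →
    Z.IsCube n fun ε => g • φ ε

namespace CubeComplex

section Action

variable {G : Type w} [Group G] {V : Type u} [MulAction G V] (Z : CubeComplex V)
  [CubicalAction G Z]

theorem smul_adj (g : G) {a b : V} (h : Z.graph.Adj a b) : Z.graph.Adj (g • a) (g • b) := by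
  obtain ⟨φ, hφ, rfl, rfl⟩ := h
  exact ⟨_, CubicalAction.smul_isCube g hφ, rfl, rfl⟩

/-- The induced action on the cube complex, given on each cube by the isometry extending the
action on vertices. -/
noncomputable instance : MulAction G Z.Realization where
  smul g p := ⟨p.1.mapDomain (g • ·), by
    obtain ⟨n, φ, x, hφ, hp⟩ := p.2
    exact ⟨n, _, x, CubicalAction.smul_isCube g hφ, by rw [hp, mapDomain_cubePoint]; rfl⟩⟩
  one_smul p := Subtype.ext (by
    change p.1.mapDomain (fun a => (1 : G) • a) = p.1
    simp only [one_smul]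
    exact Finsupp.mapDomain_id)
  mul_smul g h p := Subtype.ext (by
    change p.1.mapDomain (fun a => (g * h) • a) = (p.1.mapDomain (h • ·)).mapDomain (g • ·)
    rw [← Finsupp.mapDomain_comp]
    congr 1
    funext a
    exact mul_smul g h a)

instance : MulAction G Z.Edge where
  smul g e := ⟨e.1.map (g • ·), by
    obtain ⟨e, he⟩ := e
    induction e with
    | _ a b => exact Z.smul_adj g he⟩
  one_smul e := Subtype.ext (by
    change e.1.map (fun a => (1 : G) • a) = e.1
    simp)
  mul_smul g h e := Subtype.ext (by
    change e.1.map (fun a => (g * h) • a) = (e.1.map (h • ·)).map (g • ·)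
    rw [Sym2.map_map]
    congr 1
    funext a
    exact mul_smul g h a)

theorem smul_parallel (g : G) {e f : Z.Edge} (h : Z.parallelSetoid e f) :
    Z.parallelSetoid (g • e) (g • f) := by
  change Relation.EqvGen _ _ _
  change Relation.EqvGen _ _ _ at h
  induction h with
  | rel e f h =>
    obtain ⟨q, rfl, rfl⟩ := h
    exact .rel _ _ ⟨⟨_, CubicalAction.smul_isCube g q.2⟩, rfl, rfl⟩
  | refl e => exact .refl _
  | symm e f _ ih => exact .symm _ _ ih
  | trans e f k _ _ ih₁ ih₂ => exact .trans _ _ _ ih₁ ih₂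

instance : MulAction G Z.Hyperplane where
  smul g := Quotient.map (g • ·) fun _ _ h => Z.smul_parallel g h
  one_smul H := by
    induction H using Quotient.inductionOn with
    | _ e => exact congrArg (Quotient.mk _) (one_smul G e)
  mul_smul g h H := by
    induction H using Quotient.inductionOn with
    | _ e => exact congrArg (Quotient.mk _) (mul_smul g h e)

variable {Z}

theorem smul_mem_dual (g : G) {H : Z.Hyperplane} {e : Sym2 V} (he : e ∈ H.dual) :
    e.map (g • ·) ∈ (g • H).dual := by
  obtain ⟨h, rfl⟩ := he
  exact ⟨(g • (⟨e, h⟩ : Z.Edge)).2, rfl⟩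

theorem smul_reachable (g : G) {H : Z.Hyperplane} {a b : V}
    (h : (Z.graph.deleteEdges H.dual).Reachable a b) :
    (Z.graph.deleteEdges (g • H).dual).Reachable (g • a) (g • b) := by
  refine h.map ⟨(g • ·), ?_⟩
  intro a b hab
  rw [SimpleGraph.deleteEdges_adj] at hab ⊢
  refine ⟨Z.smul_adj g hab.1, fun hm => hab.2 ?_⟩
  have := smul_mem_dual g⁻¹ hm
  simpa using this

theorem smul_side (g : G) (H : Z.Hyperplane) (a : V) : g • H.side a = (g • H).side (g • a) := by
  ext b
  rw [Set.mem_smul_set_iff_inv_smul_mem]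
  constructor
  · intro h
    simpa [Hyperplane.side] using smul_reachable g h
  · intro h
    simpa [Hyperplane.side] using smul_reachable g⁻¹ h

end Action

end CubeComplex

/-! ### Sageev's construction -/

/-- Vertices of Sageev's cube complex `X(E, W)`, where `W` indexes a set of walls of `E` and
`parts K` consists of the two parts of the wall `K`: a choice of one part for each wall, such that
the chosen parts pairwise intersect and every element of `E` belongs to all but finitely many of
them. -/
@[ext]
structure SageevVertex {E : Type u} {W : Type v} (parts : W → Set (Set E)) where
  choice : W → Set E
  choice_mem : ∀ K, choice K ∈ parts K
  inter : ∀ K L, (choice K ∩ choice L).Nonempty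
  finite : ∀ x : E, {K | x ∉ choice K}.Finite

/-- Sageev's cube complex `X(E, W)`: the `n`-cubes are the sets of `2ⁿ` distinct vertices having the
same chosen parts for all walls except `n`, one vertex for each possible choice of parts for these
`n` walls. -/
def sageev {E : Type u} {W : Type v} (parts : W → Set (Set E)) :
    CubeComplex (SageevVertex parts) where
  IsCube _ φ := IsFaceMap fun ε => (φ ε).choice
  injective := by
    rintro n φ ⟨σ, h, -⟩ ε δ hεδ
    funext i
    refine (h i ε δ).1 ?_
    change (φ ε).choice (σ i) = (φ δ).choice (σ i)
    rw [hεδ]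
  vertex v := ⟨⟨Fin.elim0, fun i => i.elim0⟩, fun i => i.elim0, fun _ _ _ _ => rfl⟩
  face := by
    rintro m n φ f ⟨τ, hf, hf'⟩ ⟨σ, h, h'⟩
    refine ⟨τ.trans σ, ?_, ?_⟩
    · intro i ε δ
      rw [← hf i]
      exact h (τ i) (f ε) (f δ)
    · intro w hw ε δ
      by_cases hwσ : w ∈ Set.range σ
      · obtain ⟨j, rfl⟩ := hwσ
        refine (h j (f ε) (f δ)).2 (hf' j ?_ ε δ)
        rintro ⟨i, rfl⟩
        exact hw ⟨i, rfl⟩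
      · exact h' w hwσ (f ε) (f δ)
  unique := by
    classical
    rintro n φ ψ ⟨σ, h, h'⟩ ⟨τ, k, k'⟩ hr
    have hmem : ∀ ε, ∃ δ, φ δ = ψ ε := fun ε => by
      have : ψ ε ∈ Set.range φ := hr ▸ ⟨ε, rfl⟩
      exact this
    choose f hf using hmem
    -- the walls of the two parametrisations agree
    have hrange : ∀ i, ∃ j, σ j = τ i := by
      intro i
      by_contra hcon
      have hi : τ i ∉ Set.range σ := fun ⟨j, hj⟩ => hcon ⟨j, hj⟩
      have h1 := h' (τ i) hi (f fun _ => false) (f fun _ => true)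
      simp only [hf] at h1
      have h2 := (k i (fun _ => false) (fun _ => true)).1 h1
      simp at h2
    choose π hπ using hrange
    have hinj : Function.Injective π := fun i j hij => τ.injective (by rw [← hπ, ← hπ, hij])
    have hsurj : Function.Surjective π := Finite.injective_iff_surjective.1 hinj
    refine ⟨f, ⟨⟨π, hinj⟩, ?_, ?_⟩, ?_⟩
    · intro i ε δ
      have h1 := h (π i) (f ε) (f δ)
      simp only [hf, hπ] at h1
      exact h1.symm.trans (k i ε δ)
    · intro w hw
      exact absurd (hsurj w) hw
    · funext ε
      exact (hf ε).symm

/-- The system of walls is preserved by an action on `E` and an action on the walls. -/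
class EquivariantParts (G : Type w) [Group G] {E : Type u} {W : Type v} [MulAction G E]
    [MulAction G W] (parts : W → Set (Set E)) : Prop where
  smul_mem : ∀ (g : G) {K : W} {s : Set E}, s ∈ parts K → g • s ∈ parts (g • K)

section SageevAction

variable {G : Type w} [Group G] {E : Type u} {W : Type v} [MulAction G E] [MulAction G W]
  (parts : W → Set (Set E)) [EquivariantParts G parts]

/-- The induced action on choices of parts: the part chosen by `g • x` for the wall `g • K` is the
translate by `g` of the part chosen by `x` for `K`. -/
instance : MulAction G (SageevVertex parts) where
  smul g x :=
    { choice := fun K => g • x.choice (g⁻¹ • K)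
      choice_mem := fun K => by
        simpa using EquivariantParts.smul_mem g (x.choice_mem (g⁻¹ • K))
      inter := fun K L => by
        rw [← Set.smul_set_inter]
        exact (x.inter _ _).smul_set
      finite := fun a => by
        refine ((x.finite (g⁻¹ • a)).image (g • ·)).subset ?_
        intro K hK
        refine ⟨g⁻¹ • K, ?_, by simp⟩
        simpa [Set.mem_smul_set_iff_inv_smul_mem] using hK }
  one_smul x := by
    ext1
    funext K
    change (1 : G) • x.choice ((1 : G)⁻¹ • K) = x.choice K
    simp
  mul_smul g h x := by
    ext1
    funext K
    change (g * h) • x.choice ((g * h)⁻¹ • K) = g • h • x.choice (h⁻¹ • g⁻¹ • K)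
    simp [mul_smul]

instance : CubicalAction G (sageev parts) where
  smul_isCube := by
    rintro g n φ ⟨σ, h, h'⟩
    refine ⟨σ.trans (MulAction.toPerm g).toEmbedding, ?_, ?_⟩
    · intro i ε δ
      change g • (φ ε).choice (g⁻¹ • g • σ i) = g • (φ δ).choice (g⁻¹ • g • σ i) ↔ _
      simp [h i ε δ]
    · intro K hK ε δ
      change g • (φ ε).choice (g⁻¹ • K) = g • (φ δ).choice (g⁻¹ • K)
      refine congrArg (g • ·) (h' (g⁻¹ • K) ?_ ε δ)
      rintro ⟨i, hi⟩
      exact hK ⟨i, by simp [hi]⟩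

end SageevAction

/-! ### Collapses -/

namespace CubeComplex

section Collapse

variable {G : Type w} [Group G] {V : Type u} [MulAction G V] {Z : CubeComplex V}
  [CubicalAction G Z]

/-- The walls retained when the `G`-invariant family `𝓗` of hyperplanes is collapsed: the
partitions of the vertex set into the halfspaces of the hyperplanes not in `𝓗`. -/
def keptParts (𝓗 : SubMulAction G Z.Hyperplane) (K : ↥(𝓗ᶜ)) : Set (Set V) := K.1.halfspaces

instance (𝓗 : SubMulAction G Z.Hyperplane) : EquivariantParts G (keptParts 𝓗) where
  smul_mem := by
    rintro g K s ⟨a, rfl⟩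
    exact ⟨g • a, (smul_side g K.1 a).symm⟩

/-- The vertices of the range of the collapse of `𝓗`. -/
abbrev CollapseVertex (𝓗 : SubMulAction G Z.Hyperplane) : Type u := SageevVertex (keptParts 𝓗)

/-- The range of the collapse of `𝓗`, the restriction quotient `X(Z, 𝔚 ∖ 𝓗)`. -/
abbrev collapseRange (𝓗 : SubMulAction G Z.Hyperplane) : CubeComplex (CollapseVertex 𝓗) :=
  sageev (keptParts 𝓗)

theorem finite_sides (hZ : Z.graph.Connected) (a b : V) : {H : Z.Hyperplane | b ∉ H.side a}.Finite := by
  classical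
  obtain ⟨p⟩ := hZ.preconnected a b
  have hfin : {H : Z.Hyperplane | ∃ e ∈ p.edges, e ∈ H.dual}.Finite := by
    have : {H : Z.Hyperplane | ∃ e ∈ p.edges, e ∈ H.dual}
        = ⋃ e ∈ {e | e ∈ p.edges}, {H : Z.Hyperplane | e ∈ H.dual} := by
      ext H
      simp
    rw [this]
    refine (List.finite_toSet p.edges).biUnion fun e _ => Set.Subsingleton.finite ?_
    rintro H ⟨h, rfl⟩ K ⟨h', rfl⟩
    rfl
  refine hfin.subset fun H hH => ?_
  by_contra hcon
  simp only [Set.mem_ofPred_eq, not_exists, not_and] at hcon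
  exact hH ⟨p.toDeleteEdges _ hcon⟩

/-- The collapse of `𝓗` on vertices: a vertex is sent to the choice of the halfspaces containing
it. -/
def collapse (hZ : Z.IsCAT0) (𝓗 : SubMulAction G Z.Hyperplane) (a : V) : CollapseVertex 𝓗 where
  choice K := K.1.side a
  choice_mem _ := ⟨a, rfl⟩
  inter _ _ := ⟨a, SimpleGraph.Reachable.refl _, SimpleGraph.Reachable.refl _⟩
  finite b := (finite_sides hZ.connected a b).preimage Subtype.val_injective.injOn

/-- The collapse on all points: `q` is the image of `p` under the extension of `collapse hZ 𝓗`
to cubes, that is, `q` is obtained from `p` by applying the collapse to the vertices in the convex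
combination `p` (on each cube this is the orthogonal projection forgetting the coordinates dual
to `𝓗`). -/
def IsCollapseImage (hZ : Z.IsCAT0) (𝓗 : SubMulAction G Z.Hyperplane) (p : Z.Realization)
    (q : (collapseRange 𝓗).Realization) : Prop :=
  q.1 = p.1.mapDomain (collapse hZ 𝓗)

/-- `𝓗` is strongly collapsible: for `H ∈ 𝓗` and `g ∉ Stab(H)`, `Sep(H | gH)` is not contained
in `𝓗`. -/
def IsStronglyCollapsible (𝓗 : SubMulAction G Z.Hyperplane) : Prop :=
  ∀ H ∈ 𝓗, ∀ g : G, g ∉ MulAction.stabilizer G H →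
    ¬ Z.Sep H.carrier (g • H).carrier ⊆ (𝓗 : Set Z.Hyperplane)

/-- The collapse of `𝓗` induces a homotopy equivalence `Z/G → Y/G` of orbit spaces. -/
def InducesHomotopyEquiv (hZ : Z.IsCAT0) (𝓗 : SubMulAction G Z.Hyperplane) : Prop :=
  ∃ h : ContinuousMap.HomotopyEquiv (Quotient (MulAction.orbitRel G Z.Realization))
      (Quotient (MulAction.orbitRel G (collapseRange 𝓗).Realization)),
    ∀ p : Z.Realization, ∃ q : (collapseRange 𝓗).Realization, IsCollapseImage hZ 𝓗 p q ∧
      h.toFun (Quotient.mk _ p) = Quotient.mk _ q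

variable (G) in
/-- The equivalence relation on the edges of `Z/G` (the `G`-orbits of edges of `Z`) generated by
being opposite edges in a square of `Z/G` that is the image of a square of `Z` in `S`. -/
def QuotientParallel (S : Set Z.Square) :
    Quotient (MulAction.orbitRel G Z.Edge) → Quotient (MulAction.orbitRel G Z.Edge) → Prop :=
  Relation.EqvGen fun a b => ∃ q ∈ S, a = Quotient.mk _ q.bottom ∧ b = Quotient.mk _ q.top

/-- The edges of the preimage in `Z/G` of a vertex `y` of `Y/G`: the images of the edges of `Z`
that are collapsed to a vertex in the orbit `y`. -/
def preimageEdges (hZ : Z.IsCAT0) (𝓗 : SubMulAction G Z.Hyperplane)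
    (y : Quotient (MulAction.orbitRel G (CollapseVertex 𝓗))) :
    Set (Quotient (MulAction.orbitRel G Z.Edge)) :=
  {a | ∃ e : Z.Edge, Quotient.mk _ e = a ∧ ∃ x : CollapseVertex 𝓗, Quotient.mk _ x = y ∧
    ∀ b ∈ e.1, collapse hZ 𝓗 b = x}

/-- The squares of `Z` that are collapsed to a vertex in the orbit `y`; their images in `Z/G` are
the squares of the preimage of `y`. -/
def preimageSquares (hZ : Z.IsCAT0) (𝓗 : SubMulAction G Z.Hyperplane)
    (y : Quotient (MulAction.orbitRel G (CollapseVertex 𝓗))) : Set Z.Square :=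
  {q | ∃ x : CollapseVertex 𝓗, Quotient.mk _ x = y ∧ ∀ ε, collapse hZ 𝓗 (q.1 ε) = x}

end Collapse

end CubeComplex

/-! The argument lives on the fibres of the collapse. Two vertices of $Z$ have the same image
exactly when every hyperplane separating them is in `𝓗`, so fibres are convex. A closest pair of
vertices in the carriers of two hyperplanes is separated only by the hyperplanes between these
carriers (`exists_bridge`). Hence, for `H ∈ 𝓗`, the inclusion $\mathrm{Sep}(H\mid
gH)\subseteq\mathcal H$ says that $H$ and $gH$ cross a common fibre, and the collapse is strong if
and only if translates of a member of `𝓗` that cross a common fibre coincide.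

Condition 1 amounts to freeness of the action on the vertices of $Y$. If that action is free, an
equivariant map from the vertices of $Y$ to those of $Z$ exists; it extends to points, and both
composites with the collapse are joined to the identity by equivariant straight lines
(`inducesHomotopyEquiv_of_free`). Conversely, suppose $g$ fixes $c(z)$. A path from $z$ to $gz$
becomes a loop in the contractible complex $Y$; a homotopy equivalence then makes its image in $Z/G$
freely null-homotopic, and since $Z\to Z/G$ is a covering, the path was closed
(`free_of_inducesHomotopyEquiv`).

A strong collapse gives freeness: if $g$ fixes $c(z)$, it fixes every hyperplane between $z$ and
$gz$, so $g^2z=z$ and $g$ fixes a point of $Z$ (`IsStronglyCollapsible.free`). It gives condition 2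
because two edges of a fibre that are parallel in $Z/G$ must be dual to the same hyperplane, and
convexity supplies a ladder of squares inside the fibre. Conversely, a violation of strongness
yields two edges of one fibre that are parallel in $Z/G$; by condition 2 they are joined by squares
of the fibre, and lifting these, with freeness, shows that the two hyperplanes agree.

Two tools carry this. The geometry of $Z$ comes from a normal form for edge paths: reduced paths
with common endpoints differ only by pushes across squares (`Flip.diamond`, `Reduced.flip`), which
yields the quadrangle condition and from it halfspaces, gates and the Helly property. The topology
comes from an explicit equivariant retraction of finitely supported probability measures on vertices
onto any complex dual to a system of walls (`IsWallStructure.retract`). It applies to $Z$ and $Y$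
alike and provides straight lines, contractions and barycentres. -/

/-! ### Squares -/

/-- The vertex of the cube adjacent to `ε` in direction `i`. -/
def flipAt {n : ℕ} (ε : Fin n → Bool) (i : Fin n) : Fin n → Bool :=
  Function.update ε i (!(ε i))

theorem flipAt_flipAt {n : ℕ} (ε : Fin n → Bool) (i : Fin n) : flipAt (flipAt ε i) i = ε := by
  simp [flipAt]

theorem flipAt_comm {n : ℕ} (ε : Fin n → Bool) {i j : Fin n} (h : i ≠ j) :
    flipAt (flipAt ε i) j = flipAt (flipAt ε j) i := by
  unfold flipAt
  rw [Function.update_of_ne h, Function.update_of_ne h.symm, Function.update_comm h]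

/-- A property of the vertices of a cube that is invariant under moving along edges. -/
theorem forall_of_flipAt {n : ℕ} {p : (Fin n → Bool) → Prop} (s : Finset (Fin n))
    (h : ∀ ε, ∀ i ∈ s, p ε → p (flipAt ε i)) (ε δ : Fin n → Bool)
    (hs : ∀ i, i ∉ s → ε i = δ i) (hε : p ε) : p δ := by
  induction s using Finset.induction_on generalizing ε with
  | empty =>
    obtain rfl : ε = δ := funext fun i => hs i (by simp)
    exact hε
  | insert i s hi ih =>
    have ih' := ih (fun ε j hj => h ε j (Finset.mem_insert_of_mem hj))
    by_cases he : ε i = δ i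
    · refine ih' ε (fun j hj => ?_) hε
      by_cases hji : j = i
      · rw [hji, he]
      · exact hs j (by simp [hji, hj])
    · refine ih' (flipAt ε i) (fun j hj => ?_) (h ε i (Finset.mem_insert_self i s) hε)
      by_cases hji : j = i
      · subst hji
        simp only [flipAt, Function.update_self]
        revert he
        cases ε j <;> cases δ j <;> simp
      · rw [flipAt, Function.update_of_ne hji]
        exact hs j (by simp [hji, hj])

namespace CubeComplex

variable {V : Type u} (Z : CubeComplex V)

/-- `a, b, c, d` are the vertices, in cyclic order, of a square. -/
def Sq (a b c d : V) : Prop :=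
  ∃ φ, Z.IsCube 2 φ ∧ φ ![false, false] = a ∧ φ ![true, false] = b ∧ φ ![true, true] = c ∧
    φ ![false, true] = d

variable {Z}

theorem IsCube.sq {n : ℕ} {φ : (Fin n → Bool) → V} (hφ : Z.IsCube n φ) (ε : Fin n → Bool)
    {i j : Fin n} (hij : i ≠ j) :
    Z.Sq (φ ε) (φ (flipAt ε i)) (φ (flipAt (flipAt ε i) j)) (φ (flipAt ε j)) := by
  refine ⟨φ ∘ fun t k => if k = i then xor (ε i) (t 0) else if k = j then xor (ε j) (t 1) else ε k,
    Z.face _ ⟨⟨![i, j], ?_⟩, ?_, ?_⟩ hφ, ?_, ?_, ?_, ?_⟩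
  · intro a b hab
    fin_cases a <;> fin_cases b <;> simp_all
  · intro k s t
    fin_cases k
    · change ((if i = i then _ else _) = if i = i then _ else _) ↔ _
      simp
    · change ((if j = i then _ else if j = j then _ else _) =
        if j = i then _ else if j = j then _ else _) ↔ _
      simp [hij.symm]
  · intro k hk s t
    have h1 : k ≠ i := fun h => hk ⟨0, h.symm⟩
    have h2 : k ≠ j := fun h => hk ⟨1, h.symm⟩
    simp [h1, h2]
  all_goals
    refine congrArg φ (funext fun k => ?_)
    by_cases h1 : k = i
    · subst h1
      simp [flipAt, hij]
    · by_cases h2 : k = j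
      · subst h2
        simp [flipAt, h1]
      · simp [flipAt, h1, h2]

theorem Sq.rotate {a b c d : V} (h : Z.Sq a b c d) : Z.Sq b c d a := by
  obtain ⟨φ, hφ, rfl, rfl, rfl, rfl⟩ := h
  have := hφ.sq ![true, false] (i := 1) (j := 0) (by decide)
  convert this using 2 <;> decide

theorem Sq.reflect {a b c d : V} (h : Z.Sq a b c d) : Z.Sq a d c b := by
  obtain ⟨φ, hφ, rfl, rfl, rfl, rfl⟩ := h
  have := hφ.sq ![false, false] (i := 1) (j := 0) (by decide)
  convert this using 2 <;> decide

theorem Sq.adj {a b c d : V} (h : Z.Sq a b c d) : Z.graph.Adj a b := by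
  obtain ⟨φ, hφ, rfl, rfl, rfl, rfl⟩ := h
  have h := Z.adj_update hφ ![false, false] 0
  have e : Function.update ![false, false] (0 : Fin 2) (!(![false, false] (0 : Fin 2)))
      = ![true, false] := by decide
  rwa [e] at h

theorem Sq.ne {a b c d : V} (h : Z.Sq a b c d) : b ≠ d := by
  obtain ⟨φ, hφ, rfl, rfl, rfl, rfl⟩ := h
  intro h
  have := Z.injective hφ h
  exact absurd this (by decide)

theorem cubeOrigin_two : cubeOrigin 2 = ![false, false] := by decide

theorem cubeUnit_two_zero : (cubeUnit 0 : Fin 2 → Bool) = ![true, false] := by decide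

theorem cubeUnit_two_one : (cubeUnit 1 : Fin 2 → Bool) = ![false, true] := by decide

/-- Links are simplicial, so a square is determined by one corner and its two neighbours. -/
theorem Sq.unique (hZ : Z.IsCAT0) {a b c c' d : V} (h : Z.Sq a b c d) (h' : Z.Sq a b c' d) :
    c = c' := by
  obtain ⟨φ, hφ, h0, h1, h2, h3⟩ := h
  obtain ⟨ψ, hψ, k0, k1, k2, k3⟩ := h'
  have : φ = ψ := by
    refine hZ.link_simplicial 2 φ ψ hφ hψ ?_ ?_
    · rw [cubeOrigin_two, h0, k0]
    · intro i
      fin_cases i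
      · exact (congrArg φ cubeUnit_two_zero).trans
          ((h1.trans k1.symm).trans (congrArg ψ cubeUnit_two_zero.symm))
      · exact (congrArg φ cubeUnit_two_one).trans
          ((h3.trans k3.symm).trans (congrArg ψ cubeUnit_two_one.symm))
  rw [← h2, ← k2, this]

theorem Sq.exists_corner {a b c d : V} (h : Z.Sq a b c d) : ∃ φ, Z.IsCube 2 φ ∧
    φ (cubeOrigin 2) = a ∧ φ (cubeUnit 0) = b ∧ φ (cubeUnit 1) = d := by
  obtain ⟨φ, hφ, h0, h1, h2, h3⟩ := h
  refine ⟨φ, hφ, ?_, ?_, ?_⟩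
  · rw [cubeOrigin_two, h0]
  · rw [cubeUnit_two_zero, h1]
  · rw [cubeUnit_two_one, h3]

/-- Three squares around a vertex are the faces of a `3`-cube. -/
theorem Sq.exists_cube (hZ : Z.IsCAT0) {a x y z p q r : V} (h₁ : Z.Sq a x p y)
    (h₂ : Z.Sq a y q z) (h₃ : Z.Sq a z r x) :
    ∃ t, Z.Sq x p t r ∧ Z.Sq y q t p ∧ Z.Sq z r t q := by
  obtain ⟨φ, hφ, h0, hu⟩ := hZ.link_flag 3 a ![x, y, z] (by
      have := h₁.ne
      have := h₂.ne
      have := h₃.ne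
      intro i j hij
      fin_cases i <;> fin_cases j <;> simp_all) (by
      intro i
      fin_cases i
      · exact h₁.adj
      · exact h₂.adj
      · exact h₃.adj) (by
      intro i j hij
      fin_cases i <;> fin_cases j
      all_goals first
        | exact absurd rfl hij
        | exact h₁.exists_corner
        | exact h₂.exists_corner
        | exact h₃.exists_corner
        | exact h₁.reflect.exists_corner
        | exact h₂.reflect.exists_corner
        | exact h₃.reflect.exists_corner)
  have e0 : cubeOrigin 3 = ![false, false, false] := by decide
  have e1 : (cubeUnit 0 : Fin 3 → Bool) = ![true, false, false] := by decide
  have e2 : (cubeUnit 1 : Fin 3 → Bool) = ![false, true, false] := by decide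
  have e3 : (cubeUnit 2 : Fin 3 → Bool) = ![false, false, true] := by decide
  have hx : φ ![true, false, false] = x := e1 ▸ hu 0
  have hy : φ ![false, true, false] = y := e2 ▸ hu 1
  have hz : φ ![false, false, true] = z := e3 ▸ hu 2
  rw [e0] at h0
  have hp : φ ![true, true, false] = p := by
    have := hφ.sq ![false, false, false] (i := 0) (j := 1) (by decide)
    refine Sq.unique hZ (a := a) (b := x) (d := y) ?_ h₁
    rw [← h0, ← hx, ← hy]
    convert this using 2 <;> decide
  have hq : φ ![false, true, true] = q := by
    have := hφ.sq ![false, false, false] (i := 1) (j := 2) (by decide)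
    refine Sq.unique hZ (a := a) (b := y) (d := z) ?_ h₂
    rw [← h0, ← hy, ← hz]
    convert this using 2 <;> decide
  have hr : φ ![true, false, true] = r := by
    have := hφ.sq ![false, false, false] (i := 2) (j := 0) (by decide)
    refine Sq.unique hZ (a := a) (b := z) (d := x) ?_ h₃
    rw [← h0, ← hx, ← hz]
    convert this using 2 <;> decide
  refine ⟨φ ![true, true, true], ?_, ?_, ?_⟩
  · have := hφ.sq ![true, false, false] (i := 1) (j := 2) (by decide)
    rw [← hx, ← hp, ← hr]
    convert this using 2 <;> decide
  · have := hφ.sq ![false, true, false] (i := 2) (j := 0) (by decide)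
    rw [← hy, ← hp, ← hq]
    convert this using 2 <;> decide
  · have := hφ.sq ![false, false, true] (i := 0) (j := 1) (by decide)
    rw [← hz, ← hq, ← hr]
    convert this using 2 <;> decide

/-! ### Flips of edge paths -/

variable (Z) in
/-- The equivalence relation on edge paths generated by pushing a path across a square. -/
inductive Flip : ∀ {a b : V}, Z.graph.Walk a b → Z.graph.Walk a b → Prop
  | refl {a b : V} (p : Z.graph.Walk a b) : Flip p p
  | symm {a b : V} {p q : Z.graph.Walk a b} : Flip p q → Flip q p
  | trans {a b : V} {p q r : Z.graph.Walk a b} : Flip p q → Flip q r → Flip p r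
  | cons {a b c : V} (h : Z.graph.Adj a b) {p q : Z.graph.Walk b c} :
      Flip p q → Flip (.cons h p) (.cons h q)
  | square {a b c d e : V} (s : Z.Sq a b c d) (h₁ : Z.graph.Adj a b) (h₂ : Z.graph.Adj b c)
      (h₃ : Z.graph.Adj a d) (h₄ : Z.graph.Adj d c) (p : Z.graph.Walk c e) :
      Flip (.cons h₁ (.cons h₂ p)) (.cons h₃ (.cons h₄ p))

theorem Flip.length_eq {a b : V} {p q : Z.graph.Walk a b} (h : Z.Flip p q) :
    p.length = q.length := by
  induction h with
  | refl => rfl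
  | symm _ ih => exact ih.symm
  | trans _ _ ih₁ ih₂ => exact ih₁.trans ih₂
  | cons h _ ih => simp [ih]
  | square => simp

/-- Two paths with the same endpoints either have flip equivalent tails after a common first step,
or their first steps span a square and their tails are flip equivalent to paths through the fourth
vertex of that square. -/
inductive Diamond : ∀ {a b : V}, Z.graph.Walk a b → Z.graph.Walk a b → Prop
  | nil {a : V} : Diamond (.nil : Z.graph.Walk a a) .nil
  | tail {a b c : V} (h h' : Z.graph.Adj a b) {p q : Z.graph.Walk b c} (hpq : Z.Flip p q) :
      Diamond (.cons h p) (.cons h' q)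
  | square {a b c d e : V} (s : Z.Sq a b c d) (h₁ : Z.graph.Adj a b) (h₂ : Z.graph.Adj b c)
      (h₃ : Z.graph.Adj a d) (h₄ : Z.graph.Adj d c) {p : Z.graph.Walk b e} {q : Z.graph.Walk d e}
      (r : Z.graph.Walk c e) (hp : Z.Flip p (.cons h₂ r)) (hq : Z.Flip q (.cons h₄ r)) :
      Diamond (.cons h₁ p) (.cons h₃ q)

theorem Diamond.symm {a b : V} {p q : Z.graph.Walk a b} (h : Diamond p q) : Diamond q p := by
  cases h with
  | nil => exact .nil
  | tail h h' hpq => exact .tail h' h hpq.symm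
  | square s h₁ h₂ h₃ h₄ r hp hq => exact .square s.reflect h₃ h₄ h₁ h₂ r hq hp

/-- The only case with content is square against square, with first steps to `b`, `d` and `d'`. The
two tails through `d` are flip equivalent and shorter, so the hypothesis compares them. If they
leave `d` by the same edge, the two squares share a corner at `d` and `b = d'`. Otherwise three
squares meet at `d`; they bound a cube, and the three faces opposite to them provide the required
square and tails. -/
theorem Diamond.trans (hZ : Z.IsCAT0) {a e : V} {p q r : Z.graph.Walk a e}
    (ih : ∀ (b : V) (p' q' : Z.graph.Walk b e), p'.length < q.length → Z.Flip p' q' →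
      Diamond p' q')
    (h : Diamond p q) (h' : Diamond q r) : Diamond p r := by
  cases h with
  | nil => exact h'
  | @tail _ b k₁ k₂ p₀ q₀ hpq =>
    cases h' with
    | tail _ k₃ hqr => exact .tail k₁ k₃ (hpq.trans hqr)
    | square s _ h₂ h₃ h₄ t hq hr => exact .square s k₁ h₂ h₃ h₄ t (hpq.trans hq) hr
  | @square b c d _ s h₁ h₂ h₃ h₄ p₀ q₀ t hp hq =>
    cases h' with
    | tail _ k₃ hqr => exact .square s h₁ h₂ k₃ h₄ t hp (hqr.symm.trans hq)
    | @square _ c' d' _ s' _ k₂ k₃ k₄ _ r₀ t' hq' hr =>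
      have hdi := ih d _ _ (by
        have := hq.length_eq
        simp only [SimpleGraph.Walk.length_cons] at this ⊢
        omega) (hq.symm.trans hq')
      cases hdi with
      | tail _ _ htt =>
        obtain rfl : b = d' := Sq.unique hZ s.rotate.rotate.rotate s'.rotate.reflect
        exact .tail h₁ k₃ (hp.trans (((Flip.cons h₂ htt)).trans hr.symm))
      | @square _ f _ _ s'' _ m₂ _ m₄ _ _ x hx hx' =>
        obtain ⟨y, y₁, y₂, y₃⟩ := Sq.exists_cube hZ s.rotate.rotate.rotate s'' s'.rotate
        have hby := y₁.rotate.adj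
        have hyf := y₂.rotate.adj.symm
        have hd'y := y₃.rotate.adj
        refine .square y₁ h₁ hby k₃ hd'y (.cons hyf x) ?_ ?_
        · exact hp.trans ((Flip.cons h₂ hx).trans
            (.square y₂.rotate.rotate.rotate h₂ m₂ hby hyf x))
        · exact hr.trans ((Flip.cons k₄ hx').trans
            (.square y₃.reflect.rotate.rotate.rotate k₄ m₄ hd'y hyf x))

/-- Outer induction on the length, inner induction on the derivation of the flip equivalence. Flips
preserve length, so the outer hypothesis covers the tails in the transitivity step. -/
theorem Flip.diamond (hZ : Z.IsCAT0) {a e : V} {p q : Z.graph.Walk a e} (h : Z.Flip p q) :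
    Diamond p q := by
  obtain ⟨n, hn⟩ : ∃ n, p.length = n := ⟨_, rfl⟩
  induction n using Nat.strong_induction_on generalizing a e p q with
  | _ n ihn =>
    induction h with
    | refl p' =>
      cases p' with
      | nil => exact .nil
      | cons h p' => exact .tail h h (.refl _)
    | symm h ih => exact (ih (h.length_eq.trans hn)).symm
    | trans h₁ h₂ ih₁ ih₂ =>
      have hn' := h₁.length_eq.symm.trans hn
      exact Diamond.trans hZ (fun b p'' q'' hlt hf => ihn _ (hn' ▸ hlt) hf rfl) (ih₁ hn)
        (ih₂ hn')
    | cons h hpq _ => exact .tail h h hpq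
    | square s h₁ h₂ h₃ h₄ p => exact .square s h₁ h₂ h₃ h₄ p (.refl _) (.refl _)

end CubeComplex

/-! ### Reduced edge paths and their uniqueness up to flips -/

namespace CubeComplex

variable {V : Type u} {Z : CubeComplex V}

theorem Flip.of_cons (hZ : Z.IsCAT0) {a b e : V} {h h' : Z.graph.Adj a b}
    {p q : Z.graph.Walk b e} (hpq : Z.Flip (.cons h p) (.cons h' q)) : Z.Flip p q := by
  cases hpq.diamond hZ with
  | tail _ _ hpq => exact hpq
  | square s => exact absurd rfl s.ne

theorem Flip.exists_square (hZ : Z.IsCAT0) {a b d e : V} {h₁ : Z.graph.Adj a b}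
    {h₃ : Z.graph.Adj a d} {p : Z.graph.Walk b e} {q : Z.graph.Walk d e} (hbd : b ≠ d)
    (hpq : Z.Flip (.cons h₁ p) (.cons h₃ q)) :
    ∃ c, Z.Sq a b c d ∧ ∃ (h₂ : Z.graph.Adj b c) (h₄ : Z.graph.Adj d c) (r : Z.graph.Walk c e),
      Z.Flip p (.cons h₂ r) ∧ Z.Flip q (.cons h₄ r) := by
  cases hpq.diamond hZ with
  | tail _ _ hpq => exact absurd rfl hbd
  | @square _ c _ _ s _ h₂ _ h₄ _ _ r hp hq => exact ⟨c, s, h₂, h₄, r, hp, hq⟩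

/-- The path `p` is flip equivalent to a path with first edge `h`. -/
def StartsWith {a b e : V} (p : Z.graph.Walk a e) (h : Z.graph.Adj a b) : Prop :=
  ∃ r : Z.graph.Walk b e, Z.Flip p (.cons h r)

theorem StartsWith.congr {a b e : V} {p q : Z.graph.Walk a e} {h : Z.graph.Adj a b}
    (hpq : Z.Flip p q) (hp : StartsWith p h) : StartsWith q h := by
  obtain ⟨r, hr⟩ := hp
  exact ⟨r, hpq.symm.trans hr⟩

/-- A path is reduced if no backtrack can be produced by flips. -/
def Reduced : ∀ {a e : V}, Z.graph.Walk a e → Prop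
  | _, _, .nil => True
  | _, _, .cons h p => Reduced p ∧ ¬ StartsWith p h.symm

/-- A possible cancellation at one edge of a square is the same as a cancellation at the opposite
edge. This makes reducedness invariant under flips. -/
theorem startsWith_cons_iff (hZ : Z.IsCAT0) {a b c d e : V} (s : Z.Sq a b c d)
    (h₁ : Z.graph.Adj b a) (h₂ : Z.graph.Adj b c) (h₄ : Z.graph.Adj c d)
    (p : Z.graph.Walk c e) : StartsWith (.cons h₂ p) h₁ ↔ StartsWith p h₄ := by
  constructor
  · rintro ⟨r, hr⟩
    obtain ⟨x, sx, k₂, k₄, t, hp, -⟩ := hr.exists_square hZ s.rotate.ne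
    obtain rfl : x = d := Sq.unique hZ sx s.rotate
    exact ⟨t, hp⟩
  · rintro ⟨r, hr⟩
    have hda := s.rotate.rotate.rotate.adj
    exact ⟨.cons hda.symm r, (hr.cons h₂).trans
      (.square s.rotate h₂ h₄ h₁ hda.symm r)⟩

theorem Reduced.square (hZ : Z.IsCAT0) {a b c d e : V} (s : Z.Sq a b c d)
    {h₁ : Z.graph.Adj a b} {h₂ : Z.graph.Adj b c} (h₃ : Z.graph.Adj a d)
    (h₄ : Z.graph.Adj d c) {p : Z.graph.Walk c e}
    (hp : Reduced (.cons h₁ (.cons h₂ p))) : Reduced (.cons h₃ (.cons h₄ p)) := by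
  obtain ⟨⟨h0, hb⟩, ha⟩ := hp
  refine ⟨⟨h0, ?_⟩, ?_⟩
  · rwa [startsWith_cons_iff hZ s h₁.symm h₂ h₄.symm] at ha
  · rwa [startsWith_cons_iff hZ s.reflect h₃.symm h₄ h₂.symm]

theorem Flip.reduced_iff (hZ : Z.IsCAT0) {a b : V} {p q : Z.graph.Walk a b}
    (h : Z.Flip p q) : Reduced p ↔ Reduced q := by
  induction h with
  | refl p => exact Iff.rfl
  | symm _ ih => exact ih.symm
  | trans _ _ ih₁ ih₂ => exact ih₁.trans ih₂
  | cons h hpq ih =>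
    exact and_congr ih (not_congr ⟨StartsWith.congr hpq, StartsWith.congr hpq.symm⟩)
  | square s h₁ h₂ h₃ h₄ p => exact ⟨.square hZ s h₃ h₄, .square hZ s.reflect h₁ h₂⟩

open Classical in
/-- Prepend an edge to a reduced path, cancelling it if possible. -/
noncomputable def prepend {a b e : V} (h : Z.graph.Adj a b) (p : Z.graph.Walk b e) :
    Z.graph.Walk a e :=
  if hp : StartsWith p h.symm then hp.choose else .cons h p

theorem prepend_of_flip (hZ : Z.IsCAT0) {a b e : V} {h : Z.graph.Adj a b}
    {p : Z.graph.Walk b e} {r : Z.graph.Walk a e} (hr : Z.Flip p (.cons h.symm r)) :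
    Z.Flip (prepend h p) r := by
  have hp : StartsWith p h.symm := ⟨r, hr⟩
  rw [prepend, dif_pos hp]
  exact (hp.choose_spec.symm.trans hr).of_cons hZ

theorem prepend_of_not {a b e : V} {h : Z.graph.Adj a b}
    {p : Z.graph.Walk b e} (hp : ¬ StartsWith p h.symm) : prepend h p = .cons h p :=
  dif_neg hp

theorem Flip.prepend (hZ : Z.IsCAT0) {a b e : V} (h : Z.graph.Adj a b)
    {p q : Z.graph.Walk b e} (hpq : Z.Flip p q) :
    Z.Flip (CubeComplex.prepend h p) (CubeComplex.prepend h q) := by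
  by_cases hp : StartsWith p h.symm
  · obtain ⟨r, hr⟩ := hp
    exact (prepend_of_flip hZ hr).trans (prepend_of_flip hZ (hpq.symm.trans hr)).symm
  · rw [prepend_of_not hp, prepend_of_not fun hq => hp (hq.congr hpq.symm)]
    exact hpq.cons h

theorem Reduced.prepend (hZ : Z.IsCAT0) {a b e : V} (h : Z.graph.Adj a b)
    {p : Z.graph.Walk b e} (hp : Reduced p) : Reduced (CubeComplex.prepend h p) := by
  by_cases hs : StartsWith p h.symm
  · obtain ⟨r, hr⟩ := hs
    exact ((prepend_of_flip hZ hr).reduced_iff hZ).2 ((hr.reduced_iff hZ).1 hp).1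
  · rw [prepend_of_not hs]
    exact ⟨hp, hs⟩

/-- Together with `prepend_square` this checks the defining relations of homotopy, so that
prepending edges acts on flip classes of reduced paths. A normal form is obtained without a
confluence argument for paths that are not reduced. -/
theorem prepend_prepend (hZ : Z.IsCAT0) {a b e : V} (h : Z.graph.Adj a b)
    (h' : Z.graph.Adj b a) {p : Z.graph.Walk a e} (hp : Reduced p) :
    Z.Flip (prepend h (prepend h' p)) p := by
  by_cases hs : StartsWith p h'.symm
  · obtain ⟨r, hr⟩ := hs
    have hred := (hr.reduced_iff hZ).1 hp
    have h1 := prepend_of_flip (h := h') hZ hr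
    refine (h1.prepend hZ h).trans ?_
    rw [prepend_of_not hred.2]
    exact hr.symm
  · rw [prepend_of_not hs]
    exact prepend_of_flip hZ (.refl _)

/-- The mixed case: along one side of the square the edge at `c` cancels at once. Along the other
side nothing cancels first, but a push across the square exposes a cancellation at the second edge.
-/
theorem prepend_square_aux (hZ : Z.IsCAT0) {a b c d e : V} (s : Z.Sq a b c d)
    (h₁ : Z.graph.Adj a b) (h₂ : Z.graph.Adj b c) (h₃ : Z.graph.Adj a d)
    (h₄ : Z.graph.Adj d c) {p : Z.graph.Walk c e}
    (hb : StartsWith p h₂.symm) (hd : ¬ StartsWith p h₄.symm) :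
    Z.Flip (prepend h₁ (prepend h₂ p)) (prepend h₃ (prepend h₄ p)) := by
  obtain ⟨r, hr⟩ := hb
  have hb' : ¬ StartsWith r h₁.symm := by
    rw [← startsWith_cons_iff hZ s.rotate.rotate.rotate.reflect h₄.symm h₂.symm h₁.symm]
    exact fun h => hd (h.congr hr.symm)
  refine ((prepend_of_flip hZ hr).prepend hZ h₁).trans ?_
  rw [prepend_of_not hb', prepend_of_not hd]
  refine (prepend_of_flip hZ (((hr.cons h₄)).trans ?_)).symm
  exact .square s.rotate.rotate.rotate.reflect h₄ h₂.symm h₃.symm h₁ r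

theorem prepend_square (hZ : Z.IsCAT0) {a b c d e : V} (s : Z.Sq a b c d)
    (h₁ : Z.graph.Adj a b) (h₂ : Z.graph.Adj b c) (h₃ : Z.graph.Adj a d)
    (h₄ : Z.graph.Adj d c) {p : Z.graph.Walk c e} :
    Z.Flip (prepend h₁ (prepend h₂ p)) (prepend h₃ (prepend h₄ p)) := by
  by_cases hb : StartsWith p h₂.symm
  · by_cases hd : StartsWith p h₄.symm
    · obtain ⟨r, hr⟩ := hb
      obtain ⟨r', hr'⟩ := hd
      obtain ⟨x, sx, k₁, k₃, t, ht, ht'⟩ := (hr.symm.trans hr').exists_square hZ s.ne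
      obtain rfl : x = a := Sq.unique hZ sx s.rotate.rotate.reflect
      exact (((prepend_of_flip hZ hr).prepend hZ h₁).trans (prepend_of_flip hZ ht)).trans
        (((prepend_of_flip hZ hr').prepend hZ h₃).trans (prepend_of_flip hZ ht')).symm
    · exact prepend_square_aux hZ s h₁ h₂ h₃ h₄ hb hd
  · by_cases hd : StartsWith p h₄.symm
    · exact (prepend_square_aux hZ s.reflect h₃ h₄ h₁ h₂ hd hb).symm
    · rw [prepend_of_not hb, prepend_of_not hd, prepend_of_not, prepend_of_not]
      · exact .square s h₁ h₂ h₃ h₄ p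
      · rwa [startsWith_cons_iff hZ s.reflect h₃.symm h₄ h₂.symm]
      · rwa [startsWith_cons_iff hZ s h₁.symm h₂ h₄.symm]

/-- A reduced path homotopic to a given one. -/
noncomputable def reduction : ∀ {a e : V}, Z.graph.Walk a e → Z.graph.Walk a e
  | _, _, .nil => .nil
  | _, _, .cons h p => prepend h (reduction p)

theorem reduced_reduction (hZ : Z.IsCAT0) {a e : V} (p : Z.graph.Walk a e) :
    Reduced (reduction p) := by
  induction p with
  | nil => trivial
  | cons h p ih => exact ih.prepend hZ h

theorem PathHomotopic.flip_reduction (hZ : Z.IsCAT0) {a e : V} {p q : Z.graph.Walk a e}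
    (h : Z.PathHomotopic p q) : Z.Flip (reduction p) (reduction q) := by
  induction h with
  | refl p => exact .refl _
  | symm _ ih => exact ih.symm
  | trans _ _ ih₁ ih₂ => exact ih₁.trans ih₂
  | cons h _ ih => exact ih.prepend hZ h
  | backtrack h h' p => exact prepend_prepend hZ h h' (reduced_reduction hZ p)
  | square φ hφ h₁ h₂ h₃ h₄ p =>
    exact prepend_square hZ ⟨φ, hφ, rfl, rfl, rfl, rfl⟩ h₁ h₂ h₃ h₄

theorem Reduced.flip_reduction {a e : V} {p : Z.graph.Walk a e}
    (hp : Reduced p) : Z.Flip (reduction p) p := by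
  induction p with
  | nil => exact .refl _
  | cons h p ih =>
    have := ih hp.1
    change Z.Flip (CubeComplex.prepend h (reduction p)) _
    rw [prepend_of_not fun hs => hp.2 (hs.congr this)]
    exact this.cons h

/-- Each cancellation lowers the length by two. Parity is thus an invariant of the endpoints, which
makes the graph bipartite. -/
theorem length_reduction_le {a e : V} (p : Z.graph.Walk a e) :
    (reduction p).length ≤ p.length ∧ (Even (reduction p).length ↔ Even p.length) := by
  induction p with
  | nil => exact ⟨le_rfl, Iff.rfl⟩
  | cons h p ih =>
    change (CubeComplex.prepend h (reduction p)).length ≤ _ ∧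
      (Even (CubeComplex.prepend h (reduction p)).length ↔ _)
    by_cases hs : StartsWith (reduction p) h.symm
    · rw [prepend, dif_pos hs]
      have := hs.choose_spec.length_eq
      rw [SimpleGraph.Walk.length_cons] at this ⊢
      rw [Nat.even_add_one, ← ih.2, this, Nat.even_add_one, not_not]
      exact ⟨by omega, Iff.rfl⟩
    · rw [prepend_of_not hs, SimpleGraph.Walk.length_cons, SimpleGraph.Walk.length_cons,
        Nat.even_add_one, Nat.even_add_one, ih.2]
      exact ⟨by omega, Iff.rfl⟩

theorem PathHomotopic.append_left {a b c : V} (p : Z.graph.Walk a b) {q r : Z.graph.Walk b c}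
    (h : Z.PathHomotopic q r) : Z.PathHomotopic (p.append q) (p.append r) := by
  induction p with
  | nil => exact h
  | cons k p ih => exact .cons k (ih h)

theorem PathHomotopic.append_right {a b c : V} {p q : Z.graph.Walk a b}
    (h : Z.PathHomotopic p q) (r : Z.graph.Walk b c) :
    Z.PathHomotopic (p.append r) (q.append r) := by
  induction h with
  | refl p => exact .refl _
  | symm _ ih => exact (ih r).symm
  | trans _ _ ih₁ ih₂ => exact (ih₁ r).trans (ih₂ r)
  | cons h _ ih => exact .cons h (ih r)
  | backtrack h h' p => exact .backtrack h h' _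
  | square φ hφ h₁ h₂ h₃ h₄ p => exact .square φ hφ h₁ h₂ h₃ h₄ _

theorem pathHomotopic_reverse_append {a b : V} (p : Z.graph.Walk a b) :
    Z.PathHomotopic (p.reverse.append p) .nil := by
  induction p with
  | nil => exact .refl _
  | cons h p ih =>
    rw [SimpleGraph.Walk.reverse_cons, ← SimpleGraph.Walk.append_assoc]
    exact (PathHomotopic.append_left _ (.backtrack _ _ _)).trans ih

theorem IsCAT0.pathHomotopic (hZ : Z.IsCAT0) {a b : V} (p q : Z.graph.Walk a b) :
    Z.PathHomotopic p q := by
  have h1 := (pathHomotopic_reverse_append q).append_left p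
  have h2 := (hZ.simplyConnected a (p.append q.reverse)).append_right q
  rw [SimpleGraph.Walk.append_nil, SimpleGraph.Walk.append_assoc] at h1
  exact h1.symm.trans h2

theorem Reduced.flip (hZ : Z.IsCAT0) {a b : V} {p q : Z.graph.Walk a b} (hp : Reduced p)
    (hq : Reduced q) : Z.Flip p q :=
  (hp.flip_reduction.symm.trans ((hZ.pathHomotopic p q).flip_reduction hZ)).trans
    hq.flip_reduction

/-- A backtrack reachable by flips would leave a path shorter by two. -/
theorem reduced_of_length_eq_dist {a b : V} {p : Z.graph.Walk a b}
    (h : p.length = Z.graph.dist a b) : Reduced p := by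
  induction p with
  | nil => trivial
  | @cons a c b k p ih =>
    rw [SimpleGraph.Walk.length_cons] at h
    refine ⟨ih (le_antisymm ?_ (SimpleGraph.dist_le p)), ?_⟩
    · obtain ⟨q, hq⟩ := p.reachable.exists_walk_length_eq_dist
      have := SimpleGraph.dist_le (SimpleGraph.Walk.cons k q)
      rw [SimpleGraph.Walk.length_cons] at this
      omega
    · rintro ⟨r, hr⟩
      have h1 := hr.length_eq
      have h2 := SimpleGraph.dist_le r
      rw [SimpleGraph.Walk.length_cons] at h1
      omega

/-! ### The graph metric -/

theorem IsCAT0.exists_walk (hZ : Z.IsCAT0) (a b : V) :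
    ∃ p : Z.graph.Walk a b, p.length = Z.graph.dist a b :=
  (hZ.connected a b).exists_walk_length_eq_dist

theorem even_length_iff (hZ : Z.IsCAT0) {a b : V} (p q : Z.graph.Walk a b) :
    Even p.length ↔ Even q.length := by
  rw [← (length_reduction_le p).2, ← (length_reduction_le q).2,
    ((hZ.pathHomotopic p q).flip_reduction hZ).length_eq]

/-- The graph is bipartite. -/
theorem dist_eq_add_one_or (hZ : Z.IsCAT0) {a b : V} (h : Z.graph.Adj a b) (v : V) :
    Z.graph.dist v a = Z.graph.dist v b + 1 ∨ Z.graph.dist v b = Z.graph.dist v a + 1 := by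
  obtain ⟨p, hp⟩ := hZ.exists_walk a v
  obtain ⟨q, hq⟩ := hZ.exists_walk b v
  have h1 := even_length_iff hZ p (.cons h q)
  have h2 := SimpleGraph.dist_le (SimpleGraph.Walk.cons h q)
  have h3 := SimpleGraph.dist_le (SimpleGraph.Walk.cons h.symm p)
  rw [SimpleGraph.Walk.length_cons] at h1 h2 h3
  rw [SimpleGraph.dist_comm (u := v), SimpleGraph.dist_comm (u := v), ← hp, ← hq]
  rw [← hp, ← hq] at *
  rw [Nat.even_add_one] at h1
  have : p.length ≠ q.length := by
    intro h
    rw [h] at h1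
    tauto
  omega

/-- The quadrangle condition. -/
theorem quadrangle (hZ : Z.IsCAT0) {v a b d : V} (h₁ : Z.graph.Adj a b) (h₂ : Z.graph.Adj a d)
    (hbd : b ≠ d) (hb : Z.graph.dist v a = Z.graph.dist v b + 1)
    (hd : Z.graph.dist v a = Z.graph.dist v d + 1) :
    ∃ c, Z.Sq a b c d ∧ Z.graph.dist v b = Z.graph.dist v c + 1 := by
  obtain ⟨p, hp⟩ := hZ.exists_walk b v
  obtain ⟨q, hq⟩ := hZ.exists_walk d v
  rw [SimpleGraph.dist_comm] at hp hq
  have hp' : Reduced (.cons h₁ p) := reduced_of_length_eq_dist (by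
    rw [SimpleGraph.Walk.length_cons, hp, SimpleGraph.dist_comm (u := a), hb])
  have hq' : Reduced (.cons h₂ q) := reduced_of_length_eq_dist (by
    rw [SimpleGraph.Walk.length_cons, hq, SimpleGraph.dist_comm (u := a), hd])
  -- Geodesics are reduced, so the two geodesics through `b` and `d` are flip equivalent, and their
  -- distinct first edges span a square.
  obtain ⟨c, s, k₂, -, r, hr, -⟩ := (hp'.flip hZ hq').exists_square hZ hbd
  refine ⟨c, s, ?_⟩
  have h1 := hr.length_eq
  have h2 := SimpleGraph.dist_le r
  rw [SimpleGraph.Walk.length_cons] at h1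
  rw [SimpleGraph.dist_comm] at h2
  have h3 := dist_eq_add_one_or hZ k₂ v
  omega

end CubeComplex

namespace CubeComplex

variable {V : Type u} {Z : CubeComplex V}

variable (Z) in
theorem dist_comm' (a b : V) : Z.graph.dist a b = Z.graph.dist b a := SimpleGraph.dist_comm

theorem exists_step (hZ : Z.IsCAT0) {a b : V} (h : a ≠ b) :
    ∃ c, Z.graph.Adj a c ∧ Z.graph.dist b a = Z.graph.dist b c + 1 := by
  obtain ⟨p, hp⟩ := hZ.exists_walk a b
  cases p with
  | nil => exact absurd rfl h
  | @cons _ c _ k p =>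
    refine ⟨c, k, ?_⟩
    have h1 := SimpleGraph.dist_le p
    have h2 := dist_eq_add_one_or hZ k b
    rw [SimpleGraph.Walk.length_cons] at hp
    rw [SimpleGraph.dist_comm (v := b)] at h1 hp
    omega

/-! ### Halfspaces -/

variable (Z) in
/-- The vertices closer to `a` than to `b`. -/
def closer (a b : V) : Set V := {v | Z.graph.dist v a < Z.graph.dist v b}

theorem mem_closer_iff {a b v : V} :
    v ∈ Z.closer a b ↔ Z.graph.dist v a < Z.graph.dist v b := Iff.rfl

theorem left_mem_closer (hZ : Z.IsCAT0) {a b : V} (h : Z.graph.Adj a b) : a ∈ Z.closer a b := by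
  have := dist_eq_add_one_or hZ h a
  rw [mem_closer_iff]
  rw [SimpleGraph.dist_self] at *
  omega

theorem right_notMem_closer (a b : V) :
    b ∉ Z.closer a b := by
  rw [mem_closer_iff, SimpleGraph.dist_self]
  omega

/-- Otherwise parity forces `a` and `c` to be at equal distance from `v`, with `b` and `d` one step
further away. The quadrangle condition at `b` then makes the fourth vertex of the square closer to
`v` than `a`, but by uniqueness that vertex is `d`. -/
theorem Sq.closer_subset (hZ : Z.IsCAT0) {a b c d : V} (s : Z.Sq a b c d) :
    Z.closer a b ⊆ Z.closer d c := by
  intro v hv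
  rw [mem_closer_iff] at hv ⊢
  by_contra hcon
  have h1 := dist_eq_add_one_or hZ s.adj v
  have h2 := dist_eq_add_one_or hZ s.rotate.adj v
  have h3 := dist_eq_add_one_or hZ s.rotate.rotate.adj v
  have h4 := dist_eq_add_one_or hZ s.rotate.rotate.rotate.adj v
  obtain ⟨x, sx, hx⟩ := quadrangle hZ (v := v) s.adj.symm s.rotate.adj s.reflect.rotate.ne.symm
    (by omega) (by omega)
  obtain rfl : x = d := Sq.unique hZ sx s.rotate.reflect
  omega

theorem Sq.closer_eq (hZ : Z.IsCAT0) {a b c d : V} (s : Z.Sq a b c d) :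
    Z.closer a b = Z.closer d c :=
  (s.closer_subset hZ).antisymm (s.rotate.rotate.rotate.reflect.closer_subset hZ)

theorem Sq.parallel {a b c d : V} (s : Z.Sq a b c d) (h : Z.graph.Adj a b)
    (h' : Z.graph.Adj d c) : Z.parallelSetoid ⟨s(a, b), h⟩ ⟨s(d, c), h'⟩ := by
  obtain ⟨φ, hφ, rfl, rfl, rfl, rfl⟩ := s
  exact .rel _ _ ⟨⟨φ, hφ⟩, rfl, rfl⟩

theorem closer_eq_of_parallel (hZ : Z.IsCAT0) {e f : Z.Edge} (h : Z.parallelSetoid e f) :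
    {s | ∃ a b, e.1 = s(a, b) ∧ s = Z.closer a b} =
      {s | ∃ a b, f.1 = s(a, b) ∧ s = Z.closer a b} := by
  change Relation.EqvGen _ _ _ at h
  induction h with
  | rel e f h =>
    obtain ⟨⟨φ, hφ⟩, rfl, rfl⟩ := h
    have s : Z.Sq _ _ _ _ := ⟨φ, hφ, rfl, rfl, rfl, rfl⟩
    have h1 := s.closer_eq hZ
    have h2 := s.rotate.rotate.reflect.rotate.rotate.reflect
    have h3 := s.reflect.rotate.closer_eq hZ
    have h3 := s.rotate.reflect.closer_eq hZ
    ext t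
    change (∃ a b, s(_, _) = s(a, b) ∧ _) ↔ (∃ a b, s(_, _) = s(a, b) ∧ _)
    simp only [Sym2.eq_iff]
    constructor
    · rintro ⟨a, b, ⟨rfl, rfl⟩ | ⟨rfl, rfl⟩, rfl⟩
      · exact ⟨_, _, Or.inl ⟨rfl, rfl⟩, h1⟩
      · exact ⟨_, _, Or.inr ⟨rfl, rfl⟩, h3⟩
    · rintro ⟨a, b, ⟨rfl, rfl⟩ | ⟨rfl, rfl⟩, rfl⟩
      · exact ⟨_, _, Or.inl ⟨rfl, rfl⟩, h1.symm⟩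
      · exact ⟨_, _, Or.inr ⟨rfl, rfl⟩, h3.symm⟩
  | refl e => rfl
  | symm e f _ ih => exact ih.symm
  | trans e f k _ _ ih₁ ih₂ => exact ih₁.trans ih₂

/-- An edge crossing the wall determined by the edge `ab` is parallel to `ab`. -/
theorem parallel_of_closer (hZ : Z.IsCAT0) {a b c d : V} (hab : Z.graph.Adj a b)
    (hcd : Z.graph.Adj c d) (hc : c ∈ Z.closer a b) (hd : d ∉ Z.closer a b) :
    Z.parallelSetoid ⟨s(c, d), hcd⟩ ⟨s(a, b), hab⟩ := by
  obtain ⟨n, hn⟩ : ∃ n, Z.graph.dist a c = n := ⟨_, rfl⟩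
  induction n generalizing c d with
  | zero =>
    obtain rfl : a = c := (hZ.connected.dist_eq_zero_iff).1 hn
    obtain rfl : d = b := by
      have e2 := dist_eq_add_one_or hZ hab d
      rw [mem_closer_iff] at hd
      rw [SimpleGraph.dist_eq_one_iff_adj.2 hcd.symm] at hd e2
      exact hZ.connected.dist_eq_zero_iff.1 (by omega)
    exact Z.parallelSetoid.refl _
  | succ n ih =>
    rw [mem_closer_iff] at hc hd
    have e1 := dist_eq_add_one_or hZ hab c
    have e2 := dist_eq_add_one_or hZ hab d
    have e3 := dist_eq_add_one_or hZ hcd a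
    have e4 := dist_eq_add_one_or hZ hcd b
    rw [Z.dist_comm' c a, Z.dist_comm' c b] at hc e1
    rw [Z.dist_comm' d a, Z.dist_comm' d b] at hd e2
    obtain ⟨c', hcc', h1⟩ := exists_step hZ (a := c) (b := a) (by
      rintro rfl
      simp at hn)
    have e6 := dist_eq_add_one_or hZ hcc' b
    have e7 := dist_eq_add_one_or hZ hab c'
    rw [Z.dist_comm' c' a, Z.dist_comm' c' b] at e7
    -- Seen from `b`, both `d` and the next vertex `c'` towards `a` are one step closer than `c`.
    -- The resulting square moves the edge `cd` one step towards `ab`.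
    obtain ⟨d', s, hd'⟩ := quadrangle hZ (v := b) hcd hcc' (by rintro rfl; omega) (by omega)
      (by omega)
    have e8 := dist_eq_add_one_or hZ s.rotate.adj a
    have e9 := dist_eq_add_one_or hZ s.rotate.rotate.adj a
    have h2 := s.rotate.rotate.adj.symm
    refine Z.parallelSetoid.trans (s.parallel hcd h2)
      (ih h2 ?_ ?_ (by omega))
    · rw [mem_closer_iff, Z.dist_comm' _ a, Z.dist_comm' _ b]
      omega
    · rw [mem_closer_iff, Z.dist_comm' _ a, Z.dist_comm' _ b]
      omega

theorem mem_dual_iff {a b : V} (h : Z.graph.Adj a b) (H : Z.Hyperplane) :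
    s(a, b) ∈ H.dual ↔ Quotient.mk Z.parallelSetoid ⟨s(a, b), h⟩ = H :=
  ⟨fun ⟨_, h⟩ => h, fun h' => ⟨h, h'⟩⟩

theorem Hyperplane.exists_dual (H : Z.Hyperplane) : ∃ a b, s(a, b) ∈ H.dual := by
  induction H using Quotient.inductionOn with
  | _ e =>
    obtain ⟨e, he⟩ := e
    induction e with
    | _ a b => exact ⟨a, b, he, rfl⟩

theorem adj_of_mem_dual {H : Z.Hyperplane} {a b : V} (h : s(a, b) ∈ H.dual) : Z.graph.Adj a b :=
  h.1

theorem exists_hyperplane {a b : V} (h : Z.graph.Adj a b) : ∃ H : Z.Hyperplane, s(a, b) ∈ H.dual :=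
  ⟨Quotient.mk _ ⟨s(a, b), h⟩, h, rfl⟩

theorem eq_of_mem_dual {H K : Z.Hyperplane} {e : Sym2 V} (h : e ∈ H.dual) (h' : e ∈ K.dual) :
    H = K := by
  obtain ⟨_, rfl⟩ := h
  obtain ⟨_, rfl⟩ := h'
  rfl

theorem mem_dual_iff_closer (hZ : Z.IsCAT0) {H : Z.Hyperplane} {a b c d : V}
    (hab : s(a, b) ∈ H.dual) (hcd : Z.graph.Adj c d) :
    s(c, d) ∈ H.dual ↔ (c ∈ Z.closer a b ↔ d ∉ Z.closer a b) := by
  have hadj := adj_of_mem_dual hab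
  rw [mem_dual_iff hadj] at hab
  constructor
  · intro h
    rw [mem_dual_iff hcd] at h
    have h1 := closer_eq_of_parallel hZ (Quotient.exact (h.trans hab.symm))
    have h2 : Z.closer a b ∈ {s | ∃ x y, s(a, b) = s(x, y) ∧ s = Z.closer x y} :=
      ⟨a, b, rfl, rfl⟩
    rw [← h1] at h2
    obtain ⟨x, y, hxy, h3⟩ := h2
    rw [h3]
    change s(c, d) = s(x, y) at hxy
    rw [Sym2.eq_iff] at hxy
    obtain ⟨rfl, rfl⟩ | ⟨rfl, rfl⟩ := hxy
    · have h4 := left_mem_closer hZ hcd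
      have h5 := right_notMem_closer (Z := Z) c d
      tauto
    · have h4 := left_mem_closer hZ hcd.symm
      have h5 := right_notMem_closer (Z := Z) d c
      tauto
  · intro h
    by_cases hc : c ∈ Z.closer a b
    · rw [mem_dual_iff hcd, ← hab]
      exact Quotient.sound (parallel_of_closer hZ hadj hcd hc (h.1 hc))
    · rw [Sym2.eq_swap, mem_dual_iff hcd.symm, ← hab]
      exact Quotient.sound (parallel_of_closer hZ hadj hcd.symm (by tauto) hc)

theorem Hyperplane.mem_side_comm {H : Z.Hyperplane} {a b : V} (h : b ∈ H.side a) :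
    H.side a = H.side b := by
  ext c
  exact ⟨fun h' => SimpleGraph.Reachable.trans (SimpleGraph.Reachable.symm h) h',
    fun h' => SimpleGraph.Reachable.trans h h'⟩

theorem Hyperplane.self_mem_side (H : Z.Hyperplane) (a : V) : a ∈ H.side a :=
  SimpleGraph.Reachable.refl _

theorem Hyperplane.mem_side_iff {H : Z.Hyperplane} {a b : V} :
    b ∈ H.side a ↔ H.side b = H.side a :=
  ⟨fun h => (mem_side_comm h).symm, fun h => h ▸ H.self_mem_side b⟩

/-- The edges leaving `closer a b` are exactly the dual edges of `H`, so a path avoiding them cannot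
leave it. Conversely, a geodesic from one of its vertices to `a` stays in it. -/
theorem side_eq_closer (hZ : Z.IsCAT0) {H : Z.Hyperplane} {a b : V} (hab : s(a, b) ∈ H.dual) :
    H.side a = Z.closer a b := by
  have hadj := adj_of_mem_dual hab
  ext v
  constructor
  · rintro ⟨p⟩
    have key : ∀ {x y : V} (p : (Z.graph.deleteEdges H.dual).Walk x y), x ∈ Z.closer a b →
        y ∈ Z.closer a b := by
      intro x y p
      induction p with
      | nil => exact id
      | cons h p ih =>
        intro hx
        rw [SimpleGraph.deleteEdges_adj, mem_dual_iff_closer hZ hab h.1] at h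
        exact ih (by tauto)
    exact key p (left_mem_closer hZ hadj)
  · intro hv
    obtain ⟨n, hn⟩ : ∃ n, Z.graph.dist a v = n := ⟨_, rfl⟩
    revert v
    induction n with
    | zero =>
      intro v hv hn
      obtain rfl : a = v := (hZ.connected.dist_eq_zero_iff).1 hn
      exact H.self_mem_side _
    | succ n ih =>
      intro v hv hn
      obtain ⟨w, hvw, hw⟩ := exists_step hZ (a := v) (b := a) (by
        rintro rfl
        simp at hn)
      have hw' : w ∈ Z.closer a b := by
        rw [mem_closer_iff] at hv ⊢
        have h1 := dist_eq_add_one_or hZ hvw b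
        have h2 := dist_eq_add_one_or hZ hadj w
        have h3 := dist_eq_add_one_or hZ hadj v
        have := Z.dist_comm' v a
        have := Z.dist_comm' v b
        have := Z.dist_comm' w a
        have := Z.dist_comm' w b
        omega
      refine SimpleGraph.Reachable.trans (ih w hw' (by omega)) (SimpleGraph.Adj.reachable ?_)
      rw [SimpleGraph.deleteEdges_adj, mem_dual_iff_closer hZ hab hvw.symm]
      exact ⟨hvw.symm, by tauto⟩

theorem side_eq_iff_dist (hZ : Z.IsCAT0) {H : Z.Hyperplane} {a b : V} (hab : s(a, b) ∈ H.dual)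
    (v : V) : H.side v = H.side a ↔ Z.graph.dist v a < Z.graph.dist v b := by
  rw [← Hyperplane.mem_side_iff, side_eq_closer hZ hab, mem_closer_iff]

/-- A hyperplane has exactly two halfspaces. -/
theorem side_trichotomy (hZ : Z.IsCAT0) (H : Z.Hyperplane) (x y z : V) :
    H.side x = H.side y ∨ H.side x = H.side z ∨ H.side y = H.side z := by
  obtain ⟨a, b, hab⟩ := H.exists_dual
  have key : ∀ v, H.side v = H.side a ∨ H.side v = H.side b := by
    intro v
    have h := dist_eq_add_one_or hZ (adj_of_mem_dual hab) v
    rw [side_eq_iff_dist hZ hab, side_eq_iff_dist hZ (Sym2.eq_swap ▸ hab)]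
    omega
  rcases key x with hx | hx <;> rcases key y with hy | hy <;> rcases key z with hz | hz <;>
    simp [hx, hy, hz]

theorem mem_dual_iff_side (hZ : Z.IsCAT0) {H : Z.Hyperplane} {c d : V}
    (hcd : Z.graph.Adj c d) : s(c, d) ∈ H.dual ↔ H.side c ≠ H.side d := by
  constructor
  · intro h he
    have := (side_eq_iff_dist hZ h d).1 he.symm
    rw [SimpleGraph.dist_self] at this
    omega
  · intro h
    by_contra hn
    refine h (Hyperplane.mem_side_iff.1 (SimpleGraph.Adj.reachable ?_))
    rw [SimpleGraph.deleteEdges_adj, Sym2.eq_swap]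
    exact ⟨hcd.symm, hn⟩

theorem side_ne_of_mem_dual (hZ : Z.IsCAT0) {H : Z.Hyperplane} {c d : V}
    (h : s(c, d) ∈ H.dual) : H.side c ≠ H.side d :=
  (mem_dual_iff_side hZ (adj_of_mem_dual h)).1 h

theorem side_eq_of_mem_dual (hZ : Z.IsCAT0) {H K : Z.Hyperplane} {c d : V}
    (h : s(c, d) ∈ H.dual) (hne : K ≠ H) : K.side c = K.side d := by
  by_contra hcon
  exact hne (eq_of_mem_dual ((mem_dual_iff_side hZ (adj_of_mem_dual h)).2 hcon) h)

/-! ### Convexity -/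

/-- If the step from `a` to `c` crossed `H`, then `b`, being closer to `c`, would lie on the side of
`c`. This one-step convexity of halfspaces also gives convexity of the fibres of the collapse. -/
theorem side_eq_of_step (hZ : Z.IsCAT0) {H : Z.Hyperplane} {a b c : V} (hac : Z.graph.Adj a c)
    (hd : Z.graph.dist b a = Z.graph.dist b c + 1) (h : H.side a = H.side b) :
    H.side c = H.side b := by
  rw [← h]
  by_contra hcon
  have h1 := (mem_dual_iff_side hZ hac).2 (Ne.symm hcon)
  have := (side_eq_iff_dist hZ h1 b).1 h.symm
  omega

theorem side_ne_of_step (hZ : Z.IsCAT0) {H : Z.Hyperplane} {a b c : V} (h : s(a, c) ∈ H.dual)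
    (hd : Z.graph.dist b a = Z.graph.dist b c + 1) : H.side b = H.side c := by
  rw [side_eq_iff_dist hZ (Sym2.eq_swap ▸ h)]
  omega

theorem side_eq_of_dist_add (hZ : Z.IsCAT0) {H : Z.Hyperplane} {a b g : V}
    (hg : Z.graph.dist a b = Z.graph.dist a g + Z.graph.dist g b) (h : H.side a = H.side b) :
    H.side g = H.side b := by
  obtain ⟨n, hn⟩ : ∃ n, Z.graph.dist a g = n := ⟨_, rfl⟩
  induction n generalizing a with
  | zero =>
    obtain rfl : a = g := (hZ.connected.dist_eq_zero_iff).1 hn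
    exact h
  | succ n ih =>
    obtain ⟨c, hac, hc⟩ := exists_step hZ (a := a) (b := g) (by
      rintro rfl
      simp at hn)
    have h1 := hZ.connected.dist_triangle (u := c) (v := g) (w := b)
    have h2 := dist_eq_add_one_or hZ hac b
    rw [Z.dist_comm' g a, Z.dist_comm' g c] at hc
    rw [Z.dist_comm' b a, Z.dist_comm' b c] at h2
    refine ih (by omega) (side_eq_of_step hZ hac ?_ h) (by omega)
    rw [Z.dist_comm' b a, Z.dist_comm' b c]
    omega

theorem exists_separating (hZ : Z.IsCAT0) {a b : V} (h : a ≠ b) :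
    ∃ H : Z.Hyperplane, H.side a ≠ H.side b := by
  obtain ⟨c, hac, hc⟩ := exists_step hZ h
  obtain ⟨H, hH⟩ := exists_hyperplane hac
  exact ⟨H, (side_ne_of_step hZ hH hc) ▸ side_ne_of_mem_dual hZ hH⟩

theorem eq_of_side_eq (hZ : Z.IsCAT0) {a b : V} (h : ∀ H : Z.Hyperplane, H.side a = H.side b) :
    a = b := by
  by_contra hne
  obtain ⟨H, hH⟩ := exists_separating hZ hne
  exact hH (h H)

theorem side_eq_of_ne (hZ : Z.IsCAT0) {H : Z.Hyperplane} {a b c : V} (h₁ : H.side b ≠ H.side a)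
    (h₂ : H.side c ≠ H.side a) : H.side b = H.side c := by
  rcases side_trichotomy hZ H a b c with h | h | h
  · exact absurd h.symm h₁
  · exact absurd h.symm h₂
  · exact h

/-- Two edges at a vertex span a square if some vertex is separated from it by both of their
hyperplanes. -/
theorem exists_sq_of_side (hZ : Z.IsCAT0) {H K : Z.Hyperplane} {a b d v : V}
    (hb : s(a, b) ∈ H.dual) (hd : s(a, d) ∈ K.dual) (hbd : b ≠ d) (h₁ : H.side v ≠ H.side a)
    (h₂ : K.side v ≠ K.side a) : ∃ c, Z.Sq a b c d := by
  have e1 := dist_eq_add_one_or hZ (adj_of_mem_dual hb) v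
  have e2 := dist_eq_add_one_or hZ (adj_of_mem_dual hd) v
  rw [Ne, side_eq_iff_dist hZ hb] at h₁
  rw [Ne, side_eq_iff_dist hZ hd] at h₂
  obtain ⟨c, hc, -⟩ := quadrangle hZ (v := v) (adj_of_mem_dual hb) (adj_of_mem_dual hd) hbd
    (by omega) (by omega)
  exact ⟨c, hc⟩

theorem eq_of_mem_dual_of_mem_dual (hZ : Z.IsCAT0) {H : Z.Hyperplane} {a b c : V}
    (hb : s(a, b) ∈ H.dual) (hc : s(a, c) ∈ H.dual) : b = c := by
  have h1 : H.side b = H.side c :=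
    side_eq_of_ne hZ (side_ne_of_mem_dual hZ hb).symm (side_ne_of_mem_dual hZ hc).symm
  rw [side_eq_iff_dist hZ (Sym2.eq_swap ▸ hc),
    SimpleGraph.dist_eq_one_iff_adj.2 (adj_of_mem_dual hb).symm] at h1
  exact (hZ.connected.dist_eq_zero_iff).1 (by omega)

/-- If `y` is not between `x` and `z`, then some neighbour of `y` is closer to both. -/
theorem exists_step_of_dist_ne (hZ : Z.IsCAT0) {x y z : V}
    (h : Z.graph.dist x z ≠ Z.graph.dist x y + Z.graph.dist y z) :
    ∃ w, Z.graph.Adj y w ∧ Z.graph.dist x y = Z.graph.dist x w + 1 ∧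
      Z.graph.dist z y = Z.graph.dist z w + 1 := by
  obtain ⟨n, hn⟩ : ∃ n, Z.graph.dist z y = n := ⟨_, rfl⟩
  induction n generalizing y with
  | zero =>
    obtain rfl : z = y := (hZ.connected.dist_eq_zero_iff).1 hn
    simp at h
  | succ n ih =>
    obtain ⟨y₁, hy, h1⟩ := exists_step hZ (a := y) (b := z) (by
      rintro rfl
      simp at hn)
    rcases dist_eq_add_one_or hZ hy x with h2 | h2
    · exact ⟨y₁, hy, h2, h1⟩
    · obtain ⟨w₁, hw, h3, h4⟩ := ih (y := y₁) (by
        have := Z.dist_comm' y z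
        have := Z.dist_comm' y₁ z
        omega) (by omega)
      -- From `y₁`, both `y` and `w₁` are one step closer to `x`. The fourth vertex of their square
      -- is closer to `x` than `y`, and being adjacent to `w₁` it is also closer to `z`.
      obtain ⟨w, s, hw'⟩ := quadrangle hZ (v := x) hy.symm hw (by rintro rfl; omega) h2 h3
      refine ⟨w, s.rotate.adj, hw', ?_⟩
      have e1 := dist_eq_add_one_or hZ s.rotate.adj z
      have e2 := dist_eq_add_one_or hZ s.rotate.rotate.adj z
      omega

/-- A hyperplane cannot separate a vertex on a geodesic from both of the endpoints. -/
theorem side_eq_or_of_dist_add (hZ : Z.IsCAT0) (H : Z.Hyperplane) {a b g : V}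
    (hg : Z.graph.dist a b = Z.graph.dist a g + Z.graph.dist g b) :
    H.side g = H.side a ∨ H.side g = H.side b := by
  rcases side_trichotomy hZ H g a b with h | h | h
  · exact .inl h
  · exact .inr h
  · exact .inr (side_eq_of_dist_add hZ hg h)

/-- The gate of `x` in a halfspace. -/
theorem exists_gate (hZ : Z.IsCAT0) (H : Z.Hyperplane) (x b : V) :
    ∃ g, H.side g = H.side b ∧ ∀ z, H.side z = H.side b →
      Z.graph.dist x z = Z.graph.dist x g + Z.graph.dist g z := by
  classical
  have hex : ∃ n, ∃ g, H.side g = H.side b ∧ Z.graph.dist x g = n := ⟨_, b, rfl, rfl⟩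
  obtain ⟨g, hg, hmin⟩ := Nat.find_spec hex
  refine ⟨g, hg, fun z hz => ?_⟩
  by_contra hcon
  obtain ⟨w, hw, h1, h2⟩ := exists_step_of_dist_ne hZ hcon
  have h3 := side_eq_of_step hZ hw h2 (hg.trans hz.symm)
  exact Nat.find_min hex (m := Z.graph.dist x w) (by omega) ⟨w, h3.trans hz, rfl⟩

end CubeComplex

namespace CubeComplex

variable {V : Type u} {Z : CubeComplex V}

/-! ### Carriers -/

theorem Sq.mem_dual_iff {a b c d : V} (s : Z.Sq a b c d) (H : Z.Hyperplane) :
    s(a, b) ∈ H.dual ↔ s(d, c) ∈ H.dual := by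
  rw [CubeComplex.mem_dual_iff s.adj, CubeComplex.mem_dual_iff s.rotate.rotate.adj.symm,
    Quotient.sound (s.parallel s.adj s.rotate.rotate.adj.symm)]

theorem IsCube.adj {n : ℕ} {φ : (Fin n → Bool) → V} (hφ : Z.IsCube n φ) (ε : Fin n → Bool)
    (i : Fin n) : Z.graph.Adj (φ ε) (φ (flipAt ε i)) :=
  Z.adj_update hφ ε i

theorem IsCube.mem_dual {n : ℕ} {φ : (Fin n → Bool) → V} (hφ : Z.IsCube n φ) {H : Z.Hyperplane}
    {i : Fin n} {ε : Fin n → Bool} (h : s(φ ε, φ (flipAt ε i)) ∈ H.dual) (δ : Fin n → Bool) :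
    s(φ δ, φ (flipAt δ i)) ∈ H.dual := by
  refine forall_of_flipAt (p := fun δ => s(φ δ, φ (flipAt δ i)) ∈ H.dual) Finset.univ
    (fun δ j _ hδ => ?_) ε δ (by simp) h
  by_cases hij : i = j
  · subst hij
    rw [flipAt_flipAt, Sym2.eq_swap]
    exact hδ
  · rw [(hφ.sq δ hij).mem_dual_iff, flipAt_comm δ hij] at hδ
    exact hδ

theorem mem_carrier_iff {H : Z.Hyperplane} {a : V} :
    a ∈ H.carrier ↔ ∃ b, s(a, b) ∈ H.dual := by
  constructor
  · rintro ⟨n, φ, hφ, ⟨δ, rfl⟩, ε, i, h⟩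
    exact ⟨_, hφ.mem_dual h δ⟩
  · rintro ⟨b, h⟩
    obtain ⟨φ, hφ, rfl, rfl⟩ := adj_of_mem_dual h
    refine ⟨1, φ, hφ, ⟨_, rfl⟩, fun _ => false, 0, ?_⟩
    convert h using 3
    refine funext fun i => ?_
    obtain rfl : i = 0 := Subsingleton.elim _ _
    simp

/-- Carriers are convex. -/
theorem mem_carrier_of_step (hZ : Z.IsCAT0) {H : Z.Hyperplane} {a b c : V} (ha : a ∈ H.carrier)
    (hb : b ∈ H.carrier) (hac : Z.graph.Adj a c)
    (hd : Z.graph.dist b a = Z.graph.dist b c + 1) : c ∈ H.carrier := by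
  obtain ⟨a', ha'⟩ := mem_carrier_iff.1 ha
  obtain ⟨b', hb'⟩ := mem_carrier_iff.1 hb
  by_cases hca : a' = c
  · subst hca
    exact mem_carrier_iff.2 ⟨a, Sym2.eq_swap ▸ ha'⟩
  obtain ⟨L, hL⟩ := exists_hyperplane hac
  have hLH : L ≠ H := by
    rintro rfl
    exact hca (eq_of_mem_dual_of_mem_dual hZ ha' hL)
  have hLb : L.side b ≠ L.side a := by
    rw [side_ne_of_step hZ hL hd]
    exact (side_ne_of_mem_dual hZ hL).symm
  -- A vertex separated from `a` by both `L` and `H`: either `b` itself or its neighbour across `H`.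
  -- It forces the edges `aa'` and `ac` to span a square.
  obtain ⟨v, hv, hv'⟩ : ∃ v, L.side v ≠ L.side a ∧ H.side v ≠ H.side a := by
    by_cases h : H.side b = H.side a
    · refine ⟨b', ?_, ?_⟩
      · rwa [← side_eq_of_mem_dual hZ hb' hLH]
      · rw [← h]
        exact (side_ne_of_mem_dual hZ hb').symm
    · exact ⟨b, hLb, h⟩
  obtain ⟨d, s⟩ := exists_sq_of_side hZ ha' hL hca hv' hv
  exact mem_carrier_iff.2 ⟨d, (s.mem_dual_iff H).1 ha'⟩

/-- A nearest vertex of a convex set is a gate: if `a` were not between `b` and `z`, some neighbour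
of `a` closer to both would lie in the carrier, against minimality. -/
theorem dist_add_of_mem_carrier (hZ : Z.IsCAT0) {H : Z.Hyperplane} {a b : V}
    (ha : a ∈ H.carrier) (hmin : ∀ z ∈ H.carrier, Z.graph.dist b a ≤ Z.graph.dist b z) {z : V}
    (hz : z ∈ H.carrier) : Z.graph.dist b z = Z.graph.dist b a + Z.graph.dist a z := by
  by_contra hcon
  obtain ⟨w, hw, h1, h2⟩ := exists_step_of_dist_ne hZ hcon
  have := hmin w (mem_carrier_of_step hZ ha hz hw h2)
  omega

/-- The gate `a` lies on a geodesic from `b` to each vertex of the carrier, and no hyperplane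
separates it from both ends. -/
theorem carrier_subset_side (hZ : Z.IsCAT0) {H K : Z.Hyperplane} {a b : V}
    (ha : a ∈ H.carrier) (hmin : ∀ z ∈ H.carrier, Z.graph.dist b a ≤ Z.graph.dist b z)
    (hK : K.side a ≠ K.side b) : H.carrier ⊆ K.side a := by
  intro z hz
  rw [Hyperplane.mem_side_iff]
  exact ((side_eq_or_of_dist_add hZ K (dist_add_of_mem_carrier hZ ha hmin hz)).resolve_left hK).symm

/-- Follow a geodesic from `a` to `b` up to its first edge crossing `L`. If `a` and `b` are in one
fibre of the collapse, then so is the vertex found, by convexity. -/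
theorem exists_dual_between (hZ : Z.IsCAT0) {L : Z.Hyperplane} {a b : V}
    (h : L.side a ≠ L.side b) : ∃ p q, s(p, q) ∈ L.dual ∧
      ∀ K : Z.Hyperplane, K.side a = K.side b → K.side p = K.side b := by
  obtain ⟨n, hn⟩ : ∃ n, Z.graph.dist b a = n := ⟨_, rfl⟩
  induction n generalizing a with
  | zero =>
    obtain rfl : b = a := (hZ.connected.dist_eq_zero_iff).1 hn
    exact absurd rfl h
  | succ n ih =>
    obtain ⟨c, hac, hc⟩ := exists_step hZ (a := a) (b := b) (by rintro rfl; exact h rfl)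
    by_cases hL : L.side a = L.side c
    · obtain ⟨p, q, hpq, hK⟩ := ih (a := c) (hL ▸ h) (by omega)
      exact ⟨p, q, hpq, fun K hab => hK K (side_eq_of_step hZ hac hc hab)⟩
    · exact ⟨a, c, (mem_dual_iff_side hZ hac).2 hL, fun K hab => hab⟩

/-- Two distinct hyperplanes have dual edges such that the only other hyperplanes separating them
are those separating the carriers. -/
theorem exists_bridge (hZ : Z.IsCAT0) (H H' : Z.Hyperplane) :
    ∃ a a' b b', s(a, a') ∈ H.dual ∧ s(b, b') ∈ H'.dual ∧
      ∀ K : Z.Hyperplane, K ∉ Z.Sep H.carrier H'.carrier → K.side a = K.side b := by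
  classical
  have hex : ∃ n, ∃ a ∈ H.carrier, ∃ b ∈ H'.carrier, Z.graph.dist a b = n := by
    obtain ⟨a, a', ha⟩ := H.exists_dual
    obtain ⟨b, b', hb⟩ := H'.exists_dual
    exact ⟨_, a, mem_carrier_iff.2 ⟨_, ha⟩, b, mem_carrier_iff.2 ⟨_, hb⟩, rfl⟩
  -- With `a` and `b` at minimal distance, each is the gate of the other in its carrier, so a
  -- hyperplane separating them separates the whole carriers.
  obtain ⟨a, ha, b, hb, hab⟩ := Nat.find_spec hex
  have hmin : ∀ x ∈ H.carrier, ∀ y ∈ H'.carrier, Z.graph.dist a b ≤ Z.graph.dist x y := by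
    intro x hx y hy
    rw [hab]
    exact Nat.find_min' hex ⟨x, hx, y, hy, rfl⟩
  obtain ⟨a', ha'⟩ := mem_carrier_iff.1 ha
  obtain ⟨b', hb'⟩ := mem_carrier_iff.1 hb
  refine ⟨a, a', b, b', ha', hb', fun K hK => ?_⟩
  by_contra hne
  refine hK ⟨K.side a, ⟨a, rfl⟩, K.side b, ⟨b, rfl⟩, hne, ?_, ?_⟩
  · refine carrier_subset_side hZ ha (b := b) (fun z hz => ?_) hne
    rw [Z.dist_comm' b a, Z.dist_comm' b z]
    exact hmin z hz b hb
  · exact carrier_subset_side hZ hb (b := a) (fun z hz => hmin a ha z hz) (Ne.symm hne)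

/-! ### Cubes and halfspaces -/

theorem IsCube.exists_wall (hZ : Z.IsCAT0) {n : ℕ} {φ : (Fin n → Bool) → V}
    (hφ : Z.IsCube n φ) : ∃ σ : Fin n ↪ Z.Hyperplane, ∀ i ε, s(φ ε, φ (flipAt ε i)) ∈ (σ i).dual := by
  choose σ hσ using fun i => exists_hyperplane (hφ.adj (cubeOrigin n) i)
  refine ⟨⟨σ, fun i j hij => ?_⟩, fun i => hφ.mem_dual (hσ i)⟩
  by_contra hne
  have h1 := hσ i
  rw [hij] at h1
  exact (hφ.sq (cubeOrigin n) hne).ne (eq_of_mem_dual_of_mem_dual hZ h1 (hσ j))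

theorem isFaceMap_side (hZ : Z.IsCAT0) {n : ℕ} {φ : (Fin n → Bool) → V}
    {σ : Fin n ↪ Z.Hyperplane} (hσ : ∀ i ε, s(φ ε, φ (flipAt ε i)) ∈ (σ i).dual) :
    (∀ i ε δ, (σ i).side (φ ε) = (σ i).side (φ δ) ↔ ε i = δ i) ∧
      ∀ H, H ∉ Set.range σ → ∀ ε δ, H.side (φ ε) = H.side (φ δ) := by
  have hside : ∀ (H : Z.Hyperplane) i ε, H ≠ σ i → H.side (φ ε) = H.side (φ (flipAt ε i)) :=
    fun H i ε hne => side_eq_of_mem_dual hZ (hσ i ε) hne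
  have heq : ∀ i ε δ, ε i = δ i → (σ i).side (φ ε) = (σ i).side (φ δ) := by
    intro i ε δ h
    refine forall_of_flipAt (p := fun δ => (σ i).side (φ ε) = (σ i).side (φ δ))
      (Finset.univ.erase i) (fun δ j hj hδ => ?_) ε δ (fun j hj => ?_) rfl
    · exact hδ.trans (hside _ j δ fun hij => (Finset.ne_of_mem_erase hj) (σ.injective hij).symm)
    · obtain rfl : j = i := by simpa using hj
      exact h
  refine ⟨fun i ε δ => ⟨fun h => ?_, heq i ε δ⟩, fun H hH ε δ => ?_⟩
  · by_contra hne
    refine side_ne_of_mem_dual hZ (hσ i ε) (h.trans (heq i δ _ ?_))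
    simp only [flipAt, Function.update_self]
    revert hne
    cases ε i <;> cases δ i <;> simp
  · exact forall_of_flipAt (p := fun δ => H.side (φ ε) = H.side (φ δ)) Finset.univ
      (fun δ j _ hδ => hδ.trans (hside _ j δ fun h => hH ⟨j, h.symm⟩)) ε δ (by simp) rfl

/-- Cubes can be read off from halfspaces alone. For the converse, the edges at the origin have the
prescribed walls, any two of them span a square since both walls separate the origin from a common
vertex, and flagness fills in a cube. It agrees with `φ` because vertices are determined by their
sides. -/
theorem isCube_iff_isFaceMap (hZ : Z.IsCAT0) {n : ℕ} {φ : (Fin n → Bool) → V} :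
    Z.IsCube n φ ↔ IsFaceMap fun ε (H : Z.Hyperplane) => H.side (φ ε) := by
  constructor
  · intro hφ
    obtain ⟨σ, hσ⟩ := hφ.exists_wall hZ
    exact ⟨σ, isFaceMap_side hZ hσ⟩
  · rintro ⟨σ, h, h'⟩
    set o := cubeOrigin n
    have hadj : ∀ i, s(φ o, φ (flipAt o i)) ∈ (σ i).dual := by
      intro i
      have hne : (σ i).side (φ o) ≠ (σ i).side (φ (flipAt o i)) := by
        rw [Ne, h i]
        simp [flipAt]
      have hoth : ∀ H, H ≠ σ i → H.side (φ o) = H.side (φ (flipAt o i)) := by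
        intro H hH
        by_cases hr : H ∈ Set.range σ
        · obtain ⟨j, rfl⟩ := hr
          rw [h j]
          have hji : j ≠ i := fun hji => hH (congrArg σ hji)
          simp [flipAt, Function.update_of_ne hji]
        · exact h' H hr _ _
      -- Only `σ i` separates these two vertices, so the first edge of a geodesic between them
      -- crosses `σ i` and already ends at the target.
      obtain ⟨c, hac, hc⟩ := exists_step hZ (a := φ o) (b := φ (flipAt o i))
        fun he => hne (congrArg _ he)
      obtain ⟨L, hL⟩ := exists_hyperplane hac
      have h1 := side_ne_of_step hZ hL hc
      have h2 := side_ne_of_mem_dual hZ hL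
      obtain rfl : L = σ i := by
        by_contra hne
        exact h2 ((hoth L hne).trans h1)
      obtain rfl : c = φ (flipAt o i) := by
        refine eq_of_side_eq hZ fun H => ?_
        by_cases hH : H = σ i
        · rw [hH, h1]
        · rw [← hoth H hH, side_eq_of_mem_dual hZ hL hH]
      exact hL
    have hinj : ∀ i j, φ (flipAt o i) = φ (flipAt o j) → i = j := by
      intro i j hij
      by_contra hne
      have h1 := (h i (flipAt o i) (flipAt o j)).1 (congrArg _ hij)
      rw [flipAt, flipAt, Function.update_self, Function.update_of_ne hne] at h1
      simp at h1
    have hunit : ∀ i : Fin n, cubeUnit i = flipAt o i := by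
      intro i
      funext j
      by_cases hj : j = i
      · subst hj
        simp [cubeUnit, flipAt, o, cubeOrigin]
      · simp [cubeUnit, flipAt, o, cubeOrigin, hj]
    obtain ⟨ψ, hψ, hψ0, hψu⟩ := hZ.link_flag n (φ o) (fun i => φ (flipAt o i))
      (fun i j hij => hinj i j hij) (fun i => adj_of_mem_dual (hadj i)) (by
        intro i j hij
        obtain ⟨c, s⟩ := exists_sq_of_side hZ (hadj i) (hadj j) (fun h => hij (hinj i j h))
          (v := φ (flipAt (flipAt o i) j))
          (by rw [Ne, h i]; simp [flipAt, Function.update_of_ne hij])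
          (by rw [Ne, h j]; simp [flipAt, Function.update_of_ne hij.symm])
        exact s.exists_corner)
    obtain ⟨τ, hτ⟩ := hψ.exists_wall hZ
    have hτσ : τ = σ := by
      ext i
      have h1 := hτ i o
      rw [hψ0, ← hunit, hψu] at h1
      exact eq_of_mem_dual h1 (hadj i)
    subst hτσ
    obtain ⟨k, k'⟩ := isFaceMap_side hZ hτ
    have : φ = ψ := by
      funext ε
      refine eq_of_side_eq hZ fun H => ?_
      by_cases hr : H ∈ Set.range τ
      · obtain ⟨i, rfl⟩ := hr
        by_cases hε : ε i = o i
        · exact ((h i ε o).2 hε).trans ((congrArg _ hψ0).symm.trans ((k i ε o).2 hε).symm)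
        · refine side_eq_of_ne hZ (a := φ o) (fun he => hε ((h i _ _).1 he)) ?_
          rw [← hψ0]
          exact fun he => hε ((k i _ _).1 he)
      · exact (h' H hr ε o).trans ((congrArg _ hψ0).symm.trans (k' H hr ε o).symm)
    exact this ▸ hψ

/-- Helly property: pairwise intersecting halfspaces, all but finitely many of which contain a
given vertex, have a common vertex. -/
theorem exists_common_vertex (hZ : Z.IsCAT0) (𝓚 : Set Z.Hyperplane) (x : Z.Hyperplane → Set V)
    (hpair : ∀ H ∈ 𝓚, ∀ K ∈ 𝓚, ∃ v, H.side v = x H ∧ K.side v = x K) (a : V)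
    (hfin : {H | H ∈ 𝓚 ∧ H.side a ≠ x H}.Finite) : ∃ v, ∀ H ∈ 𝓚, H.side v = x H := by
  obtain ⟨n, hn⟩ : ∃ n, {H | H ∈ 𝓚 ∧ H.side a ≠ x H}.ncard = n := ⟨_, rfl⟩
  induction n using Nat.strong_induction_on generalizing a with
  | _ n ih =>
    by_cases hall : ∀ H ∈ 𝓚, H.side a = x H
    · exact ⟨a, hall⟩
    push Not at hall
    obtain ⟨H, hH, hne⟩ := hall
    obtain ⟨b, hb, -⟩ := hpair H hH H hH
    -- Passing to the gate in a violated halfspace repairs `H` and spoils nothing: if `a` lies in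
    -- another chosen halfspace, so does some vertex of the halfspace of `H`, and the gate is on a
    -- geodesic between them.
    obtain ⟨g, hg, hgate⟩ := exists_gate hZ H a b
    have hss : {K | K ∈ 𝓚 ∧ K.side g ≠ x K} ⊂ {K | K ∈ 𝓚 ∧ K.side a ≠ x K} := by
      refine ⟨fun K hK => ⟨hK.1, fun hKa => hK.2 ?_⟩, fun hsub => ?_⟩
      · obtain ⟨v, hv, hv'⟩ := hpair H hH K hK.1
        rw [side_eq_of_dist_add hZ (hgate v (hv.trans hb.symm)) (hKa.trans hv'.symm), hv']
      · exact (hsub ⟨hH, hne⟩ : H ∈ {K | K ∈ 𝓚 ∧ K.side g ≠ x K}).2 (hg.trans hb)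
    exact ih _ (hn ▸ Set.ncard_lt_ncard hss hfin) g (hfin.subset hss.1) rfl

end CubeComplex

/-! ### Wall structures -/

/-- `side a K` tells on which side of the wall `K` the vertex `a` is. A cube complex is dual to the
system `W` of walls if its vertices are the consistent choices of sides, and its cubes are determined
by the walls. -/
structure IsWallStructure {V : Type*} {W : Type*} {P : Type*} (Z : CubeComplex V)
    (side : V → W → P) : Prop where
  isCube_iff : ∀ {n : ℕ} {φ : (Fin n → Bool) → V},
    Z.IsCube n φ ↔ IsFaceMap fun ε => side (φ ε)
  ext : ∀ {a b : V}, (∀ K, side a K = side b K) → a = b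
  finite : ∀ a b : V, {K | side a K ≠ side b K}.Finite
  trichotomy : ∀ K a b c, side a K = side b K ∨ side a K = side c K ∨ side b K = side c K
  exists_vertex : ∀ (x : W → P) (a : V), {K | side a K ≠ x K}.Finite →
    (∀ K L, ∃ v, side v K = x K ∧ side v L = x L) → ∃ v, ∀ K, side v K = x K
  exists_edge : ∀ K, ∃ a b, side a K ≠ side b K ∧ ∀ L, L ≠ K → side a L = side b L

/-! ### Product measures on cubes -/

section Cube

variable {V : Type*}

/-- The weight of a vertex of the cube at the point with coordinates `x`. -/
def cubeWeight {n : ℕ} (x : Fin n → unitInterval) (i : Fin n) (b : Bool) : ℝ :=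
  if b then (x i : ℝ) else 1 - (x i : ℝ)

theorem cubeWeight_nonneg {n : ℕ} (x : Fin n → unitInterval) (i : Fin n) (b : Bool) :
    0 ≤ cubeWeight x i b := by
  unfold cubeWeight
  split
  · exact (x i).2.1
  · exact sub_nonneg.2 (x i).2.2

theorem sum_cubeWeight {n : ℕ} (x : Fin n → unitInterval) (i : Fin n) :
    ∑ b, cubeWeight x i b = 1 := by
  simp [cubeWeight]

theorem cubePoint_eq {n : ℕ} (φ : (Fin n → Bool) → V) (x : Fin n → unitInterval) :
    cubePoint φ x = ∑ ε : Fin n → Bool, Finsupp.single (φ ε) (∏ i, cubeWeight x i (ε i)) := rfl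

/-- Marginals of the product weights. -/
theorem sum_prod_cubeWeight {n : ℕ} (x : Fin n → unitInterval) (A : Fin n → Finset Bool) :
    ∑ ε ∈ Fintype.piFinset A, ∏ i, cubeWeight x i (ε i) = ∏ i, ∑ b ∈ A i, cubeWeight x i b :=
  (Finset.prod_univ_sum _ _).symm

theorem sum_univ_prod_cubeWeight {n : ℕ} (x : Fin n → unitInterval) :
    ∑ ε : Fin n → Bool, ∏ i, cubeWeight x i (ε i) = 1 := by
  have := sum_prod_cubeWeight x fun _ => Finset.univ
  rw [Fintype.piFinset_univ] at this
  rw [this]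
  exact Finset.prod_eq_one fun i _ => sum_cubeWeight x i

theorem sum_filter_prod_cubeWeight {n : ℕ} (x : Fin n → unitInterval) (i : Fin n) (b : Bool) :
    ∑ ε : Fin n → Bool, (if ε i = b then ∏ j, cubeWeight x j (ε j) else 0) = cubeWeight x i b := by
  classical
  have h := sum_prod_cubeWeight x fun j => if j = i then {b} else Finset.univ
  rw [← Finset.sum_filter]
  have e : Finset.univ.filter (fun ε : Fin n → Bool => ε i = b) =
      Fintype.piFinset fun j => if j = i then {b} else Finset.univ := by
    ext ε
    simp only [Finset.mem_filter, Finset.mem_univ, true_and, Fintype.mem_piFinset]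
    constructor
    · intro h j
      split_ifs with hj
      · subst hj
        simpa using h
      · simp
    · intro h
      simpa using h i
  rw [e, h, Finset.prod_eq_single i]
  · simp
  · intro j _ hj
    rw [if_neg hj]
    exact sum_cubeWeight x j
  · simp

theorem cubePoint_apply {n : ℕ} {φ : (Fin n → Bool) → V} (hφ : Function.Injective φ)
    (x : Fin n → unitInterval) (δ : Fin n → Bool) :
    cubePoint φ x (φ δ) = ∏ i, cubeWeight x i (δ i) := by
  classical
  rw [cubePoint_eq, Finsupp.finsetSum_apply, Finset.sum_eq_single δ]
  · simp
  · intro ε _ hε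
    rw [Finsupp.single_apply, if_neg fun h => hε (hφ h)]
  · simp

theorem cubePoint_apply_of_notMem {n : ℕ} {φ : (Fin n → Bool) → V} (x : Fin n → unitInterval)
    {u : V} (hu : u ∉ Set.range φ) : cubePoint φ x u = 0 := by
  classical
  rw [cubePoint_eq, Finsupp.finsetSum_apply]
  refine Finset.sum_eq_zero fun ε _ => ?_
  rw [Finsupp.single_apply, if_neg fun h => hu ⟨ε, h⟩]

/-- Finitely supported probability measures. -/
def IsProb (p : V →₀ ℝ) : Prop := (∀ v, 0 ≤ p v) ∧ p.sum (fun _ r => r) = 1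

theorem isProb_cubePoint {n : ℕ} (φ : (Fin n → Bool) → V) (x : Fin n → unitInterval) :
    IsProb (cubePoint φ x) := by
  classical
  constructor
  · intro v
    rw [cubePoint_eq, Finsupp.finsetSum_apply]
    refine Finset.sum_nonneg fun ε _ => ?_
    rw [Finsupp.single_apply]
    split_ifs
    · exact Finset.prod_nonneg fun i _ => cubeWeight_nonneg x i _
    · exact le_rfl
  · rw [cubePoint_eq, ← Finsupp.sum_finsetSum_index (fun _ => rfl) (fun _ _ _ => rfl)]
    simpa using sum_univ_prod_cubeWeight x

theorem IsProb.convexComb {p q : V →₀ ℝ} (hp : IsProb p) (hq : IsProb q) {t : ℝ} (h0 : 0 ≤ t)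
    (h1 : t ≤ 1) : IsProb ((1 - t) • p + t • q) := by
  refine ⟨fun v => ?_, ?_⟩
  · have := hp.1 v
    have := hq.1 v
    have : 0 ≤ 1 - t := sub_nonneg.2 h1
    simp only [Finsupp.coe_add, Finsupp.coe_smul, Pi.add_apply, Pi.smul_apply, smul_eq_mul]
    positivity
  · rw [Finsupp.sum_add_index' (fun _ => rfl) (fun _ _ _ => rfl), Finsupp.sum_smul_index (by simp),
      Finsupp.sum_smul_index (by simp), ← Finsupp.mul_sum, ← Finsupp.mul_sum, hp.2, hq.2]
    ring

theorem IsProb.mapDomain {V' : Type*} {p : V →₀ ℝ} (hp : IsProb p) (f : V → V') :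
    IsProb (p.mapDomain f) := by
  classical
  refine ⟨fun v => ?_, ?_⟩
  · rw [Finsupp.mapDomain, Finsupp.sum_apply]
    refine Finset.sum_nonneg fun w _ => ?_
    dsimp only
    rw [Finsupp.single_apply]
    split_ifs
    · exact hp.1 w
    · exact le_rfl
  · rw [Finsupp.sum_mapDomain_index (fun _ => rfl) (fun _ _ _ => rfl)]
    exact hp.2

end Cube

/-! ### Wall coordinates of a measure and of its retraction -/

section Mass

variable {V : Type*} {W : Type*} {P : Type*}

open Classical in
/-- The mass of the side of `K` containing `u`. -/
noncomputable def mass (side : V → W → P) (p : V →₀ ℝ) (u : V) (K : W) : ℝ :=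
  p.sum fun v r => if side v K = side u K then r else 0

variable {side : V → W → P} {p : V →₀ ℝ}

theorem mass_eq_sum [DecidableEq P] {F : Finset V} (hF : p.support ⊆ F) (u : V) (K : W) :
    mass side p u K = ∑ v ∈ F, if side v K = side u K then p v else 0 := by
  rw [mass, Finsupp.sum_of_support_subset _ hF _ (by simp)]
  refine Finset.sum_congr rfl fun v _ => ?_
  congr

theorem mass_congr {u v : V} {K : W} (h : side u K = side v K) :
    mass side p u K = mass side p v K := by
  rw [mass, mass, h]

theorem mass_nonneg (hp : IsProb p) (u : V) (K : W) : 0 ≤ mass side p u K := by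
  classical
  rw [mass_eq_sum subset_rfl]
  refine Finset.sum_nonneg fun v _ => ?_
  split_ifs
  · exact hp.1 v
  · exact le_rfl

theorem mass_mono (hp : IsProb p) {u v : V} {K L : W}
    (h : ∀ x, side x K = side u K → side x L = side v L) :
    mass side p u K ≤ mass side p v L := by
  classical
  rw [mass_eq_sum subset_rfl, mass_eq_sum subset_rfl]
  refine Finset.sum_le_sum fun x _ => ?_
  by_cases hx : side x K = side u K
  · rw [if_pos hx, if_pos (h x hx)]
  · rw [if_neg hx]
    split_ifs
    · exact hp.1 x
    · exact le_rfl

theorem mass_add_mass (hp : IsProb p)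
    (htri : ∀ K a b c, side a K = side b K ∨ side a K = side c K ∨ side b K = side c K)
    {u v : V} {K : W} (h : side u K ≠ side v K) :
    mass side p u K + mass side p v K = 1 := by
  classical
  rw [← hp.2, mass_eq_sum subset_rfl, mass_eq_sum subset_rfl, ← Finset.sum_add_distrib,
    Finsupp.sum]
  refine Finset.sum_congr rfl fun x _ => ?_
  rcases htri K x u v with hx | hx | hx
  · rw [if_pos hx, if_neg (fun h' => h (hx.symm.trans h')), add_zero]
  · rw [if_pos hx, if_neg (fun h' => h (h'.symm.trans hx)), zero_add]
  · exact absurd hx h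

theorem mass_le_one (hp : IsProb p) (u : V) (K : W) : mass side p u K ≤ 1 := by
  classical
  rw [← hp.2, mass_eq_sum subset_rfl, Finsupp.sum]
  refine Finset.sum_le_sum fun x _ => ?_
  split_ifs
  · exact le_rfl
  · exact hp.1 x

theorem mass_eq_one (hp : IsProb p) {u : V} {K : W}
    (h : ∀ x ∈ p.support, side x K = side u K) : mass side p u K = 1 := by
  classical
  rw [← hp.2, mass_eq_sum subset_rfl, Finsupp.sum]
  exact Finset.sum_congr rfl fun x hx => if_pos (h x hx)

theorem side_eq_of_mass_eq_one (hp : IsProb p) {u : V} {K : W} (h : mass side p u K = 1) :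
    ∀ x ∈ p.support, side x K = side u K := by
  classical
  intro x hx
  by_contra hne
  rw [← hp.2, mass_eq_sum subset_rfl, Finsupp.sum] at h
  have h1 := (Finset.sum_eq_sum_iff_of_le (fun v _ => by
    split_ifs
    · exact le_rfl
    · exact hp.1 v)).1 h x hx
  rw [if_neg hne] at h1
  exact (Finsupp.mem_support_iff.1 hx) h1.symm

theorem exists_of_mass_ne_zero {u : V} {K : W} (h : mass side p u K ≠ 0) :
    ∃ x ∈ p.support, side x K = side u K := by
  classical
  by_contra! hcon
  refine h ?_
  rw [mass_eq_sum subset_rfl]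
  exact Finset.sum_eq_zero fun x hx => if_neg (hcon x hx)

/-- Vanishes unless `p` gives positive mass to both sides of the wall. -/
noncomputable def spread (side : V → W → P) (p : V →₀ ℝ) (u : V) (K : W) : ℝ :=
  mass side p u K * (1 - mass side p u K)

theorem spread_nonneg (hp : IsProb p) (u : V) (K : W) : 0 ≤ spread side p u K :=
  mul_nonneg (mass_nonneg hp u K) (sub_nonneg.2 (mass_le_one hp u K))

theorem spread_eq (hp : IsProb p)
    (htri : ∀ K a b c, side a K = side b K ∨ side a K = side c K ∨ side b K = side c K)
    (u v : V) (K : W) : spread side p u K = spread side p v K := by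
  by_cases h : side u K = side v K
  · rw [spread, spread, mass_congr h]
  · have := mass_add_mass hp htri h
    rw [spread, spread, ← this]
    ring

theorem exists_of_spread_ne_zero (hp : IsProb p) {u : V} {K : W} (h : spread side p u K ≠ 0) :
    ∃ x ∈ p.support, ∃ y ∈ p.support, side x K ≠ side y K := by
  rw [spread, mul_ne_zero_iff] at h
  obtain ⟨x, hx, hxu⟩ := exists_of_mass_ne_zero h.1
  by_contra! hcon
  refine h.2 (sub_eq_zero.2 (mass_eq_one hp fun y hy => ?_).symm)
  rw [← hxu, hcon x hx y hy]

open Classical in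
/-- The total spread of the walls other than `K` that do not cut `A`. -/
noncomputable def spreadBeyond (side : V → W → P) (p : V →₀ ℝ) (u : V) (A : Set V) (K : W) : ℝ :=
  ∑ᶠ L, if L ≠ K ∧ ∀ x ∈ A, ∀ y ∈ A, side x L = side y L then spread side p u L else 0

theorem spreadBeyond_eq_sum [DecidableEq W] {F : Set V} (hF : ↑p.support ⊆ F) (hp : IsProb p)
    {T : Finset W}
    (hT : ∀ K, ∀ x ∈ F, ∀ y ∈ F, side x K ≠ side y K → K ∈ T) (u : V) (A : Set V) (K : W)
    [DecidablePred fun L => ∀ x ∈ A, ∀ y ∈ A, side x L = side y L] :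
    spreadBeyond side p u A K = ∑ L ∈ T, if L ≠ K ∧ ∀ x ∈ A, ∀ y ∈ A, side x L = side y L then
      spread side p u L else 0 := by
  rw [spreadBeyond, finsum_eq_sum_of_support_subset (s := T)]
  · refine Finset.sum_congr rfl fun L _ => ?_
    congr
  · intro L hL
    rw [Function.mem_support] at hL
    obtain ⟨x, hx, y, hy, hxy⟩ := exists_of_spread_ne_zero (u := u) (K := L) hp (by
      intro h
      rw [h, ite_self] at hL
      exact hL rfl)
    exact hT L x (hF hx) y (hF hy) hxy

/-- The side of the wall `K` containing `u`. -/
def sideSet (side : V → W → P) (u : V) (K : W) : Set V := {x | side x K = side u K}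

/-- The coordinate (as mass of the side of `K` containing `u`) of the retraction of `p`. -/
noncomputable def retractMass (side : V → W → P) (p : V →₀ ℝ) (u : V) (K : W) : ℝ :=
  -- A wall not cutting the side of `u` lies beyond `K` as seen from `u`; its spread pulls the point
  -- away from `u`, and walls on the side of `u` pull it back. The weights `1 / mass` make disjoint
  -- sides of different walls compete, so that at most one keeps a positive coordinate. The
  -- convention `x / 0 = 0` is harmless: mass zero on either side makes the other correction term
  -- vanish, leaving the value 0 or 1.
  max 0 (min 1 (mass side p u K +
    spreadBeyond side p u (sideSet side u K)ᶜ K / (1 - mass side p u K) -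
    spreadBeyond side p u (sideSet side u K) K / mass side p u K))

theorem spreadBeyond_nonneg (hp : IsProb p) (u : V) (A : Set V) (K : W) :
    0 ≤ spreadBeyond side p u A K := by
  refine finsum_nonneg fun L => ?_
  split_ifs
  · exact spread_nonneg hp u L
  · exact le_rfl

theorem spreadBeyond_congr (hp : IsProb p)
    (htri : ∀ K a b c, side a K = side b K ∨ side a K = side c K ∨ side b K = side c K)
    (u v : V) (A : Set V) (K : W) :
    spreadBeyond side p u A K = spreadBeyond side p v A K := by
  unfold spreadBeyond
  simp_rw [spread_eq hp htri u v]

/-- If all the mass is on one side of `K`, then a wall not cutting that side has no spread. -/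
theorem spreadBeyond_eq_zero (hp : IsProb p) {u : V} {K : W} (h : mass side p u K = 1) :
    spreadBeyond side p u (sideSet side u K) K = 0 := by
  refine finsum_eq_zero_of_forall_eq_zero fun L => ?_
  split_ifs with hL
  · by_contra hne
    obtain ⟨x, hx, y, hy, hxy⟩ := exists_of_spread_ne_zero hp hne
    have h1 := side_eq_of_mass_eq_one hp h
    exact hxy (hL.2 x (h1 x hx) y (h1 y hy))
  · rfl

theorem compl_sideSet (htri : ∀ K a b c, side a K = side b K ∨ side a K = side c K ∨
    side b K = side c K) {u v : V} {K : W} (h : side u K ≠ side v K) :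
    (sideSet side u K)ᶜ = sideSet side v K := by
  ext x
  simp only [sideSet, Set.mem_compl_iff, Set.mem_ofPred_eq]
  rcases htri K x u v with hx | hx | hx
  · exact ⟨fun h' => absurd hx h', fun h' => absurd (hx.symm.trans h') h⟩
  · exact ⟨fun _ => hx, fun _ h' => h (h'.symm.trans hx)⟩
  · exact absurd hx h

theorem retractMass_congr (hp : IsProb p)
    (htri : ∀ K a b c, side a K = side b K ∨ side a K = side c K ∨ side b K = side c K)
    {u v : V} {K : W} (h : side u K = side v K) :
    retractMass side p u K = retractMass side p v K := by
  have : sideSet side u K = sideSet side v K := by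
    ext x
    simp [sideSet, h]
  rw [retractMass, retractMass, this, mass_congr h, spreadBeyond_congr hp htri u v,
    spreadBeyond_congr hp htri u v]

theorem retractMass_nonneg (u : V) (K : W) : 0 ≤ retractMass side p u K := le_max_left _ _

theorem max_zero_min_one_sub (x : ℝ) : max 0 (min 1 (1 - x)) = 1 - max 0 (min 1 x) := by
  rcases le_total x 0 with h | h
  · rw [min_eq_left (by linarith), min_eq_right (by linarith), max_eq_left h]
    norm_num
  · rcases le_total x 1 with h' | h'
    · rw [min_eq_right (by linarith), min_eq_right h', max_eq_right h, max_eq_right (by linarith)]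
    · rw [min_eq_right (by linarith), min_eq_left h', max_eq_left (by linarith)]
      norm_num

/-- Exchanging the two sides replaces the mass by its complement and swaps the correction terms, so
the clamped expression `x` turns into `1 - x`. -/
theorem retractMass_add (hp : IsProb p)
    (htri : ∀ K a b c, side a K = side b K ∨ side a K = side c K ∨ side b K = side c K)
    {u v : V} {K : W} (h : side u K ≠ side v K) :
    retractMass side p u K + retractMass side p v K = 1 := by
  have hm : mass side p v K = 1 - mass side p u K := by
    linarith [mass_add_mass hp htri h]
  have h1 := compl_sideSet htri h
  have h2 := compl_sideSet htri h.symm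
  rw [retractMass, retractMass, h1, h2, hm, spreadBeyond_congr hp htri v u,
    spreadBeyond_congr hp htri v u]
  rw [← eq_sub_iff_add_eq', ← max_zero_min_one_sub]
  congr 2
  ring

/-- The walls separating points of a finite set. -/
theorem finite_separating {F : Set V} (hF : F.Finite)
    (hfin : ∀ a b : V, {K | side a K ≠ side b K}.Finite) :
    ∃ T : Finset W, ∀ K, K ∈ T ↔ ∃ x ∈ F, ∃ y ∈ F, side x K ≠ side y K := by
  have hf : {K | ∃ x ∈ F, ∃ y ∈ F, side x K ≠ side y K}.Finite := by
    have : {K | ∃ x ∈ F, ∃ y ∈ F, side x K ≠ side y K} =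
        ⋃ x ∈ F, ⋃ y ∈ F, {K | side x K ≠ side y K} := by
      ext
      simp
    rw [this]
    exact hF.biUnion fun x _ => hF.biUnion fun y _ => hfin x y
  exact ⟨hf.toFinset, fun K => hf.mem_toFinset⟩

variable {Z : CubeComplex V}

/-- Strict containment of sides increases `spreadBeyond` by the spread of the larger wall. -/
theorem IsWallStructure.spreadBeyond_add_le (hS : IsWallStructure Z side) (hp : IsProb p)
    {K L : W} (hKL : K ≠ L) (z : V) {u v : V} (h : sideSet side u L ⊆ sideSet side v K) :
    spreadBeyond side p z (sideSet side v K) K + spread side p z K ≤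
      spreadBeyond side p z (sideSet side u L) L := by
  classical
  obtain ⟨T, hT⟩ := finite_separating p.support.finite_toSet hS.finite
  rw [spreadBeyond_eq_sum subset_rfl hp (T := insert K T) fun K x hx y hy h =>
      Finset.mem_insert_of_mem ((hT K).2 ⟨x, hx, y, hy, h⟩),
    spreadBeyond_eq_sum subset_rfl hp (T := insert K T) fun K x hx y hy h =>
      Finset.mem_insert_of_mem ((hT K).2 ⟨x, hx, y, hy, h⟩)]
  have e : spread side p z K = ∑ M ∈ insert K T, if M = K then spread side p z M else 0 := by
    rw [Finset.sum_ite_eq', if_pos (Finset.mem_insert_self _ _)]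
  rw [e, ← Finset.sum_add_distrib]
  refine Finset.sum_le_sum fun M _ => ?_
  have hs := spread_nonneg (side := side) hp z M
  by_cases hMK : M = K
  · subst hMK
    rw [if_neg (by simp), if_pos rfl, zero_add, if_pos]
    exact ⟨hKL, fun x hx y hy => (h hx).trans (h hy).symm⟩
  · rw [if_neg hMK, add_zero]
    split_ifs with h1 h2
    · exact le_rfl
    · refine absurd ⟨?_, fun x hx y hy => h1.2 x (h hx) y (h hy)⟩ h2
      rintro rfl
      -- A smaller wall that did not cut the larger side would induce the same partition as `K`,
      -- which the edge crossing only `K` rules out.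
      obtain ⟨a, b, hab, hoth⟩ := hS.exists_edge K
      have hM := hoth M hMK
      have huv : side u K = side v K := h (show side u M = side u M from rfl)
      have key : ∀ x, side x K = side v K ↔ side x M = side u M := fun x =>
        ⟨fun hx => h1.2 x hx u huv, fun hx => h hx⟩
      have h3 := key a
      rw [hM, ← key b] at h3
      rcases hS.trichotomy K a b v with h4 | h4 | h4
      · exact hab h4
      · exact hab (h4.trans (h3.1 h4).symm)
      · exact hab ((h3.2 h4).trans h4.symm)
    · exact hs
    · exact le_rfl

/-- If the side of `L` at `u` is disjoint from that of `K` at `v` and has positive coordinate, then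
the latter has coordinate zero. -/
theorem IsWallStructure.exists_of_retractMass_pos (hS : IsWallStructure Z side) (hp : IsProb p)
    {u v : V} {K L : W} (hKL : K ≠ L) (hu : 0 < retractMass side p u L)
    (hv : 0 < retractMass side p v K) : ∃ x, side x L = side u L ∧ side x K = side v K := by
  by_contra! hcon
  obtain ⟨w, hw⟩ : ∃ w, side v K ≠ side w K := by
    obtain ⟨a, b, hab, -⟩ := hS.exists_edge K
    by_contra! h
    exact hab ((h a).symm.trans (h b))
  obtain ⟨t, ht⟩ : ∃ t, side u L ≠ side t L := by
    obtain ⟨a, b, hab, -⟩ := hS.exists_edge L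
    by_contra! h
    exact hab ((h a).symm.trans (h b))
  have hKw := compl_sideSet hS.trichotomy hw
  have hLt := compl_sideSet hS.trichotomy ht
  have hsub : sideSet side u L ⊆ sideSet side w K := by
    rw [← hKw]
    exact fun x hx => hcon x hx
  have hsub' : sideSet side v K ⊆ sideSet side t L := by
    rw [← hLt]
    exact fun x hx hx' => hcon x hx' hx
  -- Disjointness puts each side inside the complement of the other. Hence everything beyond `K` as
  -- seen from `L`, and `K` itself, counts against `L`, and symmetrically.
  have e1 := hS.spreadBeyond_add_le hp hKL u hsub
  have e2 := hS.spreadBeyond_add_le hp hKL.symm u hsub'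
  rw [spreadBeyond_congr hp hS.trichotomy u v _ K, spread_eq hp hS.trichotomy u v K, ← hKw] at e1
  rw [spreadBeyond_congr hp hS.trichotomy u v _ K, ← hLt] at e2
  have hm : mass side p u L + mass side p v K ≤ 1 := by
    rw [← mass_add_mass hp hS.trichotomy hw.symm]
    gcongr
    exact mass_mono hp fun x hx => hsub hx
  have n1 := mass_nonneg (side := side) hp u L
  have n2 := mass_nonneg (side := side) hp v K
  have n3 := spreadBeyond_nonneg (side := side) hp u (sideSet side u L) L
  have n4 := spreadBeyond_nonneg (side := side) hp v (sideSet side v K) K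
  have n5 := spreadBeyond_nonneg (side := side) hp u (sideSet side u L)ᶜ L
  have n6 := spreadBeyond_nonneg (side := side) hp v (sideSet side v K)ᶜ K
  have hz1 : mass side p u L = 0 → spreadBeyond side p u (sideSet side u L)ᶜ L = 0 := by
    intro h0
    rw [hLt, spreadBeyond_congr hp hS.trichotomy u t]
    exact spreadBeyond_eq_zero hp (by linarith [mass_add_mass hp hS.trichotomy ht])
  have hz2 : mass side p v K = 0 → spreadBeyond side p v (sideSet side v K)ᶜ K = 0 := by
    intro h0
    rw [hKw, spreadBeyond_congr hp hS.trichotomy v w]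
    exact spreadBeyond_eq_zero hp (by linarith [mass_add_mass hp hS.trichotomy hw])
  unfold retractMass at hu hv
  unfold spread at e1 e2
  generalize mass side p u L = a at *
  generalize mass side p v K = b at *
  generalize spreadBeyond side p u (sideSet side u L) L = S at *
  generalize spreadBeyond side p u (sideSet side u L)ᶜ L = Sc at *
  generalize spreadBeyond side p v (sideSet side v K) K = R at *
  generalize spreadBeyond side p v (sideSet side v K)ᶜ K = Rc at *
  have hu' : 0 < a + Sc / (1 - a) - S / a := by
    by_contra! h
    exact absurd hu (not_lt.2 (max_le le_rfl (min_le_of_right_le h)))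
  have hv' : 0 < b + Rc / (1 - b) - R / b := by
    by_contra! h
    exact absurd hv (not_lt.2 (max_le le_rfl (min_le_of_right_le h)))
  have ha : 0 < a := by
    rcases n1.lt_or_eq with h | h
    · exact h
    · rw [← h, hz1 h.symm] at hu'
      simp at hu'
  have hb : 0 < b := by
    rcases n2.lt_or_eq with h | h
    · exact h
    · rw [← h, hz2 h.symm] at hv'
      simp at hv'
  have ha1 : 0 < 1 - a := by linarith
  have hb1 : 0 < 1 - b := by linarith
  have f1 : (1 - a) * S < a * (a * (1 - a) + Sc) := by
    have : 0 < (a + Sc / (1 - a) - S / a) * (a * (1 - a)) := by positivity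
    have e : (a + Sc / (1 - a) - S / a) * (a * (1 - a)) =
        a * (a * (1 - a) + Sc) - (1 - a) * S := by
      field_simp
    linarith
  have f2 : (1 - b) * R < b * (b * (1 - b) + Rc) := by
    have : 0 < (b + Rc / (1 - b) - R / b) * (b * (1 - b)) := by positivity
    have e : (b + Rc / (1 - b) - R / b) * (b * (1 - b)) =
        b * (b * (1 - b) + Rc) - (1 - b) * R := by
      field_simp
    linarith
  -- The estimates close up to a strict cycle: `g1`, `f1`, `g4`, `g2`, `f2` and `g3` lead from `(1 -
  -- a) * (Rc + b * (1 - b))` back to itself. The inputs to `g3` and `g4` are `a + b ≤ 1`, that is,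
  -- disjoint sides have total mass at most one.
  have g1 : (1 - a) * (Rc + b * (1 - b)) ≤ (1 - a) * S := mul_le_mul_of_nonneg_left e1 ha1.le
  have g2 : (1 - b) * (Sc + a * (1 - a)) ≤ (1 - b) * R := mul_le_mul_of_nonneg_left e2 hb1.le
  have g3 : b * (Rc + b * (1 - b)) ≤ (1 - a) * (Rc + b * (1 - b)) :=
    mul_le_mul_of_nonneg_right (by linarith) (by positivity)
  have g4 : a * (Sc + a * (1 - a)) ≤ (1 - b) * (Sc + a * (1 - a)) :=
    mul_le_mul_of_nonneg_right (by linarith) (by positivity)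
  linarith

end Mass

/-! ### The retraction onto a complex dual to walls -/

section Retract

variable {V : Type*} {W : Type*} {P : Type*} {side : V → W → P} {Z : CubeComplex V}
  {p : V →₀ ℝ}

theorem IsWallStructure.finite_ne_one (hS : IsWallStructure Z side) {m : V → W → ℝ} {a : V}
    (hcongr : ∀ u v K, side u K = side v K → m u K = m v K) (hfin : {K | m a K ≠ 1}.Finite)
    (u : V) : {K | m u K ≠ 1}.Finite := by
  refine (hfin.union (hS.finite a u)).subset fun K hK => ?_
  by_cases h : side a K = side u K
  · exact .inl (by rw [Set.mem_ofPred_eq, hcongr a u K h]; exact hK)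
  · exact .inr h

/-- A consistent choice of a probability measure on the two sides of each wall determines a point of
the cube complex. -/
theorem IsWallStructure.exists_point (hS : IsWallStructure Z side) {m : V → W → ℝ} (a : V)
    (hcongr : ∀ u v K, side u K = side v K → m u K = m v K) (h0 : ∀ u K, 0 ≤ m u K)
    (hadd : ∀ u v K, side u K ≠ side v K → m u K + m v K = 1)
    (hfin : {K | m a K ≠ 1}.Finite)
    (hcons : ∀ u v K L, K ≠ L → 0 < m u L → 0 < m v K →
      ∃ x, side x L = side u L ∧ side x K = side v K) :
    ∃ (n : ℕ) (φ : (Fin n → Bool) → V) (t : Fin n → unitInterval), Z.IsCube n φ ∧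
      (∀ i, 0 < (t i : ℝ) ∧ (t i : ℝ) < 1) ∧ ∀ u, cubePoint φ t u = ∏ᶠ K, m u K := by
  classical
  have hopp : ∀ K, ∃ b, side b K ≠ side a K := by
    intro K
    obtain ⟨x, y, hxy, -⟩ := hS.exists_edge K
    by_contra! h
    exact hxy ((h x).trans (h y).symm)
  choose b hb using hopp
  have hmb : ∀ K, m (b K) K = 1 - m a K := fun K => by linarith [hadd _ _ K (hb K)]
  have hT : {K | m a K ≠ 1 ∧ m a K ≠ 0}.Finite := hfin.subset fun K hK => hK.1
  -- The walls with both coordinates positive are the directions of the cube; on every other wall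
  -- the cube lies on the side of coordinate one. All sides used have positive coordinate, so
  -- `hcons` makes the choices pairwise compatible and each corner is a vertex.
  let T : Set W := {K | m a K ≠ 1 ∧ m a K ≠ 0}
  have : Finite T := hT.to_subtype
  obtain ⟨n, ⟨e⟩⟩ := Finite.exists_equiv_fin T
  let far : (Fin n → Bool) → W → Prop := fun ε K =>
    if h : K ∈ T then ε (e ⟨K, h⟩) = true else m a K = 0
  let rep : (Fin n → Bool) → W → V := fun ε K => if far ε K then b K else a
  have hpos : ∀ ε K, 0 < m (rep ε K) K := by
    intro ε K
    by_cases hK : K ∈ T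
    · simp only [rep]
      split_ifs
      · refine lt_of_le_of_ne (h0 _ _) (Ne.symm ?_)
        rw [hmb, sub_ne_zero]
        exact hK.1.symm
      · exact lt_of_le_of_ne (h0 _ _) hK.2.symm
    · simp only [rep, far, dif_neg hK]
      split_ifs with h
      · rw [hmb, h]
        norm_num
      · exact lt_of_le_of_ne (h0 _ _) (Ne.symm h)
  have hvert : ∀ ε, ∃ v, ∀ K, side v K = side (rep ε K) K := by
    intro ε
    refine hS.exists_vertex _ a (hfin.subset fun K hK => ?_) fun K L => ?_
    · intro h1
      refine hK ?_
      have hKT : K ∉ T := fun h => h.1 h1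
      simp only [rep, far, dif_neg hKT, h1]
      simp
    · by_cases hKL : K = L
      · subst hKL
        exact ⟨_, rfl, rfl⟩
      · exact hcons _ _ L K (Ne.symm hKL) (hpos ε K) (hpos ε L)
  choose φ hφ using hvert
  have hfarT : ∀ ε i, far ε (e.symm i) ↔ ε i = true := by
    intro ε i
    simp only [far, dif_pos (e.symm i).2]
    simp
  have hrepT : ∀ ε i, rep ε (e.symm i) = if ε i then b (e.symm i) else a := by
    intro ε i
    simp only [rep, hfarT]
  have hface : IsFaceMap fun ε => side (φ ε) := by
    refine ⟨e.symm.toEmbedding.trans (Function.Embedding.subtype _), fun i ε δ => ?_,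
      fun K hK ε δ => ?_⟩
    · change side (φ ε) (e.symm i) = side (φ δ) (e.symm i) ↔ _
      rw [hφ, hφ, hrepT, hrepT]
      have := hb (e.symm i)
      cases ε i <;> cases δ i <;> simp [this, this.symm]
    · have hKT : K ∉ T := fun h => hK ⟨e ⟨K, h⟩, by simp⟩
      change side (φ ε) K = side (φ δ) K
      rw [hφ, hφ]
      simp only [rep, far, dif_neg hKT]
  have hcube := hS.isCube_iff.2 hface
  let t : Fin n → unitInterval := fun i => ⟨m (b (e.symm i)) (e.symm i), h0 _ _, by
    rw [hmb]
    linarith [h0 a (e.symm i)]⟩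
  have hfin' := fun u => hS.finite_ne_one hcongr hfin u
  refine ⟨n, φ, t, hcube, fun i => ⟨?_, ?_⟩, fun u => ?_⟩
  · refine lt_of_le_of_ne (h0 _ _) (Ne.symm ?_)
    change m (b (e.symm i)) (e.symm i) ≠ 0
    rw [hmb, sub_ne_zero]
    exact (e.symm i).2.1.symm
  · change m (b (e.symm i)) (e.symm i) < 1
    rw [hmb, sub_lt_self_iff]
    exact lt_of_le_of_ne (h0 _ _) (e.symm i).2.2.symm
  by_cases hu : u ∈ Set.range φ
  · obtain ⟨δ, rfl⟩ := hu
    rw [cubePoint_apply (Z.injective hcube)]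
    have hval : ∀ i, cubeWeight t i (δ i) = m (φ δ) (e.symm i) := by
      intro i
      rw [hcongr _ _ _ (hφ δ _), hrepT]
      unfold cubeWeight
      split_ifs
      · rfl
      · change 1 - m (b (e.symm i)) (e.symm i) = _
        rw [hmb]
        ring
    rw [finprod_eq_prod_of_mulSupport_subset (s := Finset.univ.map
      (e.symm.toEmbedding.trans (Function.Embedding.subtype _))), Finset.prod_map]
    · exact Finset.prod_congr rfl fun i _ => hval i
    · intro K hK
      by_contra hcon
      have hKT : K ∉ T := by
        intro h
        refine hcon ?_
        rw [Finset.mem_coe, Finset.mem_map]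
        exact ⟨e ⟨K, h⟩, Finset.mem_univ _, by simp⟩
      refine hK ?_
      rw [hcongr _ _ _ (hφ δ K)]
      simp only [rep, far, dif_neg hKT]
      split_ifs with h
      · rw [hmb, h, sub_zero]
      · by_contra h1
        exact hKT ⟨h1, h⟩
  · rw [cubePoint_apply_of_notMem _ hu]
    -- If every side of `u` had positive coordinate, `u` would agree with a corner of the cube on
    -- all walls.
    have : ∃ K, m u K = 0 := by
      by_contra! hcon
      obtain ⟨δ, hδ⟩ : ∃ δ : Fin n → Bool,
          ∀ i, δ i = true ↔ side u (e.symm i) ≠ side a (e.symm i) :=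
        ⟨fun i => decide _, fun i => decide_eq_true_iff⟩
      refine hu ⟨δ, hS.ext fun K => ?_⟩
      rw [hφ]
      by_cases hK : K ∈ T
      · obtain ⟨i, hi⟩ : ∃ i, K = e.symm i := ⟨e ⟨K, hK⟩, by simp⟩
        rw [hi, hrepT]
        by_cases h : side u (e.symm i) = side a (e.symm i)
        · rw [if_neg (fun h1 => (hδ i).1 h1 h), h]
        · rw [if_pos ((hδ i).2 h)]
          rcases hS.trichotomy (e.symm i) (b (e.symm i)) u a with h1 | h1 | h1
          · exact h1
          · exact absurd h1 (hb _)
          · exact absurd h1 h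
      · simp only [rep, far, dif_neg hK]
        split_ifs with h
        · rcases hS.trichotomy K (b K) u a with h1 | h1 | h1
          · exact h1
          · exact absurd h1 (hb _)
          · exact absurd ((hcongr _ _ _ h1).trans h) (hcon K)
        · by_contra hne
          have h1 := hadd _ _ K hne
          have h2 : m a K = 1 := by
            by_contra h2
            exact hK ⟨h2, h⟩
          exact hcon K (by linarith)
    obtain ⟨K, hK⟩ := this
    rw [finprod_eq_prod_of_mulSupport_subset (s := (hfin' u).toFinset) _ (by
      intro L hL
      simpa using hL)]
    refine (Finset.prod_eq_zero (i := K) ?_ hK).symm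
    simp [hK]

theorem retractMass_eq_one (hp : IsProb p) {u : V} {K : W} (h : mass side p u K = 1) :
    retractMass side p u K = 1 := by
  rw [retractMass, spreadBeyond_eq_zero hp h, h]
  simp

theorem IsWallStructure.finite_retractMass (hS : IsWallStructure Z side) (hp : IsProb p) (u : V) :
    {K | retractMass side p u K ≠ 1}.Finite := by
  classical
  obtain ⟨T, hT⟩ := finite_separating (side := side) (insert u p.support).finite_toSet hS.finite
  refine T.finite_toSet.subset fun K hK => ?_
  by_contra hKT
  refine hK (retractMass_eq_one hp (mass_eq_one hp fun x hx => ?_))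
  by_contra hne
  exact hKT ((hT K).2 ⟨x, by simp [hx], u, by simp, hne⟩)

theorem IsWallStructure.exists_retract (hS : IsWallStructure Z side) (hp : IsProb p) :
    ∃ (n : ℕ) (φ : (Fin n → Bool) → V) (t : Fin n → unitInterval), Z.IsCube n φ ∧
      (∀ i, 0 < (t i : ℝ) ∧ (t i : ℝ) < 1) ∧
        ∀ u, cubePoint φ t u = ∏ᶠ K, retractMass side p u K := by
  obtain ⟨a, -⟩ : p.support.Nonempty := by
    rw [Finsupp.support_nonempty_iff]
    rintro rfl
    have := hp.2
    simp at this
  exact hS.exists_point a (fun u v K => retractMass_congr hp hS.trichotomy)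
    (fun u K => retractMass_nonneg u K) (fun u v K => retractMass_add hp hS.trichotomy)
    (hS.finite_retractMass hp a) (fun u v K L => hS.exists_of_retractMass_pos hp)

/-- The retraction of the simplex spanned by the vertices onto a CAT(0) cube complex. -/
noncomputable def IsWallStructure.retract (hS : IsWallStructure Z side) (hp : IsProb p) :
    Z.Realization :=
  ⟨cubePoint (hS.exists_retract hp).choose_spec.choose
    (hS.exists_retract hp).choose_spec.choose_spec.choose, _, _, _,
    (hS.exists_retract hp).choose_spec.choose_spec.choose_spec.1, rfl⟩

theorem IsWallStructure.retract_apply (hS : IsWallStructure Z side) (hp : IsProb p) (u : V) :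
    (hS.retract hp).1 u = ∏ᶠ K, retractMass side p u K :=
  (hS.exists_retract hp).choose_spec.choose_spec.choose_spec.2.2 u

namespace CubeComplex

theorem Realization.isProb (q : Z.Realization) : IsProb q.1 := by
  obtain ⟨n, φ, x, -, h⟩ := q.2
  rw [h]
  exact isProb_cubePoint φ x

end CubeComplex

theorem mass_cubePoint [DecidableEq P] {n : ℕ} (φ : (Fin n → Bool) → V) (x : Fin n → unitInterval)
    (u : V) (K : W) : mass side (cubePoint φ x) u K =
      ∑ ε : Fin n → Bool, if side (φ ε) K = side u K then ∏ i, cubeWeight x i (ε i) else 0 := by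
  rw [mass, cubePoint_eq, ← Finsupp.sum_finsetSum_index (fun _ => by simp)
    (fun v r s => by split_ifs <;> simp)]
  refine Finset.sum_congr rfl fun ε _ => ?_
  rw [Finsupp.sum_single_index (by simp)]
  congr

theorem support_cubePoint {n : ℕ} (φ : (Fin n → Bool) → V) (x : Fin n → unitInterval) :
    ↑(cubePoint φ x).support ⊆ Set.range φ := by
  intro v hv
  by_contra h
  exact Finsupp.mem_support_iff.1 hv (cubePoint_apply_of_notMem x h)

/-- The weights on a cube form a product measure whose marginals are the masses of the sides of its
walls. A vertex outside the cube has a side of mass zero. -/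
theorem IsWallStructure.finprod_mass (hS : IsWallStructure Z side) (q : Z.Realization) (u : V) :
    ∏ᶠ K, mass side q.1 u K = q.1 u := by
  classical
  have hprob := CubeComplex.Realization.isProb q
  obtain ⟨n, φ, x, hφ, h⟩ := q.2
  rw [h] at hprob ⊢
  obtain ⟨σ, hσ, hσ'⟩ := hS.isCube_iff.1 hφ
  have hnot : ∀ u K, K ∉ Set.range σ → (∀ ε, side (φ ε) K = side u K) →
      mass side (cubePoint φ x) u K = 1 := by
    intro u K hK hu
    refine mass_eq_one hprob fun v hv => ?_
    obtain ⟨ε, rfl⟩ := support_cubePoint φ x hv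
    exact hu ε
  by_cases hu : u ∈ Set.range φ
  · obtain ⟨δ, rfl⟩ := hu
    rw [cubePoint_apply (Z.injective hφ), finprod_eq_prod_of_mulSupport_subset
      (s := Finset.univ.map σ), Finset.prod_map]
    · refine Finset.prod_congr rfl fun i _ => ?_
      rw [mass_cubePoint, ← sum_filter_prod_cubeWeight x i (δ i)]
      refine Finset.sum_congr rfl fun ε _ => ?_
      have := hσ i ε δ
      dsimp only at this
      simp only [this]
    · intro K hK
      by_contra hcon
      have hKσ : K ∉ Set.range σ := by
        rintro ⟨i, rfl⟩
        exact hcon (by simp)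
      exact hK (hnot _ K hKσ fun ε => hσ' K hKσ ε δ)
  · rw [cubePoint_apply_of_notMem x hu]
    have : ∃ K, mass side (cubePoint φ x) u K = 0 := by
      by_contra! hcon
      refine hu ⟨fun i => decide (side u (σ i) = side (φ fun _ => true) (σ i)),
        hS.ext fun K => ?_⟩
      by_cases hK : K ∈ Set.range σ
      · obtain ⟨i, rfl⟩ := hK
        by_cases h1 : side u (σ i) = side (φ fun _ => true) (σ i)
        · rw [h1]
          exact (hσ i _ _).2 (by simp [h1])
        · rcases hS.trichotomy (σ i) (φ fun i => decide (side u (σ i) = side (φ fun _ => true) (σ i)))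
            u (φ fun _ => true) with h2 | h2 | h2
          · exact h2
          · have := (hσ i _ _).1 h2
            simp [h1] at this
          · exact absurd h2 h1
      · obtain ⟨y, hy, hyu⟩ := exists_of_mass_ne_zero (hcon K)
        obtain ⟨ε, rfl⟩ := support_cubePoint φ x hy
        exact (hσ' K hK _ _).trans hyu
    obtain ⟨K, hK⟩ := this
    obtain ⟨T, hT⟩ := finite_separating (side := side)
      (insert u (cubePoint φ x).support).finite_toSet hS.finite
    rw [finprod_eq_prod_of_mulSupport_subset (s := insert K T)]
    · exact Finset.prod_eq_zero (Finset.mem_insert_self _ _) hK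
    · intro L hL
      rw [Finset.mem_coe, Finset.mem_insert, hT]
      right
      by_contra! hcon
      exact hL (mass_eq_one hprob fun v hv => hcon v (by simp [hv]) u (by simp))

/-- Two walls cutting the support of a point are transverse. -/
theorem IsWallStructure.exists_of_spread_ne_zero (hS : IsWallStructure Z side) (q : Z.Realization)
    {K L : W} (hKL : K ≠ L) {u v : V} (hK : spread side q.1 u K ≠ 0)
    (hL : spread side q.1 u L ≠ 0) : ∃ x y, side x K = side v K ∧ side y K = side v K ∧
      side x L ≠ side y L := by
  have hprob := CubeComplex.Realization.isProb q
  obtain ⟨n, φ, x, hφ, h⟩ := q.2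
  obtain ⟨σ, hσ, hσ'⟩ := hS.isCube_iff.1 hφ
  have key : ∀ K, spread side q.1 u K ≠ 0 → K ∈ Set.range σ := by
    intro K hK
    obtain ⟨x, hx, y, hy, hxy⟩ := _root_.exists_of_spread_ne_zero hprob hK
    rw [h] at hx hy
    obtain ⟨ε, rfl⟩ := support_cubePoint _ _ hx
    obtain ⟨δ, rfl⟩ := support_cubePoint _ _ hy
    by_contra hcon
    exact hxy (hσ' K hcon ε δ)
  obtain ⟨i, rfl⟩ := key K hK
  obtain ⟨j, rfl⟩ := key L hL
  have hij : i ≠ j := fun h => hKL (congrArg σ h)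
  obtain ⟨ε, hε⟩ : ∃ ε, side (φ ε) (σ i) = side v (σ i) := by
    rcases hS.trichotomy (σ i) (φ fun _ => true) (φ fun _ => false) v with h1 | h1 | h1
    · have := (hσ i _ _).1 h1
      simp at this
    · exact ⟨_, h1⟩
    · exact ⟨_, h1⟩
  refine ⟨φ ε, φ (flipAt ε j), hε, ?_, fun h1 => ?_⟩
  · rw [← hε]
    exact (hσ i _ _).2 (by simp [flipAt, Function.update_of_ne hij])
  · have := (hσ j _ _).1 h1
    simp [flipAt] at this

/-- Walls with positive spread at a point of the complex are directions of one cube, hence pairwise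
transverse. None lies beyond another, and the correction terms vanish. -/
theorem IsWallStructure.retractMass_realization (hS : IsWallStructure Z side) (q : Z.Realization)
    (u : V) (K : W) : retractMass side q.1 u K = mass side q.1 u K := by
  have hp := CubeComplex.Realization.isProb q
  have hnn := mass_nonneg (side := side) hp u K
  have hle := mass_le_one (side := side) hp u K
  by_cases hw : spread side q.1 u K = 0
  · rw [spread, mul_eq_zero] at hw
    rcases hw with h | h
    · obtain ⟨v, hv⟩ : ∃ v, side v K ≠ side u K := by
        obtain ⟨x, y, hxy, -⟩ := hS.exists_edge K
        by_contra! h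
        exact hxy ((h x).trans (h y).symm)
      have h1 := mass_add_mass hp hS.trichotomy hv
      have h2 := retractMass_add hp hS.trichotomy hv
      have h3 := retractMass_eq_one (side := side) (u := v) (K := K) hp (by linarith)
      linarith
    · have h1 : mass side q.1 u K = 1 := by linarith
      rw [h1, retractMass_eq_one hp h1]
  · have hz : ∀ v, spreadBeyond side q.1 u (sideSet side v K) K = 0 := by
      intro v
      refine finsum_eq_zero_of_forall_eq_zero fun L => ?_
      split_ifs with hL
      · by_contra hne
        obtain ⟨x, y, hx, hy, hxy⟩ := hS.exists_of_spread_ne_zero q (v := v) hL.1.symm hw hne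
        exact hxy (hL.2 x hx y hy)
      · rfl
    obtain ⟨v, hv⟩ : ∃ v, side u K ≠ side v K := by
      obtain ⟨x, y, hxy, -⟩ := hS.exists_edge K
      by_contra! h
      exact hxy ((h x).symm.trans (h y))
    rw [retractMass, compl_sideSet hS.trichotomy hv, hz, hz]
    simp [hnn, hle]

/-- The retraction is the identity on the cube complex. -/
theorem IsWallStructure.retract_realization (hS : IsWallStructure Z side) (q : Z.Realization)
    (hp : IsProb q.1) : hS.retract hp = q := by
  refine Subtype.ext (Finsupp.ext fun u => ?_)
  rw [hS.retract_apply, ← hS.finprod_mass q]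
  simp_rw [hS.retractMass_realization]

/-! ### Equivariance -/

theorem mass_mapDomain {V' : Type*} {W' : Type*} {P' : Type*} {side' : V' → W' → P'} (e : V → V')
    {u : V} {K : W} {u' : V'} {K' : W'}
    (h : ∀ v, side' (e v) K' = side' u' K' ↔ side v K = side u K) :
    mass side' (p.mapDomain e) u' K' = mass side p u K := by
  classical
  rw [mass, mass, Finsupp.sum_mapDomain_index (by simp) (fun v r s => by split_ifs <;> simp)]
  refine Finsupp.sum_congr fun v _ => ?_
  simp only [h]

theorem retractMass_mapDomain (e : V ≃ V) (f : W ≃ W)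
    (h : ∀ u v K, side (e u) (f K) = side (e v) (f K) ↔ side u K = side v K) (u : V) (K : W) :
    retractMass side (p.mapDomain e) (e u) (f K) = retractMass side p u K := by
  have hm : ∀ L, mass side (p.mapDomain e) (e u) (f L) = mass side p u L := fun L =>
    mass_mapDomain e fun v => h v u L
  have hb : ∀ A : Set V, spreadBeyond side (p.mapDomain e) (e u) (e '' A) (f K) =
      spreadBeyond side p u A K := by
    intro A
    unfold spreadBeyond
    rw [← finsum_comp_equiv f]
    refine finsum_congr fun L => ?_
    have hiff : (f L ≠ f K ∧ ∀ x ∈ e '' A, ∀ y ∈ e '' A, side x (f L) = side y (f L)) ↔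
        L ≠ K ∧ ∀ x ∈ A, ∀ y ∈ A, side x L = side y L := by
      rw [Ne, f.injective.eq_iff]
      simp only [Set.forall_mem_image, h]
    by_cases hL : L ≠ K ∧ ∀ x ∈ A, ∀ y ∈ A, side x L = side y L
    · rw [if_pos hL, if_pos (hiff.2 hL), spread, spread, hm]
    · rw [if_neg hL, if_neg (mt hiff.1 hL)]
  have hset : sideSet side (e u) (f K) = e '' sideSet side u K := by
    ext x
    obtain ⟨x, rfl⟩ := e.surjective x
    rw [e.injective.mem_set_image]
    exact h x u K
  rw [retractMass, retractMass, hm, hset, ← Set.image_compl_eq e.bijective, hb, hb]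

end Retract

/-! ### Continuity in the cell topology -/

section Topology

variable {V : Type u} {Z : CubeComplex V}

namespace CubeComplex

theorem continuous_charMap {n : ℕ} (φ : {φ : (Fin n → Bool) → V // Z.IsCube n φ}) :
    Continuous (Z.charMap φ) := by
  rw [continuous_iff_coinduced_le]
  exact le_iSup₂_of_le (f := fun (n : ℕ) (φ : {φ : (Fin n → Bool) → V // Z.IsCube n φ}) =>
    TopologicalSpace.coinduced (Z.charMap φ) inferInstance) n φ le_rfl

theorem continuous_of_charMap {X : Type*} [TopologicalSpace X] {f : Z.Realization → X}
    (h : ∀ (n : ℕ) (φ : {φ : (Fin n → Bool) → V // Z.IsCube n φ}), Continuous (f ∘ Z.charMap φ)) :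
    Continuous f :=
  continuous_iSup_dom.2 fun n => continuous_iSup_dom.2 fun φ => continuous_coinduced_dom.2 (h n φ)

theorem exists_charMap_eq (q : Z.Realization) :
    ∃ (n : ℕ) (φ : {φ : (Fin n → Bool) → V // Z.IsCube n φ}) (x : Fin n → unitInterval),
      q = Z.charMap φ x := by
  obtain ⟨n, φ, x, hφ, h⟩ := q.2
  exact ⟨n, ⟨φ, hφ⟩, x, Subtype.ext h⟩

/-- The topology is coinduced from cubes, which need not be compatible with products. Currying into
a compact-open function space avoids this, as the second factor is locally compact. -/
theorem continuous_prod_of_charMap {X A : Type*} [TopologicalSpace X] [TopologicalSpace A]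
    [LocallyCompactSpace A] {f : Z.Realization × A → X}
    (h : ∀ (n : ℕ) (φ : {φ : (Fin n → Bool) → V // Z.IsCube n φ}),
      Continuous fun y : (Fin n → unitInterval) × A => f (Z.charMap φ y.1, y.2)) :
    Continuous f := by
  have hf : ∀ q : Z.Realization, Continuous fun t => f (q, t) := by
    intro q
    obtain ⟨n, φ, x, rfl⟩ := exists_charMap_eq q
    exact (h n φ).comp (.prodMk_right x)
  let g : Z.Realization → C(A, X) := fun q => ⟨fun t => f (q, t), hf q⟩
  have hg : Continuous g := by
    refine continuous_of_charMap fun n φ => ?_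
    exact ContinuousMap.continuous_of_continuous_uncurry _ (h n φ)
  exact ContinuousMap.continuous_uncurry_of_continuous ⟨g, hg⟩

theorem continuous_cubePoint_apply {n : ℕ} (φ : (Fin n → Bool) → V) (v : V) :
    Continuous fun x : Fin n → unitInterval => cubePoint φ x v := by
  classical
  simp only [cubePoint_eq, Finsupp.finsetSum_apply, Finsupp.single_apply]
  refine continuous_finsetSum _ fun ε _ => ?_
  split_ifs
  · refine continuous_finsetProd _ fun i _ => ?_
    unfold cubeWeight
    split_ifs <;> fun_prop
  · fun_prop

theorem continuous_apply (v : V) : Continuous fun q : Z.Realization => q.1 v :=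
  continuous_of_charMap fun _ φ => continuous_cubePoint_apply φ.1 v

end CubeComplex

variable {W : Type*} {P : Type*} {side : V → W → P}

open CubeComplex

/-- The retraction fixes the point and presents it with coordinates strictly between 0 and 1, so all
vertices of that cube carry positive weight. -/
theorem IsWallStructure.exists_carrier (hS : IsWallStructure Z side) (q : Z.Realization) :
    ∃ (n : ℕ) (φ : {φ : (Fin n → Bool) → V // Z.IsCube n φ}) (x : Fin n → unitInterval),
      q = Z.charMap φ x ∧ Set.range φ.1 ⊆ q.1.support := by
  obtain ⟨n, φ, t, hφ, ht, h⟩ := hS.exists_retract (Realization.isProb q)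
  have e : q.1 = cubePoint φ t := by
    refine Finsupp.ext fun u => ?_
    rw [h, ← hS.finprod_mass q]
    simp_rw [hS.retractMass_realization]
  refine ⟨n, ⟨φ, hφ⟩, t, Subtype.ext e, ?_⟩
  rintro _ ⟨δ, rfl⟩
  rw [Finset.mem_coe, Finsupp.mem_support_iff, e, cubePoint_apply (Z.injective hφ)]
  refine Finset.prod_ne_zero_iff.2 fun i _ => ?_
  have := ht i
  unfold cubeWeight
  split_ifs <;> linarith

/-- A map into a finite subcomplex is continuous if its coordinates are. -/
theorem IsWallStructure.continuous_of_apply (hS : IsWallStructure Z side) {X : Type*}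
    [TopologicalSpace X] {f : X → Z.Realization} {F : Set V} (hF : F.Finite)
    (hsupp : ∀ x, ↑(f x).1.support ⊆ F) (h : ∀ v, Continuous fun x => (f x).1 v) :
    Continuous f := by
  classical
  rw [continuous_iff_isClosed]
  intro C hC
  let I : Set (Σ n, {φ : (Fin n → Bool) → V // Z.IsCube n φ}) := {c | Set.range c.2.1 ⊆ F}
  have hI : I.Finite := by
    have : Finite F := hF.to_subtype
    have : Fintype F := Fintype.ofFinite F
    have hbound : ∀ c ∈ I, c.1 < Nat.card F + 1 := by
      rintro ⟨n, φ⟩ hc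
      have h1 := Nat.card_le_card_of_injective
        (fun ε => (⟨φ.1 ε, hc ⟨ε, rfl⟩⟩ : F)) fun ε δ hεδ => Z.injective φ.2 (congrArg Subtype.val hεδ)
      have h2 := Nat.lt_two_pow_self (n := n)
      rw [Nat.card_fun, Nat.card_eq_fintype_card (α := Bool), Fintype.card_bool, Nat.card_eq_fintype_card (α := Fin n),
        Fintype.card_fin] at h1
      exact (h2.trans_le h1).trans (Nat.lt_succ_self _)
    let ι : I → Σ n : Fin (Nat.card F + 1), ((Fin n → Bool) → F) := fun c =>
      ⟨⟨c.1.1, hbound c.1 c.2⟩, fun ε => ⟨c.1.2.1 ε, c.2 ⟨ε, rfl⟩⟩⟩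
    have hι : Function.Injective ι := by
      rintro ⟨⟨n, φ, hφ⟩, hc⟩ ⟨⟨m, ψ, hψ⟩, hd⟩ h
      simp only [ι, Sigma.mk.injEq, Fin.mk.injEq] at h
      obtain ⟨rfl, h⟩ := h
      have : φ = ψ := funext fun ε => congrArg Subtype.val (congrFun (eq_of_heq h) ε)
      subst this
      rfl
    exact Set.finite_coe_iff.1 (Finite.of_injective ι hι)
  -- Only finitely many cubes have all vertices in `F`. In weight coordinates, the part of `C` in
  -- each of them is a compact, hence closed, set.
  have hpre : f ⁻¹' C = ⋃ c ∈ I, {x | (fun v => (f x).1 v) ∈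
      (fun y (v : V) => cubePoint c.2.1 y v) '' (Z.charMap c.2 ⁻¹' C)} := by
    ext x
    simp only [Set.mem_preimage, Set.mem_iUnion, Set.mem_image, Set.mem_ofPred_eq]
    constructor
    · intro hx
      obtain ⟨n, φ, y, hy, hr⟩ := hS.exists_carrier (f x)
      refine ⟨⟨n, φ⟩, hr.trans (hsupp x), y, ?_, ?_⟩
      · rwa [← hy]
      · rw [hy]
        rfl
    · rintro ⟨c, -, y, hy, hyx⟩
      have : f x = Z.charMap c.2 y := Subtype.ext (Finsupp.ext fun v => (congrFun hyx v).symm)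
      rwa [this]
  rw [hpre]
  refine hI.isClosed_biUnion fun c _ => ?_
  refine IsClosed.preimage (continuous_pi h) (IsCompact.isClosed (IsCompact.image ?_ ?_))
  · exact (hC.preimage (continuous_charMap c.2)).isCompact
  · exact continuous_pi fun v => continuous_cubePoint_apply c.2.1 v

/-! ### Continuity of the retraction -/

/-- The division is singular only where `a` is 0 or 1. There the potentially singular correction has
the sign that the clamp absorbs, and the other one tends to zero, so the value is squeezed. -/
theorem continuousAt_clamp {X : Type*} [TopologicalSpace X] {a S R : X → ℝ} {x₀ : X}
    (ha : ContinuousAt a x₀) (hS : ContinuousAt S x₀) (hR : ContinuousAt R x₀)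
    (ha0 : ∀ x, 0 ≤ a x) (ha1 : ∀ x, a x ≤ 1) (hS0 : ∀ x, 0 ≤ S x) (hR0 : ∀ x, 0 ≤ R x)
    (h0 : a x₀ = 0 → R x₀ = 0) (h1 : a x₀ = 1 → S x₀ = 0) :
    ContinuousAt (fun x => max 0 (min 1 (a x + R x / (1 - a x) - S x / a x))) x₀ := by
  by_cases ha' : a x₀ = 0
  · have hlim : ContinuousAt (fun x => a x + R x / (1 - a x)) x₀ :=
      ha.add (hR.div (continuousAt_const.sub ha) (by rw [ha']; norm_num))
    have hz : a x₀ + R x₀ / (1 - a x₀) = 0 := by rw [ha', h0 ha']; norm_num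
    rw [ContinuousAt] at hlim ⊢
    rw [hz] at hlim
    have hv : max 0 (min 1 (a x₀ + R x₀ / (1 - a x₀) - S x₀ / a x₀)) = 0 := by
      rw [hz, ha']
      simp
    rw [hv]
    refine squeeze_zero (fun x => le_max_left _ _) (fun x => ?_) hlim
    have e1 : 0 ≤ R x / (1 - a x) := div_nonneg (hR0 x) (sub_nonneg.2 (ha1 x))
    have e2 : 0 ≤ S x / a x := div_nonneg (hS0 x) (ha0 x)
    exact max_le (add_nonneg (ha0 x) e1) ((min_le_right _ _).trans (by linarith))
  · by_cases ha'' : a x₀ = 1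
    · have hlim : ContinuousAt (fun x => min 1 (a x - S x / a x)) x₀ :=
        continuousAt_const.min (ha.sub (hS.div ha ha'))
      have hz : min 1 (a x₀ - S x₀ / a x₀) = 1 := by rw [ha'', h1 ha'']; norm_num
      rw [ContinuousAt] at hlim ⊢
      rw [hz] at hlim
      have hv : max 0 (min 1 (a x₀ + R x₀ / (1 - a x₀) - S x₀ / a x₀)) = 1 := by
        rw [ha'', h1 ha'']
        norm_num
      rw [hv]
      refine tendsto_of_tendsto_of_tendsto_of_le_of_le hlim tendsto_const_nhds (fun x => ?_)
        (fun x => max_le zero_le_one (min_le_left _ _))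
      have e1 : 0 ≤ R x / (1 - a x) := div_nonneg (hR0 x) (sub_nonneg.2 (ha1 x))
      exact (min_le_min le_rfl (by linarith)).trans (le_max_right _ _)
    · have : 1 - a x₀ ≠ 0 := fun h => ha'' (by linarith)
      exact continuousAt_const.max (continuousAt_const.min
        ((ha.add (hR.div (continuousAt_const.sub ha) this)).sub (hS.div ha ha')))

section

variable {X : Type*} [TopologicalSpace X] {p : X → V →₀ ℝ} {F : Set V}

theorem continuous_mass (hF : F.Finite) (hsupp : ∀ x, ↑(p x).support ⊆ F)
    (hc : ∀ v, Continuous fun x => p x v) (u : V) (K : W) :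
    Continuous fun x => mass side (p x) u K := by
  classical
  have hs : ∀ x, (p x).support ⊆ hF.toFinset := fun x v hv => hF.mem_toFinset.2 (hsupp x hv)
  simp only [fun x => mass_eq_sum (hs x) (side := side) u K]
  refine continuous_finsetSum _ fun v _ => ?_
  split_ifs
  · exact hc v
  · fun_prop

theorem continuous_spreadBeyond (hS : IsWallStructure Z side) (hF : F.Finite) (hsupp : ∀ x, ↑(p x).support ⊆ F)
    (hp : ∀ x, IsProb (p x)) (hc : ∀ v, Continuous fun x => p x v) (u : V) (A : Set V) (K : W) :
    Continuous fun x => spreadBeyond side (p x) u A K := by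
  classical
  obtain ⟨T, hT⟩ := finite_separating (side := side) hF hS.finite
  simp only [fun x => spreadBeyond_eq_sum (hsupp x) (hp x) (T := T)
    (fun K a ha b hb h => (hT K).2 ⟨a, ha, b, hb, h⟩) u A K]
  refine continuous_finsetSum _ fun L _ => ?_
  have := continuous_mass (side := side) hF hsupp hc u L
  unfold spread
  split_ifs <;> fun_prop

theorem continuous_retractMass (hS : IsWallStructure Z side) (hF : F.Finite) (hsupp : ∀ x, ↑(p x).support ⊆ F)
    (hp : ∀ x, IsProb (p x)) (hc : ∀ v, Continuous fun x => p x v) (u : V) (K : W) :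
    Continuous fun x => retractMass side (p x) u K := by
  rw [continuous_iff_continuousAt]
  intro x₀
  refine continuousAt_clamp (continuous_mass hF hsupp hc u K).continuousAt
    (continuous_spreadBeyond hS hF hsupp hp hc u _ K).continuousAt
    (continuous_spreadBeyond hS hF hsupp hp hc u _ K).continuousAt
    (fun x => mass_nonneg (hp x) u K) (fun x => mass_le_one (hp x) u K)
    (fun x => spreadBeyond_nonneg (hp x) u _ K) (fun x => spreadBeyond_nonneg (hp x) u _ K)
    (fun h => ?_) (fun h => spreadBeyond_eq_zero (hp x₀) h)
  obtain ⟨v, hv⟩ : ∃ v, side u K ≠ side v K := by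
    obtain ⟨x, y, hxy, -⟩ := hS.exists_edge K
    by_contra! h
    exact hxy ((h x).symm.trans (h y))
  rw [compl_sideSet hS.trichotomy hv, spreadBeyond_congr (hp x₀) hS.trichotomy u v]
  exact spreadBeyond_eq_zero (hp x₀) (by linarith [mass_add_mass (hp x₀) hS.trichotomy hv])

theorem IsWallStructure.finite_hull (hS : IsWallStructure Z side) (x₀ : V) (T : Finset W) :
    {u | ∀ K, K ∉ T → side u K = side x₀ K}.Finite := by
  classical
  refine Set.Finite.of_finite_image (f := fun u => {K | K ∈ T ∧ side u K = side x₀ K}) ?_ ?_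
  · refine (T.finite_toSet.powerset).subset ?_
    rintro _ ⟨u, -, rfl⟩
    exact fun K hK => hK.1
  · intro u hu v hv huv
    refine hS.ext fun K => ?_
    by_cases hK : K ∈ T
    · have := Set.ext_iff.1 huv K
      simp only [Set.mem_ofPred_eq, hK, true_and] at this
      rcases hS.trichotomy K u v x₀ with h | h | h
      · exact h
      · exact h.trans (this.1 h).symm
      · exact (this.2 h).trans h.symm
    · exact (hu K hK).trans (hv K hK).symm

/-- A wall not separating points of `F` gives mass one to the side of `F`, and the retraction keeps
this. The support thus stays in a set of vertices cut by finitely many walls only. -/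
theorem IsWallStructure.exists_support_retract (hS : IsWallStructure Z side) (hF : F.Finite) : ∃ F' : Set V, F'.Finite ∧
    ∀ (p : V →₀ ℝ) (hp : IsProb p), ↑p.support ⊆ F → ↑(hS.retract hp).1.support ⊆ F' := by
  classical
  rcases F.eq_empty_or_nonempty with rfl | ⟨x₀, hx₀⟩
  · refine ⟨∅, Set.finite_empty, fun p hp h => ?_⟩
    rw [Set.subset_empty_iff, Finset.coe_eq_empty, Finsupp.support_eq_empty] at h
    have h2 := hp.2
    rw [h] at h2
    simp at h2
  obtain ⟨T, hT⟩ := finite_separating (side := side) hF hS.finite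
  refine ⟨_, hS.finite_hull x₀ T, fun p hp hsupp u hu K hK => ?_⟩
  by_contra hne
  have h1 : mass side p x₀ K = 1 := mass_eq_one hp fun v hv => by
    by_contra h
    exact hK ((hT K).2 ⟨v, hsupp hv, x₀, hx₀, h⟩)
  have h2 := retractMass_add hp hS.trichotomy hne
  rw [retractMass_eq_one hp h1] at h2
  rw [Finset.mem_coe, Finsupp.mem_support_iff, hS.retract_apply] at hu
  refine hu ?_
  rw [finprod_eq_prod_of_mulSupport_subset (s := (hS.finite_retractMass hp u).toFinset) _ (by
    intro L hL
    simpa using hL)]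
  have h3 : retractMass side p u K = 0 := by linarith
  exact Finset.prod_eq_zero (i := K) (by simp [h3]) h3

theorem IsWallStructure.continuous_retract (hS : IsWallStructure Z side) (hF : F.Finite) (hsupp : ∀ x, ↑(p x).support ⊆ F)
    (hp : ∀ x, IsProb (p x)) (hc : ∀ v, Continuous fun x => p x v) :
    Continuous fun x => hS.retract (hp x) := by
  classical
  obtain ⟨F', hF', h⟩ := hS.exists_support_retract hF
  refine hS.continuous_of_apply hF' (fun x => h _ (hp x) (hsupp x)) fun u => ?_
  simp only [hS.retract_apply]
  obtain ⟨T', hT'⟩ := finite_separating (side := side) (hF.insert u) hS.finite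
  have : ∀ x, ∏ᶠ K, retractMass side (p x) u K = ∏ K ∈ T', retractMass side (p x) u K := by
    intro x
    refine finprod_eq_prod_of_mulSupport_subset _ fun K hK => ?_
    by_contra hKT
    refine hK (retractMass_eq_one (hp x) (mass_eq_one (hp x) fun v hv => ?_))
    by_contra hne
    exact hKT ((hT' K).2 ⟨v, .inr (hsupp x hv), u, .inl rfl, hne⟩)
  simp only [this]
  exact continuous_finsetProd _ fun K _ => continuous_retractMass hS hF hsupp hp hc u K

end

end Topology

/-! ### Equivariance of the retraction -/

section Equivariance

variable {V : Type*} {W : Type*} {P : Type*} {side : V → W → P} {Z : CubeComplex V}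
  {p : V →₀ ℝ} {G : Type*} [Group G] [MulAction G V] [CubicalAction G Z] [MulAction G W]

namespace CubeComplex

theorem Realization.coe_smul (g : G) (q : Z.Realization) : (g • q).1 = q.1.mapDomain (g • ·) := rfl

theorem smul_charMap (g : G) {n : ℕ} (φ : {φ : (Fin n → Bool) → V // Z.IsCube n φ})
    (x : Fin n → unitInterval) :
    g • Z.charMap φ x = Z.charMap ⟨fun ε => g • φ.1 ε, CubicalAction.smul_isCube g φ.2⟩ x :=
  Subtype.ext (mapDomain_cubePoint _ _ _)

end CubeComplex

theorem IsWallStructure.retract_congr (hS : IsWallStructure Z side) {p q : V →₀ ℝ} (hp : IsProb p)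
    (hq : IsProb q) (h : p = q) : hS.retract hp = hS.retract hq := by
  subst h
  rfl

theorem IsWallStructure.retract_smul (hS : IsWallStructure Z side)
    (h : ∀ (g : G) u v K, side (g • u) (g • K) = side (g • v) (g • K) ↔ side u K = side v K)
    (hp : IsProb p) (g : G) (hgp : IsProb (p.mapDomain (g • ·))) :
    hS.retract hgp = g • hS.retract hp := by
  refine Subtype.ext (Finsupp.ext fun u => ?_)
  obtain ⟨u, rfl⟩ := MulAction.surjective g u
  rw [hS.retract_apply, CubeComplex.Realization.coe_smul,
    Finsupp.mapDomain_apply (MulAction.injective g), hS.retract_apply,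
    ← finprod_comp_equiv (MulAction.toPerm g)]
  exact finprod_congr fun K =>
    retractMass_mapDomain (MulAction.toPerm g) (MulAction.toPerm g) (h g) u K

end Equivariance

section

variable {V : Type u} {Z : CubeComplex V} {G : Type w} [Group G] [MulAction G V]
  [CubicalAction G Z]

instance : ContinuousConstSMul G Z.Realization where
  continuous_const_smul g := CubeComplex.continuous_of_charMap fun n φ => by
    simp only [Function.comp_def, CubeComplex.smul_charMap]
    exact CubeComplex.continuous_charMap _

end

/-! ### The two wall structures -/

namespace CubeComplex

section

variable {V : Type u} {Z : CubeComplex V}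

theorem side_eq_of_mem_halfspaces {H : Z.Hyperplane} {s : Set V} (hs : s ∈ H.halfspaces) {a : V}
    (ha : a ∈ s) : H.side a = s := by
  obtain ⟨b, rfl⟩ := hs
  exact Hyperplane.mem_side_iff.1 ha

theorem isWallStructure (hZ : Z.IsCAT0) :
    IsWallStructure Z fun a (H : Z.Hyperplane) => H.side a where
  isCube_iff := isCube_iff_isFaceMap hZ
  ext := eq_of_side_eq hZ
  finite a b := (finite_sides hZ.connected a b).subset fun H hH hb =>
    hH (Hyperplane.mem_side_iff.1 hb).symm
  trichotomy := side_trichotomy hZ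
  exists_vertex x a hfin hpair := by
    obtain ⟨v, hv⟩ := exists_common_vertex hZ Set.univ x (fun H _ K _ => hpair H K) a
      (hfin.subset fun H hH => hH.2)
    exact ⟨v, fun K => hv K trivial⟩
  exists_edge K := by
    obtain ⟨a, b, hab⟩ := K.exists_dual
    exact ⟨a, b, side_ne_of_mem_dual hZ hab, fun L hL => side_eq_of_mem_dual hZ hab hL⟩

end

variable {G : Type w} [Group G] {V : Type u} [MulAction G V] {Z : CubeComplex V}
  [CubicalAction G Z]

theorem smul_side_eq_iff (g : G) (a b : V) (H : Z.Hyperplane) :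
    (g • H).side (g • a) = (g • H).side (g • b) ↔ H.side a = H.side b := by
  rw [← smul_side, ← smul_side]
  exact (MulAction.injective g).eq_iff

variable (hZ : Z.IsCAT0) (𝓗 : SubMulAction G Z.Hyperplane)

/-- This is the only geometric input about the target: neither its link condition nor its simple
connectivity has to be established separately. -/
theorem isWallStructure_collapseRange (hZ : Z.IsCAT0) (𝓗 : SubMulAction G Z.Hyperplane) :
    IsWallStructure (collapseRange 𝓗) fun a K => a.choice K where
  isCube_iff := Iff.rfl
  ext h := SageevVertex.ext (funext h)
  finite a b := by
    obtain ⟨z⟩ := hZ.connected.nonempty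
    refine ((a.finite z).union (b.finite z)).subset fun K hK => ?_
    by_contra h
    rw [Set.mem_union, not_or, Set.mem_ofPred_eq, Set.mem_ofPred_eq, not_not, not_not] at h
    exact hK ((side_eq_of_mem_halfspaces (a.choice_mem K) h.1).symm.trans
      (side_eq_of_mem_halfspaces (b.choice_mem K) h.2))
  trichotomy K a b c := by
    obtain ⟨a', ha⟩ := a.choice_mem K
    obtain ⟨b', hb⟩ := b.choice_mem K
    obtain ⟨c', hc⟩ := c.choice_mem K
    rw [← ha, ← hb, ← hc]
    exact side_trichotomy hZ K.1 a' b' c'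
  exists_vertex x a hfin hpair := by
    refine ⟨⟨x, fun K => ?_, fun K L => ?_, fun b => ?_⟩, fun K => rfl⟩
    · obtain ⟨v, hv, -⟩ := hpair K K
      exact hv ▸ v.choice_mem K
    · obtain ⟨v, hK, hL⟩ := hpair K L
      rw [← hK, ← hL]
      exact v.inter K L
    · refine (hfin.union (a.finite b)).subset fun K hK => ?_
      by_cases h : a.choice K = x K
      · exact .inr (by rw [Set.mem_ofPred_eq, h]; exact hK)
      · exact .inl h
  exists_edge K := by
    obtain ⟨a, b, hab⟩ := K.1.exists_dual
    exact ⟨collapse hZ 𝓗 a, collapse hZ 𝓗 b, side_ne_of_mem_dual hZ hab, fun L hL =>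
      side_eq_of_mem_dual hZ hab fun h => hL (Subtype.ext h)⟩

theorem smul_choice_eq_iff (g : G) (a b : CollapseVertex 𝓗) (K : ↥(𝓗ᶜ)) :
    (g • a).choice (g • K) = (g • b).choice (g • K) ↔ a.choice K = b.choice K := by
  change g • a.choice (g⁻¹ • g • K) = g • b.choice (g⁻¹ • g • K) ↔ _
  rw [inv_smul_smul]
  exact (MulAction.injective g).eq_iff

theorem smul_collapse (g : G) (a : V) : collapse hZ 𝓗 (g • a) = g • collapse hZ 𝓗 a := by
  refine SageevVertex.ext (funext fun K => ?_)
  change K.1.side (g • a) = g • (g⁻¹ • K.1).side a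
  rw [smul_side, smul_inv_smul]

theorem collapse_eq_iff {a b : V} :
    collapse hZ 𝓗 a = collapse hZ 𝓗 b ↔ ∀ H : Z.Hyperplane, H ∉ 𝓗 → H.side a = H.side b :=
  ⟨fun h H hH => congrFun (congrArg SageevVertex.choice h) ⟨H, hH⟩,
    fun h => SageevVertex.ext (funext fun K => h K.1 K.2)⟩

/-- The Helly property of $Z$, applied to the retained hyperplanes only, realises each consistent
choice by a vertex. -/
theorem collapse_surjective : Function.Surjective (collapse hZ 𝓗) := by
  classical
  intro y
  obtain ⟨a⟩ := hZ.connected.nonempty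
  let x : Z.Hyperplane → Set V := fun H => if h : H ∉ 𝓗 then y.choice ⟨H, h⟩ else ∅
  have hx : ∀ (H : Z.Hyperplane) (h : H ∉ 𝓗), x H = y.choice ⟨H, h⟩ := fun H h => dif_pos h
  have hpair : ∀ H ∈ {H | H ∉ 𝓗}, ∀ K ∈ {H | H ∉ 𝓗}, ∃ v, H.side v = x H ∧ K.side v = x K := by
    intro H hH K hK
    rw [hx H hH, hx K hK]
    obtain ⟨z, hz, hz'⟩ := y.inter ⟨H, hH⟩ ⟨K, hK⟩
    exact ⟨z, side_eq_of_mem_halfspaces (y.choice_mem _) hz,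
      side_eq_of_mem_halfspaces (y.choice_mem _) hz'⟩
  have hfin : {H | H ∈ {H | H ∉ 𝓗} ∧ H.side a ≠ x H}.Finite := by
    refine (Set.Finite.image Subtype.val (y.finite a)).subset ?_
    rintro H ⟨hH, hne⟩
    rw [hx H hH] at hne
    exact ⟨⟨H, hH⟩, fun h => hne (side_eq_of_mem_halfspaces (y.choice_mem _) h), rfl⟩
  obtain ⟨v, hv⟩ := exists_common_vertex hZ {H | H ∉ 𝓗} x hpair a hfin
  exact ⟨v, SageevVertex.ext (funext fun K => (hv K.1 K.2).trans (hx K.1 K.2))⟩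

end CubeComplex

/-! ### The collapse on points -/

/-- Forgetting coordinates adds up product weights over the forgotten factors, and each of these
sums to one. -/
theorem cubePoint_comp {V : Type*} {m n : ℕ} (ψ : (Fin m → Bool) → V) {τ : Fin m → Fin n}
    (hτ : Function.Injective τ) (x : Fin n → unitInterval) :
    cubePoint (fun ε => ψ (ε ∘ τ)) x = cubePoint ψ (x ∘ τ) := by
  classical
  rw [cubePoint_eq, cubePoint_eq, ← Finset.sum_fiberwise Finset.univ fun ε : Fin n → Bool => ε ∘ τ]
  refine Finset.sum_congr rfl fun δ _ => ?_
  have h1 : ∀ ε ∈ Finset.univ.filter (fun ε : Fin n → Bool => ε ∘ τ = δ),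
      Finsupp.single (ψ (ε ∘ τ)) (∏ i, cubeWeight x i (ε i)) =
        Finsupp.single (ψ δ) (∏ i, cubeWeight x i (ε i)) := by
    intro ε hε
    rw [(Finset.mem_filter.1 hε).2]
  rw [Finset.sum_congr rfl h1, ← Finsupp.single_finsetSum]
  congr 1
  have h2 : Finset.univ.filter (fun ε : Fin n → Bool => ε ∘ τ = δ) =
      Fintype.piFinset fun i => Finset.univ.filter fun b => ∀ j, τ j = i → b = δ j := by
    ext ε
    simp only [Finset.mem_filter, Finset.mem_univ, true_and, Fintype.mem_piFinset, funext_iff,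
      Function.comp_apply]
    exact ⟨fun h i j hj => hj ▸ h j, fun h j => h _ j rfl⟩
  rw [h2, sum_prod_cubeWeight]
  symm
  refine Fintype.prod_of_injective τ hτ _ _ (fun i hi => ?_) fun j => ?_
  · rw [Finset.filter_true_of_mem fun b _ j hj => (hi ⟨j, hj⟩).elim, sum_cubeWeight]
  · have : Finset.univ.filter (fun b => ∀ k, τ k = τ j → b = δ k) = {δ j} := by
      ext b
      simp only [Finset.mem_filter, Finset.mem_univ, true_and, Finset.mem_singleton]
      exact ⟨fun h => h j rfl, fun h k hk => hτ hk ▸ h⟩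
    rw [this, Finset.sum_singleton]
    rfl

namespace CubeComplex

variable {G : Type w} [Group G] {V : Type u} [MulAction G V] {Z : CubeComplex V}
  [CubicalAction G Z] (hZ : Z.IsCAT0) (𝓗 : SubMulAction G Z.Hyperplane)

theorem exists_cube_collapse {n : ℕ} {φ : (Fin n → Bool) → V} (hφ : Z.IsCube n φ) :
    ∃ (m : ℕ) (ψ : (Fin m → Bool) → CollapseVertex 𝓗) (τ : Fin m → Fin n),
      (collapseRange 𝓗).IsCube m ψ ∧ Function.Injective τ ∧
        ∀ ε, collapse hZ 𝓗 (φ ε) = ψ (ε ∘ τ) := by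
  classical
  obtain ⟨σ, hσ, hσ'⟩ := (isCube_iff_isFaceMap hZ).1 hφ
  let e := (Fintype.equivFin {i // σ i ∉ 𝓗}).symm
  let ext : (Fin (Fintype.card {i // σ i ∉ 𝓗}) → Bool) → Fin n → Bool :=
    -- The value in the collapsed directions is arbitrary, as the collapse does not see it.
    fun δ i => if h : σ i ∉ 𝓗 then δ (e.symm ⟨i, h⟩) else false
  have hext : ∀ δ j, ext δ (e j).1 = δ j := by
    intro δ j
    simp only [ext]
    rw [dif_pos (e j).2]
    simp
  refine ⟨_, fun δ => collapse hZ 𝓗 (φ (ext δ)), fun j => (e j).1,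
    ⟨⟨fun j => ⟨σ (e j).1, (e j).2⟩, fun i j hij => ?_⟩, fun j δ δ' => ?_, fun K hK δ δ' => ?_⟩,
    Subtype.val_injective.comp e.injective, fun ε => ?_⟩
  · exact e.injective (Subtype.ext (σ.injective (congrArg Subtype.val hij)))
  · refine (hσ (e j).1 _ _).trans ?_
    rw [hext, hext]
  · by_cases hKσ : K.1 ∈ Set.range σ
    · obtain ⟨i, hi⟩ := hKσ
      refine absurd ⟨e.symm ⟨i, by rw [hi]; exact K.2⟩, Subtype.ext ?_⟩ hK
      change σ (e (e.symm _)).1 = K.1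
      rw [Equiv.apply_symm_apply]
      exact hi
    · exact hσ' K.1 hKσ _ _
  · refine (collapse_eq_iff hZ 𝓗).2 fun H hH => ?_
    by_cases hHσ : H ∈ Set.range σ
    · obtain ⟨i, rfl⟩ := hHσ
      rw [hσ]
      simp only [ext]
      rw [dif_pos hH]
      simp
    · exact hσ' H hHσ _ _

/-- The collapse on all points. -/
noncomputable def collapseMap (p : Z.Realization) : (collapseRange 𝓗).Realization :=
  ⟨p.1.mapDomain (collapse hZ 𝓗), by
    obtain ⟨n, φ, x, hφ, hp⟩ := p.2
    obtain ⟨m, ψ, τ, hψ, hτ, h⟩ := exists_cube_collapse hZ 𝓗 hφ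
    refine ⟨m, ψ, x ∘ τ, hψ, ?_⟩
    rw [hp, mapDomain_cubePoint, ← cubePoint_comp ψ hτ]
    congr 1
    exact funext h⟩

theorem coe_collapseMap (p : Z.Realization) :
    (collapseMap hZ 𝓗 p).1 = p.1.mapDomain (collapse hZ 𝓗) := rfl

theorem isCollapseImage_iff {p : Z.Realization} {q : (collapseRange 𝓗).Realization} :
    IsCollapseImage hZ 𝓗 p q ↔ q = collapseMap hZ 𝓗 p :=
  (Subtype.ext_iff (a1 := q) (a2 := collapseMap hZ 𝓗 p)).symm

theorem continuous_collapseMap : Continuous (collapseMap hZ 𝓗) := by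
  refine continuous_of_charMap fun n φ => ?_
  refine (isWallStructure_collapseRange hZ 𝓗).continuous_of_apply
    (Set.finite_range (collapse hZ 𝓗 ∘ φ.1)) (fun x => ?_) fun v => ?_
  · have h : ((collapseMap hZ 𝓗 ∘ Z.charMap φ) x).1 = cubePoint (collapse hZ 𝓗 ∘ φ.1) x :=
      mapDomain_cubePoint _ _ _
    rw [h]
    exact support_cubePoint _ _
  · change Continuous fun x => (cubePoint φ.1 x).mapDomain (collapse hZ 𝓗) v
    simp only [mapDomain_cubePoint]
    exact continuous_cubePoint_apply _ _

theorem collapseMap_smul (g : G) (p : Z.Realization) :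
    collapseMap hZ 𝓗 (g • p) = g • collapseMap hZ 𝓗 p := by
  refine Subtype.ext ?_
  rw [Realization.coe_smul, coe_collapseMap, coe_collapseMap, Realization.coe_smul,
    ← Finsupp.mapDomain_comp, ← Finsupp.mapDomain_comp]
  congr 1
  exact funext (smul_collapse hZ 𝓗 g)

end CubeComplex

/-! ### Homotopy equivalences of orbit spaces -/

section OrbitSpace

variable {G X Y : Type*} [Group G] [TopologicalSpace X] [TopologicalSpace Y] [MulAction G X]
  [MulAction G Y]

/-- The map of orbit spaces induced by an equivariant map. -/
def orbitSpaceMap (f : X → Y) (hf : Continuous f) (h : ∀ (g : G) x, f (g • x) = g • f x) :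
    C(Quotient (MulAction.orbitRel G X), Quotient (MulAction.orbitRel G Y)) where
  toFun := Quotient.map f (by
    rintro _ b ⟨g, rfl⟩
    exact ⟨g, (h g b).symm⟩)
  continuous_toFun := hf.quotient_map' _

theorem orbitSpaceMap_homotopic [ContinuousConstSMul G X] {f₀ f₁ : X → Y} (hf₀ : Continuous f₀)
    (h₀ : ∀ (g : G) x, f₀ (g • x) = g • f₀ x) (hf₁ : Continuous f₁)
    (h₁ : ∀ (g : G) x, f₁ (g • x) = g • f₁ x) (F : X × unitInterval → Y) (hF : Continuous F)
    (hFG : ∀ (g : G) x t, F (g • x, t) = g • F (x, t)) (hF0 : ∀ x, F (x, 0) = f₀ x)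
    (hF1 : ∀ x, F (x, 1) = f₁ x) :
    (orbitSpaceMap f₀ hf₀ h₀).Homotopic (orbitSpaceMap f₁ hf₁ h₁) := by
  refine ⟨⟨⟨fun p => Quotient.map (fun x => F (x, p.1)) ?_ p.2, ?_⟩, ?_, ?_⟩⟩
  · rintro _ b ⟨g, rfl⟩
    exact ⟨g, (hFG g b p.1).symm⟩
  -- The orbit map is open, so its product with the interval is still a quotient map and the
  -- homotopy descends.
  · have hq : IsOpenQuotientMap (Quotient.mk (MulAction.orbitRel G X)) :=
      MulAction.isOpenQuotientMap_quotientMk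
    have hq' := (IsOpenQuotientMap.id (X := unitInterval)).prodMap hq
    rw [hq'.isQuotientMap.continuous_iff]
    exact continuous_quotient_mk'.comp (hF.comp continuous_swap)
  · intro q
    induction q using Quotient.inductionOn with
    | _ x => exact congrArg _ (hF0 x)
  · intro q
    induction q using Quotient.inductionOn with
    | _ x => exact congrArg _ (hF1 x)

/-- Choose a representative in each orbit; freeness makes the element carrying it to a given point
unique. -/
theorem exists_equivariant {A B : Type*} [MulAction G A] [MulAction G B]
    (h : ∀ (g : G) (b : B), g • b = b → g = 1) (a : A) :
    ∃ z : B → A, ∀ (g : G) b, z (g • b) = g • z b := by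
  let r : B → B := fun b => (Quotient.mk (MulAction.orbitRel G B) b).out
  have hr : ∀ b, ∃ g : G, g • r b = b := fun b =>
    Setoid.symm' _ (Quotient.mk_out (s := MulAction.orbitRel G B) b)
  choose k hk using hr
  refine ⟨fun b => k b • a, fun g b => ?_⟩
  have e : r (g • b) = r b := congrArg Quotient.out (Quotient.sound ⟨g, rfl⟩)
  have h1 : ((g * k b)⁻¹ * k (g • b)) • r b = r b := by
    rw [mul_smul, ← e, hk, e, inv_smul_eq_iff, mul_smul, hk]
  have h2 := h _ _ h1
  rw [inv_mul_eq_one] at h2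
  change k (g • b) • a = g • k b • a
  rw [← h2, mul_smul]

end OrbitSpace

/-! ### Straight line homotopies -/

namespace CubeComplex

/-- The image of every finite subcomplex is contained in a finite subcomplex. -/
def IsFinitary {V V' : Type*} {Z : CubeComplex V} {Z' : CubeComplex V'}
    (f : Z.Realization → Z'.Realization) : Prop :=
  ∀ F : Set V, F.Finite → ∃ F' : Set V', F'.Finite ∧ ∀ q : Z.Realization, ↑q.1.support ⊆ F →
    ↑(f q).1.support ⊆ F'

theorem IsFinitary.comp {V V' V'' : Type*} {Z : CubeComplex V} {Z' : CubeComplex V'}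
    {Z'' : CubeComplex V''} {f' : Z'.Realization → Z''.Realization}
    {f : Z.Realization → Z'.Realization} (hf' : IsFinitary f') (hf : IsFinitary f) :
    IsFinitary (f' ∘ f) := by
  intro F hF
  obtain ⟨F₁, hF₁, h₁⟩ := hf F hF
  obtain ⟨F₂, hF₂, h₂⟩ := hf' F₁ hF₁
  exact ⟨F₂, hF₂, fun q hq => h₂ _ (h₁ q hq)⟩

end CubeComplex

section StraightLine

open CubeComplex

variable {V : Type u} {W : Type*} {P : Type*} {side : V → W → P} {Z : CubeComplex V}

/-- The straight line homotopy from the identity to `f`. -/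
noncomputable def IsWallStructure.straightLine (hS : IsWallStructure Z side)
    (f : Z.Realization → Z.Realization) (q : Z.Realization × unitInterval) : Z.Realization :=
  hS.retract ((Realization.isProb q.1).convexComb (Realization.isProb (f q.1)) q.2.2.1 q.2.2.2)

theorem IsWallStructure.straightLine_zero (hS : IsWallStructure Z side)
    (f : Z.Realization → Z.Realization) (q : Z.Realization) : hS.straightLine f (q, 0) = q := by
  rw [← hS.retract_realization q (Realization.isProb q)]
  refine hS.retract_congr _ _ ?_
  rw [hS.retract_realization q]
  simp

theorem IsWallStructure.straightLine_one (hS : IsWallStructure Z side)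
    (f : Z.Realization → Z.Realization) (q : Z.Realization) : hS.straightLine f (q, 1) = f q := by
  rw [← hS.retract_realization (f q) (Realization.isProb (f q))]
  refine hS.retract_congr _ _ ?_
  simp

theorem IsWallStructure.straightLine_smul {G : Type*} [Group G] [MulAction G V]
    [CubicalAction G Z] [MulAction G W] (hS : IsWallStructure Z side)
    (h : ∀ (g : G) u v K, side (g • u) (g • K) = side (g • v) (g • K) ↔ side u K = side v K)
    {f : Z.Realization → Z.Realization} (hf : ∀ (g : G) q, f (g • q) = g • f q) (g : G)
    (q : Z.Realization) (t : unitInterval) :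
    hS.straightLine f (g • q, t) = g • hS.straightLine f (q, t) := by
  refine (hS.retract_congr _ (IsProb.mapDomain ((Realization.isProb q).convexComb
    (Realization.isProb (f q)) t.2.1 t.2.2) _) ?_).trans (hS.retract_smul h _ g _)
  simp only [hf]
  rw [Realization.coe_smul, Realization.coe_smul, Finsupp.mapDomain_add, Finsupp.mapDomain_smul,
    Finsupp.mapDomain_smul]

/-- The retraction is continuous along measures with supports in a fixed finite set. On a single
cube the finitary condition on `f` provides such a set. -/
theorem IsWallStructure.continuous_straightLine (hS : IsWallStructure Z side)
    {f : Z.Realization → Z.Realization} (hf : Continuous f) (hfin : IsFinitary f) :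
    Continuous (hS.straightLine f) := by
  classical
  refine continuous_prod_of_charMap fun n φ => ?_
  obtain ⟨F, hF, h⟩ := hfin (Set.range φ.1) (Set.finite_range _)
  refine hS.continuous_retract (F := Set.range φ.1 ∪ F) ((Set.finite_range _).union hF)
    (fun x => ?_) _ fun v => ?_
  · refine (Finset.coe_subset.2 Finsupp.support_add).trans ?_
    rw [Finset.coe_union]
    exact Set.union_subset_union
      ((Finset.coe_subset.2 Finsupp.support_smul).trans (support_cubePoint _ _))
      ((Finset.coe_subset.2 Finsupp.support_smul).trans (h _ (support_cubePoint _ _)))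
  · simp only [Finsupp.add_apply, Finsupp.smul_apply, smul_eq_mul]
    have h1 := continuous_cubePoint_apply φ.1 v
    have h2 := (continuous_apply v).comp (hf.comp (continuous_charMap φ))
    have h1' : Continuous fun x : (Fin n → unitInterval) × unitInterval => cubePoint φ.1 x.1 v :=
      h1.comp continuous_fst
    have h2' : Continuous fun x : (Fin n → unitInterval) × unitInterval =>
      (f (Z.charMap φ x.1)).1 v := h2.comp continuous_fst
    have h3 : Continuous fun x : (Fin n → unitInterval) × unitInterval => (x.2 : ℝ) := by fun_prop
    exact ((continuous_const.sub h3).mul h1').add (h3.mul h2')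

/-! ### Extending maps of vertices -/

variable {V' : Type*} {W' : Type*} {P' : Type*} {side' : V' → W' → P'} {Z' : CubeComplex V'}

/-- The extension of a map on vertices. -/
noncomputable def IsWallStructure.extend (hS : IsWallStructure Z side) (z : V' → V)
    (q : Z'.Realization) : Z.Realization :=
  hS.retract ((Realization.isProb q).mapDomain z)

theorem IsWallStructure.isFinitary_extend (hS : IsWallStructure Z side) (z : V' → V) :
    IsFinitary (hS.extend (Z' := Z') z) := by
  classical
  intro F hF
  obtain ⟨F', hF', h⟩ := hS.exists_support_retract (hF.image z)
  refine ⟨F', hF', fun q hq => h _ _ ?_⟩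
  refine (Finset.coe_subset.2 Finsupp.mapDomain_support).trans ?_
  rw [Finset.coe_image]
  exact Set.image_mono hq

theorem IsWallStructure.continuous_extend (hS : IsWallStructure Z side) (z : V' → V) :
    Continuous (hS.extend (Z' := Z') z) := by
  refine continuous_of_charMap fun n φ => ?_
  refine hS.continuous_retract (Set.finite_range (z ∘ φ.1)) (fun x => ?_)
    (fun x => (Realization.isProb (Z'.charMap φ x)).mapDomain z) fun v => ?_
  · have h : (Z'.charMap φ x).1.mapDomain z = cubePoint (z ∘ φ.1) x := mapDomain_cubePoint _ _ _
    rw [h]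
    exact support_cubePoint _ _
  · change Continuous fun x => (cubePoint φ.1 x).mapDomain z v
    simp only [mapDomain_cubePoint]
    exact continuous_cubePoint_apply _ _

theorem IsWallStructure.extend_smul {G : Type*} [Group G] [MulAction G V] [CubicalAction G Z]
    [MulAction G W] [MulAction G V'] [CubicalAction G Z'] (hS : IsWallStructure Z side)
    (h : ∀ (g : G) u v K, side (g • u) (g • K) = side (g • v) (g • K) ↔ side u K = side v K)
    {z : V' → V} (hz : ∀ (g : G) v, z (g • v) = g • z v) (g : G) (q : Z'.Realization) :
    hS.extend z (g • q) = g • hS.extend z q := by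
  refine (hS.retract_congr _ (IsProb.mapDomain ((Realization.isProb q).mapDomain z) _) ?_).trans
    (hS.retract_smul h _ g _)
  rw [Realization.coe_smul, ← Finsupp.mapDomain_comp, ← Finsupp.mapDomain_comp]
  congr 1
  exact funext (hz g)

end StraightLine

/-! ### Free action on collapsed vertices gives a homotopy equivalence -/

namespace CubeComplex

variable {G : Type w} [Group G] {V : Type u} [MulAction G V] {Z : CubeComplex V}
  [CubicalAction G Z] (hZ : Z.IsCAT0) (𝓗 : SubMulAction G Z.Hyperplane)

theorem isFinitary_collapseMap : IsFinitary (collapseMap hZ 𝓗) := by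
  classical
  intro F hF
  refine ⟨collapse hZ 𝓗 '' F, hF.image _, fun q hq => ?_⟩
  refine (Finset.coe_subset.2 Finsupp.mapDomain_support).trans ?_
  rw [Finset.coe_image]
  exact Set.image_mono hq

/-- A homotopy inverse is the extension of any equivariant map of vertices back to $Z$. No relation
to a section of the collapse is needed, since straight lines join both composites equivariantly to
the identity. -/
theorem inducesHomotopyEquiv_of_free
    (h : ∀ (g : G) (y : CollapseVertex 𝓗), g • y = y → g = 1) : InducesHomotopyEquiv hZ 𝓗 := by
  obtain ⟨a⟩ := hZ.connected.nonempty
  obtain ⟨z, hz⟩ := exists_equivariant h a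
  have hS := isWallStructure hZ
  have hS' := isWallStructure_collapseRange hZ 𝓗
  let c := collapseMap hZ 𝓗
  have hc : Continuous c := continuous_collapseMap hZ 𝓗
  have hcG : ∀ (g : G) p, c (g • p) = g • c p := collapseMap_smul hZ 𝓗
  let s : (collapseRange 𝓗).Realization → Z.Realization := hS.extend z
  have hs : Continuous s := hS.continuous_extend z
  have hsG : ∀ (g : G) p, s (g • p) = g • s p :=
    hS.extend_smul (fun g u v K => smul_side_eq_iff g u v K) hz
  have hscG : ∀ (g : G) p, (s ∘ c) (g • p) = g • (s ∘ c) p := fun g p => by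
    simp only [Function.comp_apply, hcG, hsG]
  have hcsG : ∀ (g : G) p, (c ∘ s) (g • p) = g • (c ∘ s) p := fun g p => by
    simp only [Function.comp_apply, hcG, hsG]
  refine ⟨⟨orbitSpaceMap c hc hcG, orbitSpaceMap s hs hsG, ?_, ?_⟩, fun p => ⟨c p, rfl, rfl⟩⟩
  · have key := orbitSpaceMap_homotopic continuous_id (fun (_ : G) _ => rfl) (hs.comp hc) hscG
      (hS.straightLine (s ∘ c)) (hS.continuous_straightLine (hs.comp hc)
        ((hS.isFinitary_extend z).comp (isFinitary_collapseMap hZ 𝓗)))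
      (hS.straightLine_smul (fun g u v K => smul_side_eq_iff g u v K) hscG)
      (hS.straightLine_zero _) (hS.straightLine_one _)
    convert key.symm using 1
    · ext q
      induction q using Quotient.inductionOn with
      | _ x => rfl
    · ext q
      induction q using Quotient.inductionOn with
      | _ x => rfl
  · have key := orbitSpaceMap_homotopic continuous_id (fun (_ : G) _ => rfl) (hc.comp hs) hcsG
      (hS'.straightLine (c ∘ s)) (hS'.continuous_straightLine (hc.comp hs)
        ((isFinitary_collapseMap hZ 𝓗).comp (hS.isFinitary_extend z)))
      (hS'.straightLine_smul (fun g u v K => smul_choice_eq_iff 𝓗 g u v K) hcsG)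
      (hS'.straightLine_zero _) (hS'.straightLine_one _)
    convert key.symm using 1
    · ext q
      induction q using Quotient.inductionOn with
      | _ x => rfl
    · ext q
      induction q using Quotient.inductionOn with
      | _ x => rfl

end CubeComplex

/-! ### Free homotopies of loops and covering maps -/

/-- Lift the free homotopy. Both endpoints trace lifts of the same path and start at the same point,
so they agree throughout. -/
theorem IsCoveringMap.exists_closed_lift {E B : Type*} [TopologicalSpace E] [TopologicalSpace B]
    {p : E → B} (cov : IsCoveringMap p) (M : C(unitInterval × unitInterval, B))
    (hM : ∀ s, M (s, 0) = M (s, 1)) (γ : C(unitInterval, E)) (hγ : ∀ t, M (0, t) = p (γ t))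
    (h : γ 0 = γ 1) : ∃ δ : C(unitInterval, E), (∀ t, p (δ t) = M (1, t)) ∧ δ 0 = δ 1 := by
  let L := cov.liftHomotopy M γ hγ
  have hL : ∀ s t, p (L (s, t)) = M (s, t) := fun s t =>
    congrFun (cov.liftHomotopy_lifts M γ hγ) (s, t)
  have h0 : ∀ t, L (0, t) = γ t := cov.liftHomotopy_zero M γ hγ
  refine ⟨L.comp (.prodMk (.const _ 1) (.id _)), fun t => hL 1 t, ?_⟩
  have := cov.eq_of_comp_eq (g₁ := fun s => L (s, 0)) (g₂ := fun s => L (s, 1))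
    (L.continuous.comp (.prodMk_left 0)) (L.continuous.comp (.prodMk_left 1))
    (funext fun s => (hL s 0).trans ((hM s).trans (hL s 1).symm)) 0
    (by rw [h0, h0, h])
  exact congrFun this 1

/-- Any two lifts of one path differ by a group element, so one is closed if the other is. -/
theorem IsQuotientCoveringMap.eq_of_closed_lift {E B G : Type*} [TopologicalSpace E]
    [TopologicalSpace B] [Group G] [MulAction G E] {p : E → B} (hp : IsQuotientCoveringMap p G)
    (γ δ : C(unitInterval, E)) (h : ∀ t, p (δ t) = p (γ t)) (hδ : δ 0 = δ 1) : γ 0 = γ 1 := by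
  have : ContinuousConstSMul G E := ⟨hp.continuous_const_smul⟩
  obtain ⟨g, hg⟩ := hp.apply_eq_iff_mem_orbit.1 (h 0)
  have := hp.isCoveringMap.eq_of_comp_eq (g₁ := fun t => g • γ t) (g₂ := δ)
    (γ.continuous.const_smul g) δ.continuous
    (funext fun t => (hp.map_smul g).trans (h t).symm) 0 hg
  refine MulAction.injective g ?_
  change (fun t => g • γ t) 0 = (fun t => g • γ t) 1
  rw [this, hδ]

/-- If `c` induces a homotopy equivalence of orbit spaces, then every path joining two points of an
orbit whose image is a null-homotopic loop is a loop. -/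
theorem IsQuotientCoveringMap.eq_of_nullhomotopic {G X Y : Type*} [Group G] [TopologicalSpace X]
    [TopologicalSpace Y] [MulAction G X] [MulAction G Y]
    (hq : IsQuotientCoveringMap (Quotient.mk (MulAction.orbitRel G X)) G) {c : X → Y}
    (h : ContinuousMap.HomotopyEquiv (Quotient (MulAction.orbitRel G X))
      (Quotient (MulAction.orbitRel G Y)))
    (hh : ∀ p, h.toFun (Quotient.mk _ p) = Quotient.mk _ (c p)) (α : C(unitInterval, X))
    (D : C(unitInterval × unitInterval, Y)) {y : Y} (hD0 : ∀ t, D (0, t) = y)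
    (hD1 : ∀ t, D (1, t) = c (α t)) (hD : ∀ s, D (s, 0) = D (s, 1)) {g : G}
    (hg : g • α 0 = α 1) : α 0 = α 1 := by
  let q : C(X, Quotient (MulAction.orbitRel G X)) := ⟨Quotient.mk _, continuous_quotient_mk'⟩
  let q' : C(Y, Quotient (MulAction.orbitRel G Y)) := ⟨Quotient.mk _, continuous_quotient_mk'⟩
  obtain ⟨e, he⟩ := hq.surjective (h.invFun (q' y))
  -- The first homotopy runs from a constant loop to the image of `c ∘ α` under the homotopy
  -- inverse; a constant lift is closed.
  obtain ⟨δ, hδ, hδ'⟩ := hq.isCoveringMap.exists_closed_lift (h.invFun.comp (q'.comp D))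
    (fun s => by simp only [ContinuousMap.comp_apply, hD]) (.const _ e)
    (fun t => by
      simp only [ContinuousMap.comp_apply, hD0]
      exact he.symm) rfl
  -- The second homotopy moves that loop, through the homotopy from `h.invFun ∘ h.toFun` to the
  -- identity, to the image of `α` itself.
  obtain ⟨K⟩ := h.left_inv
  obtain ⟨δ', hδ₁, hδ₂⟩ := hq.isCoveringMap.exists_closed_lift
    (K.toContinuousMap.comp (.prodMap (.id _) (q.comp α))) (fun s => by
      have : q (α 0) = q (α 1) := by
        rw [← hg]
        exact (hq.map_smul g).symm
      change K (s, q (α 0)) = K (s, q (α 1))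
      rw [this]) δ (fun t => by
      rw [hδ]
      change K (0, q (α t)) = h.invFun (q' (D (1, t)))
      rw [K.apply_zero, hD1]
      exact congrArg h.invFun (hh _)) hδ'
  exact hq.eq_of_closed_lift α δ' (fun t => by
    rw [hδ₁]
    change K (1, q (α t)) = _
    rw [K.apply_one]
    rfl) hδ₂

/-! ### Free actions -/

section Free

open CubeComplex

variable {V : Type*} {W : Type*} {P : Type*} {side : V → W → P} {Z : CubeComplex V}
  {G : Type*} [Group G] [MulAction G V] [CubicalAction G Z] [MulAction G W]

/-- The uniform measure on the invariant finite set is fixed by `g`. Its retraction is then a fixed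
point of the complex. -/
theorem IsWallStructure.eq_one_of_smul_mem (hS : IsWallStructure Z side)
    (h : ∀ (g : G) u v K, side (g • u) (g • K) = side (g • v) (g • K) ↔ side u K = side v K)
    (hfree : ∀ (g : G) (p : Z.Realization), g • p = p → g = 1) {S : Finset V} (hne : S.Nonempty)
    {g : G} (hg : ∀ v ∈ S, g • v ∈ S) : g = 1 := by
  classical
  let p : V →₀ ℝ := ∑ v ∈ S, Finsupp.single v ((S.card : ℝ)⁻¹)
  have hcard : (S.card : ℝ) ≠ 0 := by exact_mod_cast hne.card_ne_zero
  have hp : IsProb p := by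
    refine ⟨fun v => ?_, ?_⟩
    · simp only [p, Finsupp.finsetSum_apply, Finsupp.single_apply]
      exact Finset.sum_nonneg fun w _ => by split_ifs <;> positivity
    · rw [← Finsupp.sum_finsetSum_index (fun _ => rfl) (fun _ _ _ => rfl)]
      simp [hcard]
  have hgp : p.mapDomain (g • ·) = p := by
    have hS' : S.image (g • ·) = S :=
      Finset.eq_of_subset_of_card_le (Finset.image_subset_iff.2 hg)
        (Finset.card_image_of_injective _ (MulAction.injective g)).ge
    have : p = ∑ v ∈ S.image (g • ·), Finsupp.single v ((S.card : ℝ)⁻¹) := by rw [hS']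
    conv_rhs => rw [this, Finset.sum_image (MulAction.injective g).injOn]
    simp only [p, Finsupp.mapDomain_finsetSum, Finsupp.mapDomain_single]
  refine hfree g (hS.retract hp) ?_
  rw [← hS.retract_smul h hp g (hp.mapDomain _)]
  exact hS.retract_congr _ _ hgp

theorem IsWallStructure.isQuotientCoveringMap {V : Type u} {Z : CubeComplex V} {side : V → W → P}
    {G : Type w} [Group G] [MulAction G V] [CubicalAction G Z] [MulAction G W]
    (hS : IsWallStructure Z side)
    (h : ∀ (g : G) u v K, side (g • u) (g • K) = side (g • v) (g • K) ↔ side u K = side v K)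
    (hfree : ∀ (g : G) (p : Z.Realization), g • p = p → g = 1) :
    IsQuotientCoveringMap (Quotient.mk (MulAction.orbitRel G Z.Realization)) G where
  toIsQuotientMap := MulAction.isOpenQuotientMap_quotientMk.isQuotientMap
  continuous_const_smul := continuous_const_smul
  apply_eq_iff_mem_orbit := Quotient.eq
  disjoint e := by
    classical
    set S := e.1.support with hSdef
    have hprob := Realization.isProb e
    have hsum : ∑ v ∈ S, e.1 v = 1 := hprob.2
    have hne : S.Nonempty := by
      rw [Finset.nonempty_iff_ne_empty]
      intro h
      rw [h] at hsum
      simp at hsum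
    obtain ⟨v₀, hv₀, hmin⟩ := S.exists_min_image e.1 hne
    have hpos : 0 < e.1 v₀ := lt_of_le_of_ne (hprob.1 v₀) (Finsupp.mem_support_iff.1 hv₀).symm
    -- If `q` loses less than `η` at each vertex of `S`, its mass outside `S` is at most `η *
    -- S.card`, which is the least weight of `e` minus `η`. No translate of a vertex outside `S` can
    -- then have the weight required in `S`, so the group element preserves `S`.
    set η := e.1 v₀ / (S.card + 1) with hη
    have hc : (0 : ℝ) < S.card + 1 := by positivity
    have hη' : η * S.card + η = e.1 v₀ := by
      rw [hη]
      field_simp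
    have hηpos : 0 < η := div_pos hpos hc
    refine ⟨⋂ v ∈ S, {q | e.1 v - η < q.1 v}, ?_, ?_⟩
    · refine (Filter.biInter_finset_mem S).2 fun v _ => ?_
      exact (isOpen_lt continuous_const (continuous_apply v)).mem_nhds
        (show e.1 v - η < e.1 v by linarith)
    · rintro g ⟨_, ⟨q, hq, rfl⟩, hgq⟩
      simp only [Set.mem_iInter, Set.mem_ofPred_eq] at hq hgq
      have key : ∀ v ∈ S, g⁻¹ • v ∈ S := by
        intro v hv
        by_contra hv'
        have h1 := hgq v hv
        have h2 : (g • q).1 v = q.1 (g⁻¹ • v) := by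
          conv_lhs => rw [← smul_inv_smul g v]
          exact Finsupp.mapDomain_apply (MulAction.injective g) _ _
        have hq1 := Realization.isProb q
        have h3 : q.1 (g⁻¹ • v) + ∑ v ∈ S, q.1 v ≤ 1 := by
          rw [← hq1.2, ← Finset.sum_insert hv', Finsupp.sum_of_support_subset q.1
            (s := insert (g⁻¹ • v) S ∪ q.1.support) Finset.subset_union_right _ (fun _ _ => rfl)]
          exact Finset.sum_le_sum_of_subset_of_nonneg Finset.subset_union_left
            fun w _ _ => hq1.1 w
        have h4 : ∑ v ∈ S, (e.1 v - η) ≤ ∑ v ∈ S, q.1 v :=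
          Finset.sum_le_sum fun w hw => (hq w hw).le
        rw [Finset.sum_sub_distrib, hsum, Finset.sum_const, nsmul_eq_mul] at h4
        have h5 := hmin v hv
        have h6 : e.1 v - η < q.1 (g⁻¹ • v) := h2 ▸ h1
        nlinarith
      exact inv_eq_one.1 (hS.eq_one_of_smul_mem h hfree hne key)

end Free

/-! ### Homotopy equivalences force free actions -/

namespace CubeComplex

variable {V : Type u} {Z : CubeComplex V}

/-- A vertex as a point. -/
noncomputable def point (Z : CubeComplex V) (v : V) : Z.Realization :=
  ⟨Finsupp.single v 1, 0, fun _ => v, Fin.elim0, Z.vertex v, by simp [cubePoint]⟩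

variable {G : Type w} [Group G] [MulAction G V] [CubicalAction G Z]

theorem smul_point (g : G) (v : V) : g • Z.point v = Z.point (g • v) :=
  Subtype.ext Finsupp.mapDomain_single

end CubeComplex

section

open CubeComplex

variable {V : Type u} {Z : CubeComplex V}

theorem CubeComplex.isFinitary_const {V' : Type*} {Z' : CubeComplex V'} (q : Z.Realization) :
    IsFinitary fun _ : Z'.Realization => q :=
  fun _ _ => ⟨↑q.1.support, Finset.finite_toSet _, fun _ _ => le_rfl⟩

theorem IsWallStructure.exists_path {W : Type*} {P : Type*} {side : V → W → P}
    (hS : IsWallStructure Z side) (p q : Z.Realization) :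
    ∃ α : C(unitInterval, Z.Realization), α 0 = p ∧ α 1 = q := by
  have h := hS.continuous_straightLine (continuous_const (y := q)) (isFinitary_const (Z' := Z) q)
  refine ⟨⟨fun t => hS.straightLine (fun _ => q) (p, t), h.comp (.prodMk_right p)⟩, ?_, ?_⟩
  · rw [ContinuousMap.coe_mk]
    exact hS.straightLine_zero _ p
  · rw [ContinuousMap.coe_mk]
    exact hS.straightLine_one _ p

theorem IsWallStructure.exists_contraction {W : Type*} {P : Type*} {side : V → W → P}
    (hS : IsWallStructure Z side) (α : C(unitInterval, Z.Realization)) (h : α 0 = α 1)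
    (q : Z.Realization) : ∃ D : C(unitInterval × unitInterval, Z.Realization),
      (∀ t, D (0, t) = q) ∧ (∀ t, D (1, t) = α t) ∧ ∀ s, D (s, 0) = D (s, 1) := by
  have hc := hS.continuous_straightLine (continuous_const (y := q)) (isFinitary_const (Z' := Z) q)
  refine ⟨⟨fun x => hS.straightLine (fun _ => q) (α x.2, unitInterval.symm x.1), hc.comp
    ((α.continuous.comp continuous_snd).prodMk (unitInterval.continuous_symm.comp continuous_fst))⟩,
    fun t => ?_, fun t => ?_, fun s => ?_⟩
  · simp only [ContinuousMap.coe_mk, unitInterval.symm_zero]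
    exact hS.straightLine_one _ _
  · simp only [ContinuousMap.coe_mk, unitInterval.symm_one]
    exact hS.straightLine_zero _ _
  · simp only [ContinuousMap.coe_mk, h]

end

namespace CubeComplex

variable {G : Type w} [Group G] {V : Type u} [MulAction G V] {Z : CubeComplex V}
  [CubicalAction G Z] (hZ : Z.IsCAT0) (𝓗 : SubMulAction G Z.Hyperplane)

theorem collapseMap_point (v : V) :
    collapseMap hZ 𝓗 (Z.point v) = (collapseRange 𝓗).point (collapse hZ 𝓗 v) :=
  Subtype.ext Finsupp.mapDomain_single

/-- A path from `z` to `g • z` is closed up by the collapse when `g` fixes the image of `z`. The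
loop contracts in the target, so the path was already closed and `g` fixes `z`. -/
theorem free_of_inducesHomotopyEquiv
    (hfree : ∀ (g : G) (p : Z.Realization), g • p = p → g = 1)
    (h : InducesHomotopyEquiv hZ 𝓗) (g : G) (y : CollapseVertex 𝓗) (hy : g • y = y) : g = 1 := by
  obtain ⟨h, hh⟩ := h
  obtain ⟨z, rfl⟩ := collapse_surjective hZ 𝓗 y
  have hS := isWallStructure hZ
  have hS' := isWallStructure_collapseRange hZ 𝓗
  have hq := hS.isQuotientCoveringMap (fun g u v K => smul_side_eq_iff g u v K) hfree
  have hhq : ∀ p, h.toFun (Quotient.mk _ p) = Quotient.mk _ (collapseMap hZ 𝓗 p) := by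
    intro p
    obtain ⟨p', hp', e⟩ := hh p
    rw [(isCollapseImage_iff hZ 𝓗).1 hp'] at e
    exact e
  obtain ⟨α, hα0, hα1⟩ := hS.exists_path (Z.point z) (Z.point (g • z))
  have hcα : collapseMap hZ 𝓗 (α 0) = collapseMap hZ 𝓗 (α 1) := by
    rw [hα0, hα1, collapseMap_point, collapseMap_point, smul_collapse, hy]
  obtain ⟨D, hD0, hD1, hD⟩ := hS'.exists_contraction
    (.comp ⟨_, continuous_collapseMap hZ 𝓗⟩ α) hcα (collapseMap hZ 𝓗 (α 0))
  have key := hq.eq_of_nullhomotopic h hhq α D hD0 hD1 hD (g := g) (by rw [hα0, hα1, smul_point])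
  rw [hα0, hα1, ← smul_point] at key
  exact hfree g _ key.symm

end CubeComplex

/-! ### Fibres of the collapse and parallelism -/

namespace CubeComplex

variable {G : Type w} [Group G] {V : Type u} [MulAction G V] {Z : CubeComplex V}
  [CubicalAction G Z] (hZ : Z.IsCAT0) (𝓗 : SubMulAction G Z.Hyperplane)

/-- The edge `e` is collapsed to the vertex `x`. -/
def InFiber (x : CollapseVertex 𝓗) (e : Z.Edge) : Prop := ∀ b ∈ e.1, collapse hZ 𝓗 b = x

variable {𝓗}

theorem InFiber.smul {x : CollapseVertex 𝓗} {e : Z.Edge} (h : InFiber hZ 𝓗 x e) (g : G) :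
    InFiber hZ 𝓗 (g • x) (g • e) := by
  intro b hb
  obtain ⟨a, ha, rfl⟩ := Sym2.mem_map.1 hb
  rw [smul_collapse, h a ha]

theorem inFiber_mk {x : CollapseVertex 𝓗} {a b : V} (hab : Z.graph.Adj a b) :
    InFiber hZ 𝓗 x ⟨s(a, b), hab⟩ ↔ collapse hZ 𝓗 a = x ∧ collapse hZ 𝓗 b = x := by
  simp [InFiber]

theorem mem_of_collapse_eq {H : Z.Hyperplane} {a b : V} (hab : s(a, b) ∈ H.dual)
    (h : collapse hZ 𝓗 a = collapse hZ 𝓗 b) : H ∈ 𝓗 := by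
  by_contra hH
  exact side_ne_of_mem_dual hZ hab ((collapse_eq_iff hZ 𝓗).1 h H hH)

theorem collapse_eq_of_mem {H : Z.Hyperplane} {a b : V} (hab : s(a, b) ∈ H.dual) (hH : H ∈ 𝓗) :
    collapse hZ 𝓗 a = collapse hZ 𝓗 b :=
  (collapse_eq_iff hZ 𝓗).2 fun _ hK => side_eq_of_mem_dual hZ hab fun h => hK (h ▸ hH)

/-- Translates of a member of a strongly collapsible family that meet a common fibre of the
collapse are equal. -/
theorem IsStronglyCollapsible.smul_eq (h𝓗 : IsStronglyCollapsible 𝓗) {H : Z.Hyperplane}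
    (hH : H ∈ 𝓗) (g : G) {a a' b b' : V} (ha : s(a, a') ∈ H.dual) (hb : s(b, b') ∈ (g • H).dual)
    (hab : collapse hZ 𝓗 a = collapse hZ 𝓗 b) : g • H = H := by
  by_contra hg
  refine h𝓗 H hH g hg fun K hK => ?_
  obtain ⟨s, hs, t, ht, hst, hHs, hHt⟩ := hK
  by_contra hK
  refine hst ?_
  rw [← side_eq_of_mem_halfspaces hs (hHs (mem_carrier_iff.2 ⟨_, ha⟩)),
    ← side_eq_of_mem_halfspaces ht (hHt (mem_carrier_iff.2 ⟨_, hb⟩))]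
  exact (collapse_eq_iff hZ 𝓗).1 hab K hK

/-- Each hyperplane separating `z` from `g • z` is in `𝓗` and has a dual edge in their common fibre.
So does its translate by `g`, and strongness makes the two equal. The same hyperplanes then separate
`g • z` from `g • g • z`, hence `g • g • z = z`, and `g` preserves a finite set of vertices. -/
theorem IsStronglyCollapsible.free (h𝓗 : IsStronglyCollapsible 𝓗) (hZ : Z.IsCAT0)
    (hfree : ∀ (g : G) (p : Z.Realization), g • p = p → g = 1) (g : G) (y : CollapseVertex 𝓗)
    (hy : g • y = y) : g = 1 := by
  classical
  obtain ⟨z, rfl⟩ := collapse_surjective hZ 𝓗 y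
  rw [← smul_collapse] at hy
  have hfix : ∀ L : Z.Hyperplane, L.side z ≠ L.side (g • z) → g • L = L := by
    intro L hL
    obtain ⟨p, q, hpq, hp⟩ := exists_dual_between hZ hL
    have hL𝓗 : L ∈ 𝓗 := by
      by_contra h
      exact hL ((collapse_eq_iff hZ 𝓗).1 hy L h).symm
    have hpz : collapse hZ 𝓗 p = collapse hZ 𝓗 (g • z) :=
      (collapse_eq_iff hZ 𝓗).2 fun K hK => hp K ((collapse_eq_iff hZ 𝓗).1 hy K hK).symm
    refine h𝓗.smul_eq hZ hL𝓗 g hpq (smul_mem_dual g hpq) ?_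
    rw [smul_collapse, hpz, hy, ← smul_collapse, hy]
  have hinv : ∀ K : Z.Hyperplane, K.side z ≠ K.side (g • z) ↔
      K.side (g • z) ≠ K.side (g • g • z) := by
    intro K
    have h1 : K.side (g • z) = K.side (g • g • z) ↔
        (g⁻¹ • K).side z = (g⁻¹ • K).side (g • z) := by
      rw [← smul_side_eq_iff g z (g • z) (g⁻¹ • K), smul_inv_smul]
    rw [Ne, Ne, h1]
    constructor
    · intro h h'
      rw [inv_smul_eq_iff.2 (hfix K h).symm] at h'
      exact h h'
    · intro h h'
      have h2 := hfix _ h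
      rw [smul_inv_smul] at h2
      rw [← h2] at h
      exact h h'
  have hzz : g • g • z = z := by
    refine eq_of_side_eq hZ fun K => ?_
    by_cases h : K.side z = K.side (g • z)
    · rw [h, ← not_ne_iff.1 (mt (hinv K).2 (not_not.2 h))]
    · rcases side_trichotomy hZ K z (g • z) (g • g • z) with h' | h' | h'
      · exact absurd h' h
      · exact h'.symm
      · exact absurd h' ((hinv K).1 h)
  refine (isWallStructure hZ).eq_one_of_smul_mem (fun g u v K => smul_side_eq_iff g u v K) hfree
    (S := {z, g • z}) (Finset.insert_nonempty _ _) fun v hv => ?_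
  rw [Finset.mem_insert, Finset.mem_singleton] at hv ⊢
  rcases hv with rfl | rfl
  · exact .inr rfl
  · exact .inl hzz

/-! ### Parallelism in the quotient -/

theorem QuotientParallel.exists_parallel {a b : Quotient (MulAction.orbitRel G Z.Edge)}
    (h : QuotientParallel G (Set.univ : Set Z.Square) a b) (e f : Z.Edge)
    (he : Quotient.mk _ e = a) (hf : Quotient.mk _ f = b) :
    ∃ g : G, Z.parallelSetoid e (g • f) := by
  change Relation.EqvGen _ _ _ at h
  induction h generalizing e f with
  | rel a b h =>
    obtain ⟨q, -, rfl, rfl⟩ := h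
    obtain ⟨k, rfl⟩ := Quotient.exact he
    obtain ⟨l, rfl⟩ := Quotient.exact hf
    refine ⟨k * l⁻¹, ?_⟩
    change Z.parallelSetoid (k • q.bottom) ((k * l⁻¹) • l • q.top)
    rw [mul_smul, inv_smul_smul]
    exact Z.smul_parallel k (.rel _ _ ⟨q, rfl, rfl⟩)
  | refl a =>
    obtain ⟨k, rfl⟩ := Quotient.exact (he.trans hf.symm)
    exact ⟨k, Z.parallelSetoid.refl' _⟩
  | symm a b _ ih =>
    obtain ⟨g, hg⟩ := ih f e hf he
    refine ⟨g⁻¹, ?_⟩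
    have := Z.smul_parallel g⁻¹ hg
    rw [inv_smul_smul] at this
    exact Z.parallelSetoid.symm' this
  | trans a b c _ _ ih₁ ih₂ =>
    obtain ⟨m, rfl⟩ := Quotient.exists_rep b
    obtain ⟨g, hg⟩ := ih₁ e m he rfl
    obtain ⟨k, hk⟩ := ih₂ m f rfl hf
    refine ⟨g * k, Z.parallelSetoid.trans' hg ?_⟩
    rw [mul_smul]
    exact Z.smul_parallel g hk

theorem quotientParallel_of_parallel {e f : Z.Edge} (h : Z.parallelSetoid e f) :
    QuotientParallel G (Set.univ : Set Z.Square) (Quotient.mk _ e) (Quotient.mk _ f) := by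
  change Relation.EqvGen _ _ _ at h
  induction h with
  | rel e f h =>
    obtain ⟨q, rfl, rfl⟩ := h
    exact .rel _ _ ⟨q, trivial, rfl, rfl⟩
  | refl e => exact .refl _
  | symm e f _ ih => exact .symm _ _ ih
  | trans e f k _ _ ih₁ ih₂ => exact .trans _ _ _ ih₁ ih₂

/-- Slide the edge along a geodesic from `a` to `b`. The far end of the target edge is separated
from `a` by both `H` and the next hyperplane crossed, which gives a square. Convexity of the fibre,
together with `H ∈ 𝓗`, keeps this square in the fibre. -/
theorem quotientParallel_of_inFiber {x : CollapseVertex 𝓗} {H : Z.Hyperplane} (hH : H ∈ 𝓗)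
    {a a' b b' : V} (ha : s(a, a') ∈ H.dual) (hb : s(b, b') ∈ H.dual) (hab : H.side a = H.side b)
    (hax : collapse hZ 𝓗 a = x) (hbx : collapse hZ 𝓗 b = x) :
    QuotientParallel G (preimageSquares hZ 𝓗 (Quotient.mk _ x))
      (Quotient.mk _ ⟨s(a, a'), adj_of_mem_dual ha⟩)
      (Quotient.mk _ ⟨s(b, b'), adj_of_mem_dual hb⟩) := by
  obtain ⟨n, hn⟩ : ∃ n, Z.graph.dist b a = n := ⟨_, rfl⟩
  induction n generalizing a a' with
  | zero =>
    obtain rfl : b = a := (hZ.connected.dist_eq_zero_iff).1 hn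
    obtain rfl := eq_of_mem_dual_of_mem_dual hZ ha hb
    exact .refl _
  | succ n ih =>
    have hne : a ≠ b := by
      rintro rfl
      rw [SimpleGraph.dist_self] at hn
      omega
    obtain ⟨c, hac, hc⟩ := exists_step hZ hne
    obtain ⟨K, hK⟩ := exists_hyperplane hac
    have hcH := side_eq_of_step hZ hac hc hab
    have hKH : K ≠ H := by
      rintro rfl
      exact side_ne_of_mem_dual hZ hK (hab.trans hcH.symm)
    have hac' : a' ≠ c := by
      rintro rfl
      exact side_ne_of_mem_dual hZ ha (hab.trans hcH.symm)
    obtain ⟨d, hd⟩ := exists_sq_of_side hZ ha hK hac' (v := b')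
      (fun h => side_ne_of_mem_dual hZ hb (hab.symm.trans h.symm)) (by
        rw [← side_eq_of_mem_dual hZ hb hKH, side_ne_of_step hZ hK hc]
        exact (side_ne_of_mem_dual hZ hK).symm)
    have hcd : s(c, d) ∈ H.dual := (hd.mem_dual_iff H).1 ha
    have hcx : collapse hZ 𝓗 c = x := hbx ▸ (collapse_eq_iff hZ 𝓗).2 fun L hL =>
      side_eq_of_step hZ hac hc ((collapse_eq_iff hZ 𝓗).1 (hax.trans hbx.symm) L hL)
    refine .trans _ _ _ (.rel _ _ ?_) (ih hcd hcH hcx (by omega))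
    have hdx := (collapse_eq_of_mem hZ hcd hH).symm.trans hcx
    have hax' := (collapse_eq_of_mem hZ ha hH).symm.trans hax
    obtain ⟨φ, hφ, rfl, rfl, rfl, rfl⟩ := hd
    refine ⟨⟨φ, hφ⟩, ⟨x, rfl, fun ε => ?_⟩, rfl, rfl⟩
    have hε : ε = ![ε 0, ε 1] := by
      ext i
      fin_cases i <;> rfl
    rw [hε]
    cases ε 0 <;> cases ε 1 <;> assumption

/-- A chain of squares lifts step by step: the translate of a square that contains an edge of the
fibre lies in the same fibre, since its vertices have one common image. Both directions are carried
along so that the induction passes through symmetry. -/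
theorem QuotientParallel.exists_parallel_inFiber {x : CollapseVertex 𝓗}
    {a b : Quotient (MulAction.orbitRel G Z.Edge)}
    (h : QuotientParallel G (preimageSquares hZ 𝓗 (Quotient.mk _ x)) a b) :
    (∀ e : Z.Edge, Quotient.mk _ e = a → InFiber hZ 𝓗 x e →
      ∃ f : Z.Edge, Quotient.mk _ f = b ∧ InFiber hZ 𝓗 x f ∧ Z.parallelSetoid e f) ∧
    (∀ f : Z.Edge, Quotient.mk _ f = b → InFiber hZ 𝓗 x f →
      ∃ e : Z.Edge, Quotient.mk _ e = a ∧ InFiber hZ 𝓗 x e ∧ Z.parallelSetoid f e) := by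
  change Relation.EqvGen _ _ _ at h
  induction h with
  | rel a b h =>
    obtain ⟨q, ⟨x', -, hq⟩, rfl, rfl⟩ := h
    have hbot : InFiber hZ 𝓗 x' q.bottom := (inFiber_mk hZ _).2 ⟨hq _, hq _⟩
    have htop : InFiber hZ 𝓗 x' q.top := (inFiber_mk hZ _).2 ⟨hq _, hq _⟩
    have hpar : Z.parallelSetoid q.bottom q.top := .rel _ _ ⟨q, rfl, rfl⟩
    have heq : ∀ (k : G) (e : Z.Edge), InFiber hZ 𝓗 x' e → InFiber hZ 𝓗 x (k • e) →
        k • x' = x := by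
      rintro k ⟨e, he⟩ h h'
      induction e with
      | _ a b =>
        rw [← ((inFiber_mk hZ he).1 h).1, ← smul_collapse]
        exact h' _ (Sym2.mem_map.2 ⟨a, Sym2.mem_mk_left a b, rfl⟩)
    constructor
    · intro e he hex
      obtain ⟨k, rfl⟩ := Quotient.exact he
      refine ⟨k • q.top, Quotient.sound ⟨k, rfl⟩, ?_, Z.smul_parallel k hpar⟩
      rw [← heq k _ hbot hex]
      exact htop.smul hZ k
    · intro e he hex
      obtain ⟨k, rfl⟩ := Quotient.exact he
      refine ⟨k • q.bottom, Quotient.sound ⟨k, rfl⟩, ?_,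
        Z.smul_parallel k (Z.parallelSetoid.symm' hpar)⟩
      rw [← heq k _ htop hex]
      exact hbot.smul hZ k
  | refl a =>
    exact ⟨fun e he hex => ⟨e, he, hex, Z.parallelSetoid.refl' _⟩,
      fun e he hex => ⟨e, he, hex, Z.parallelSetoid.refl' _⟩⟩
  | symm a b _ ih => exact ih.symm
  | trans a b c _ _ ih₁ ih₂ =>
    constructor
    · intro e he hex
      obtain ⟨f, hf, hfx, hef⟩ := ih₁.1 e he hex
      obtain ⟨k, hk, hkx, hfk⟩ := ih₂.1 f hf hfx
      exact ⟨k, hk, hkx, Z.parallelSetoid.trans' hef hfk⟩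
    · intro e he hex
      obtain ⟨f, hf, hfx, hef⟩ := ih₂.2 e he hex
      obtain ⟨k, hk, hkx, hfk⟩ := ih₁.2 f hf hfx
      exact ⟨k, hk, hkx, Z.parallelSetoid.trans' hef hfk⟩

/-- Lift both edges to the same fibre. Parallelism in the quotient makes their hyperplanes
translates of each other; both cross this fibre, so strongness identifies them. -/
theorem IsStronglyCollapsible.quotientParallel (h𝓗 : IsStronglyCollapsible 𝓗)
    (y : Quotient (MulAction.orbitRel G (CollapseVertex 𝓗)))
    {a b : Quotient (MulAction.orbitRel G Z.Edge)} (ha : a ∈ preimageEdges hZ 𝓗 y)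
    (hb : b ∈ preimageEdges hZ 𝓗 y) (h : QuotientParallel G (Set.univ : Set Z.Square) a b) :
    QuotientParallel G (preimageSquares hZ 𝓗 y) a b := by
  obtain ⟨e, rfl, x, rfl, hex⟩ := ha
  obtain ⟨f, rfl, x', hx', hfx⟩ := hb
  obtain ⟨k, rfl⟩ := Quotient.exact hx'
  have hfx' : InFiber hZ 𝓗 x (k⁻¹ • f) := by
    have := InFiber.smul hZ hfx k⁻¹
    rwa [inv_smul_smul] at this
  have hf : (Quotient.mk _ f : Quotient (MulAction.orbitRel G Z.Edge)) = Quotient.mk _ (k⁻¹ • f) :=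
    Quotient.sound ⟨k, smul_inv_smul k f⟩
  rw [hf] at h ⊢
  obtain ⟨g, hg⟩ := h.exists_parallel e _ rfl rfl
  generalize k⁻¹ • f = f at hfx' hg ⊢
  obtain ⟨e, he⟩ := e
  obtain ⟨f, hf⟩ := f
  induction e with
  | _ a a' =>
  induction f with
  | _ b b' =>
  obtain ⟨ha, -⟩ := (inFiber_mk hZ he).1 hex
  obtain ⟨hb, hb'⟩ := (inFiber_mk hZ hf).1 hfx'
  set H : Z.Hyperplane := Quotient.mk _ ⟨s(a, a'), he⟩ with hHdef
  have haH : s(a, a') ∈ H.dual := ⟨he, rfl⟩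
  have hH : H ∈ 𝓗 := mem_of_collapse_eq hZ haH (ha.trans ((inFiber_mk hZ he).1 hex).2.symm)
  have hbH : s(b, b') ∈ (g⁻¹ • H).dual := by
    refine ⟨hf, ?_⟩
    let F : Z.Hyperplane := Quotient.mk _ ⟨s(b, b'), hf⟩
    have h1 : g • F = H := (Quotient.sound hg).symm
    exact (eq_inv_smul_iff.2 h1 : F = g⁻¹ • H)
  rw [h𝓗.smul_eq hZ hH g⁻¹ haH hbH (ha.trans hb.symm)] at hbH
  by_cases hab : H.side a = H.side b
  · exact quotientParallel_of_inFiber hZ hH haH hbH hab ha hb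
  -- Edges are unoriented: reversing the second one puts the compared endpoints on the same side of
  -- `H`.
  · have key := quotientParallel_of_inFiber hZ hH haH (Sym2.eq_swap ▸ hbH : s(b', b) ∈ H.dual)
      (by
        rcases side_trichotomy hZ H a b b' with h | h | h
        · exact absurd h hab
        · exact h
        · exact absurd h (side_ne_of_mem_dual hZ hbH)) ha hb'
    simpa only [Sym2.eq_swap (a := b)] using key

/-- If strongness failed at `H` and `g`, the bridge between the two carriers would give an edge dual
to `H` and one dual to `g • H` in one fibre. They are parallel in the quotient, hence joined there
by squares of the fibre, and the lifted chain ends at a translate of the second edge. -/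
theorem isStronglyCollapsible_of_free (hfree : ∀ (g : G) (y : CollapseVertex 𝓗), g • y = y → g = 1)
    (h : ∀ (y : Quotient (MulAction.orbitRel G (CollapseVertex 𝓗))),
      ∀ a ∈ preimageEdges hZ 𝓗 y, ∀ b ∈ preimageEdges hZ 𝓗 y,
        QuotientParallel G (Set.univ : Set Z.Square) a b →
          QuotientParallel G (preimageSquares hZ 𝓗 y) a b) : IsStronglyCollapsible 𝓗 := by
  intro H hH g hg hsep
  obtain ⟨a, a', b, b', ha, hb, hab⟩ := exists_bridge hZ H (g • H)
  have habx : collapse hZ 𝓗 a = collapse hZ 𝓗 b :=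
    (collapse_eq_iff hZ 𝓗).2 fun K hK => hab K fun hK' => hK (hsep hK')
  have hgH : g • H ∈ 𝓗 := 𝓗.smul_mem g hH
  have hea : InFiber hZ 𝓗 (collapse hZ 𝓗 a) ⟨s(a, a'), adj_of_mem_dual ha⟩ :=
    (inFiber_mk hZ _).2 ⟨rfl, (collapse_eq_of_mem hZ ha hH).symm⟩
  have hfb : InFiber hZ 𝓗 (collapse hZ 𝓗 a) ⟨s(b, b'), adj_of_mem_dual hb⟩ :=
    (inFiber_mk hZ _).2 ⟨habx.symm, (collapse_eq_of_mem hZ hb hgH).symm.trans habx.symm⟩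
  have haH := (mem_dual_iff (adj_of_mem_dual ha) H).1 ha
  have hbH := (mem_dual_iff (adj_of_mem_dual hb) (g • H)).1 hb
  set e : Z.Edge := ⟨s(a, a'), adj_of_mem_dual ha⟩
  set f : Z.Edge := ⟨s(b, b'), adj_of_mem_dual hb⟩
  have hpar : Z.parallelSetoid (g • e) f := by
    refine Quotient.exact (s := Z.parallelSetoid) ?_
    rw [hbH, ← haH]
    rfl
  have hq : QuotientParallel G (Set.univ : Set Z.Square) (Quotient.mk _ e) (Quotient.mk _ f) := by
    have h1 : (Quotient.mk _ e : Quotient (MulAction.orbitRel G Z.Edge)) = Quotient.mk _ (g • e) :=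
      (Quotient.sound ⟨g, rfl⟩ : Quotient.mk (MulAction.orbitRel G Z.Edge) (g • e) = _).symm
    rw [h1]
    exact quotientParallel_of_parallel hpar
  have hfib := h (Quotient.mk _ (collapse hZ 𝓗 a)) _ ⟨e, rfl, _, rfl, hea⟩ _ ⟨f, rfl, _, rfl, hfb⟩ hq
  obtain ⟨f', hf', hfx', hef'⟩ := (hfib.exists_parallel_inFiber hZ).1 e rfl hea
  obtain ⟨l, rfl⟩ := Quotient.exact hf'
  -- The edge `f` and its translate by `l` lie in the same fibre, so `l` fixes a vertex of the
  -- target.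
  have hl : l = 1 := by
    refine hfree l (collapse hZ 𝓗 a) ?_
    have := hfx' (l • b) (Sym2.mem_map.2 ⟨b, Sym2.mem_mk_left b b', rfl⟩)
    rwa [smul_collapse, ← habx] at this
  subst hl
  refine hg ?_
  rw [MulAction.mem_stabilizer_iff, ← hbH, ← haH]
  refine (Quotient.sound (s := Z.parallelSetoid) ?_).symm
  have : (1 : G) • f = f := one_smul G f
  exact this ▸ hef'

end CubeComplex

theorem lemma3p7 {V : Type u} {G : Type w} [Group G] [MulAction G V] (Z : CubeComplex V)
    [CubicalAction G Z] (hZ : Z.IsCAT0)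
    (hfree : ∀ (g : G) (p : Z.Realization), g • p = p → g = 1)
    (𝓗 : SubMulAction G Z.Hyperplane) :
    CubeComplex.IsStronglyCollapsible 𝓗 ↔
      CubeComplex.InducesHomotopyEquiv hZ 𝓗 ∧
        ∀ (y : Quotient (MulAction.orbitRel G (CubeComplex.CollapseVertex 𝓗))),
          ∀ a ∈ CubeComplex.preimageEdges hZ 𝓗 y, ∀ b ∈ CubeComplex.preimageEdges hZ 𝓗 y,
            CubeComplex.QuotientParallel G (Set.univ : Set Z.Square) a b →
              CubeComplex.QuotientParallel G (CubeComplex.preimageSquares hZ 𝓗 y) a b := by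
  constructor
  · intro h
    exact ⟨CubeComplex.inducesHomotopyEquiv_of_free hZ 𝓗 (h.free hZ hfree),
      fun y a ha b hb => h.quotientParallel hZ y ha hb⟩
  · rintro ⟨h₁, h₂⟩
    exact CubeComplex.isStronglyCollapsible_of_free hZ
      (CubeComplex.free_of_inducesHomotopyEquiv hZ 𝓗 hfree h₁) h₂
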